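/- **Setting.** Fix $B>0$ (the battery capacity) and $V$ with $|V|=n$. A *table* is a matrix $M\in(\mathbb R\cup\{-\infty\})^{V\times V}$; $G^M$ is the complete directed graph on $V$ in which the arc $xy$ has gain $M[x][y]$. For a path $P=v_0v_1\dots v_k$ write $|P|=k$. $P$ is *traversable* if a car that starts at $v_0$ with charge $B$ can drive along it, where an arc of gain $g$ changes the charge $b$ to $\min\{B,b+g\}$ and is passable iff $b+g\ge 0$. A *charge drop schedule* for $P$ is $C=(d_0,\dots,d_k)$ with $d_0=0$, $d_i\ge 0$; put $g^{P,C}_{v_i}=\sum_{t<i}M[v_t][v_{t+1}]-\sum_{1\le t\le i}d_t$ and $g^C(P)=g^{P,C}_{v_k}$. $P$ is *monotone* with respect to $C$ if it is traversable and either $0\le g^{P,C}_{v_i}\le g^C(P)$ for all $i$ (ascending) or $0\ge g^{P,C}_{v_i}\ge g^C(P)$ for all $i$ (descending). **The algorithm.** Fix $\alpha,\beta\in(0,1)$. Logarithms in the algorithm have base 2; a maximum over the empty set is $-\infty$; probabilities are truncated to $[0,1]$; "$A\leftarrow_{\max}t$" means $A\leftarrow\max\{A,t\}$; loops run over vertices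 sequentially in a fixed order, and $D_0$ denotes the data structure at the start of a procedure call. A data structure $D$ has entries $D[x][y]$, $D[xy][z]$, $D[x][yz]$. $\mathrm{Init}(M)$ sets $D[x][y]=D[x][xy]=D[xy][y]=M[x][y]$ and all other entries to $-\infty$. *Short-Shortcuts*$(M)$: start with $D=\mathrm{Init}(M)$. For all $x,y,z$: if $M[x][y],M[y][z]\ge0$, then $M_2[x][z]\leftarrow_{\max}M[x][y]+M[y][z]$; otherwise, if $t=\min\{M[x][y],0\}+\min\{M[y][z],0\}\ge -B$, then $M_2[x][z]\leftarrow_{\max}t$ (initially $M_2\equiv-\infty$). After that, $M_3$ is computed in the same way with $M_2[y][z]$ in the place of $M[y][z]$. Set $D[x][z]\leftarrow_{\max}\max\{M_2[x][z],M_3[x][z]\}$. Then for all $x,y,z$, with $m=M[x][y]$: (i) if $m\ge 0$, let $k=\max\{M[y][a]+M[a][z]: -m\le M[y][a]\le 0\}$, and if $k\ge0$ then $D[x][z]\leftarrow_{\max}m+k$; (ii) if $m\le0$, let $k=\max\{M[y][a]+M[a][z]:0\le M[y][a]\le|m|\}$; if $m\ge m+k\ge-B$ then $D[x][z]\leftarrow_{\max}m+k$;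 if $m+k\ge m$ then $D[x][z]\leftarrow_{\max}m$; finally $D[x][z]\leftarrow_{\max}\min\{m,\max\{M[a][z]:M[y][a]\ge|m|\}\}$. Return the table $(D[x][y])_{x,y}$. *Breadth-Search*$(M,D)$: for all $x,y,z$: $D[xy][z]\leftarrow_{\max}M[x][y]+\max_a D_0[ya][z]$ over $a$ with $M[y][a]\in[-M[x][y],0]$ if $M[x][y]\ge0$, and with $M[y][a]\in[0,|M[x][y]|]$ otherwise; symmetrically $D[z][yx]\leftarrow_{\max}\max_aD_0[z][ay]+M[y][x]$ over $a$ with $M[a][y]\in[-M[y][x],0]$ if $M[y][x]\ge0$, and $M[a][y]\in[0,|M[y][x]|]$ otherwise. *Concatenate*$(M,D,U,W,X)$: for all $(u,v,w,x)\in U\times V\times W\times X$: if $M[u][v]<0$, then $D[uv][x]\leftarrow_{\max}D[uv][w]+\max\{D_0[wa][x]: -(D[uv][w]-M[u][v])\le M[w][a]\le0\}$; if $M[v][u]<0$, then $D[x][vu]\leftarrow_{\max}\max\{D_0[x][aw]:-(D[w][vu]-M[v][u])\le M[a][w]\le0\}+D[w][vu]$. *Concatenate-Opposite*$(M,D,U,W,X)$: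 for all $(u,v,w,x)\in U\times V\times W\times X$: if $M[u][v]<0$, then $D[uv][x]\leftarrow_{\max}D[uv][w]+\max\{D_0[w][ax]: M[a][x]\ge0,\ M[a][x]-D_0[w][ax]\le D[uv][w]-M[u][v],\ D_0[w][ax]\le|D[uv][w]|\}$, and then, if some $a$ has $M[a][x]\ge0$, $D_0[w][ax]\ge|D[uv][w]|$ and $M[a][x]\le|M[u][v]|$, set $D[uv][x]\leftarrow0$; if $M[v][u]<0$, then $D[x][vu]\leftarrow_{\max}\max\{D_0[xa][w]: M[x][a]\ge0,\ M[x][a]-D_0[xa][w]\le D[w][vu]-M[v][u],\ D_0[xa][w]\le|D[w][vu]|\}+D[w][vu]$, and then, if some $a$ has $M[x][a]\ge0$, $D_0[xa][w]\ge|D[w][vu]|$ and $M[x][a]\le|M[v][u]|$, set $D[x][vu]\leftarrow0$. *Arc-Bounded-To-Monotone*$(M,D,T)$: for all $(u,v,x,y)\in T\times V^3$: if $M[u][v]\le0$, let $t=D[uv][x]+M[x][y]$; if $-B\le t\le M[u][v]$ then $D[u][y]\leftarrow_{\max}t$; if $t\ge M[u][v]$ then $D[u][y]\leftarrow_{\max}M[u][v]$;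 if $t\ge0$ then $D[v][y]\leftarrow_{\max}t-M[u][v]$. If $M[v][u]\le0$, let $t=M[y][x]+D[x][vu]$; if $-B\le t\le M[v][u]$ then $D[y][u]\leftarrow_{\max}t$; if $t\ge M[v][u]$ then $D[y][u]\leftarrow_{\max}M[v][u]$; if $t\ge 0$ then $D[y][v]\leftarrow_{\max}t-M[v][u]$. *Compute-Funnels*$(M)$: $D=\mathrm{Init}(M)$, $s=c_Fn^\beta$; run Breadth-Search $\lceil n/s\rceil$ times; sample $S\subseteq V$, every vertex independently with probability $c_S\log n\cdot s/n$; run Concatenate$(M,D,S,S,S)$ $\lceil\log n\rceil$ times, then Concatenate$(M,D,S,S,V)$ once, then Breadth-Search $\lceil n/s\rceil$ times; return $D$. *Long-Shortcuts*$(M)$: $D=$ Compute-Funnels$(M)$, $T=\emptyset$. For $i=1,\dots,\lceil\log(n^{1-\alpha}\log^2n)\rceil$: sample $T_i\subseteq V$, every vertex independently with probability $c_T\log^2n/(2^in^\alpha)$; repeat $2^i$ times: Concatenate-Opposite$(M,D,T_i,V,V)$, then Concatenate$(M,D,T_i,V,V)$; set $T\leftarrow T\cup T_i$. Run Arc-Bounded-To-Monotone$(M,D,T)$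 and return the table $(D[x][y])_{x,y}$. *Update-Shortcuts*$(M)$: $r=\lceil c_Rn^\alpha\rceil$, $M'=M$. Repeat $r$ times: with probability $c_L\log n/r$ set $M'\leftarrow\max\{M',\text{Long-Shortcuts}(M)\}$ (entrywise); then $M\leftarrow$ Short-Shortcuts$(M)$. Return $\max\{M,M'\}$. **Statement.** Let $\alpha,\beta\in(0,1)$, $c_R\ge1$, $c_F>0$ and $\delta>0$. There is $K>0$ such that for all $c_L,c_S,c_T\ge K$ there is a constant $c>0$ such that the following holds for all $n$, all $B>0$ and all tables $M$ on $n$ vertices with $M[x][x]\ge0$ for every $x$. Let $P=v_0\dots v_k$ be a simple path that is monotone in $G^M$ with respect to a charge drop schedule $C$, and let $M'$ be the (random) table returned by Update-Shortcuts$(M)$. 1. If $|P|\le n^\alpha$, then $M'[v_0][v_k]\ge g^C(P)$ for every outcome of the random choices. 2. If $|P|>n^\alpha$, then with probability at least $1-n^{-\delta}$ there are a path $P'$ from $v_0$ to $v_k$ and a charge drop schedule $C'$ such that $P'$ is monotone in $G^{M'}$ with respect to $C'$, $g^{C'}(P')\ge g^C(P)$ and $|P'|\le\bigl(1-\frac{c}{\log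 n}\bigr)|P|$. -/

import Mathlib

open scoped ENNReal

noncomputable section

namespace EnergyPaths

/-! ## Tables and paths

Gains are real numbers or `-∞` (the bottom element `⊥`), and `⊥ + t = ⊥`. The vertex set is `Fin n`.
A table `M` is identified with the complete directed graph `G^M` in which the arc `xy` has gain
`M x y`. -/

/-- A gain: a real number, or `⊥` for `-∞`. -/
abbrev Gain : Type := WithBot ℝ

/-- A table of shortcuts on the vertices `0, …, n - 1`. -/
abbrev Table (n : ℕ) : Type := Fin n → Fin n → Gain

/-- The charge with which a car with battery capacity `B` that starts at `v 0` with charge `b`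
reaches `v i` along `v 0, v 1, …` in `G^M`; it is `⊥` if the car gets stuck on the way. -/
def charge {n : ℕ} (B : ℝ) (M : Table n) (v : ℕ → Fin n) (b : ℝ) : ℕ → Gain
  | 0 => ((min B b : ℝ) : Gain)
  | i + 1 =>
      if 0 ≤ charge B M v b i + M (v i) (v (i + 1)) then
        min (B : Gain) (charge B M v b i + M (v i) (v (i + 1)))
      else ⊥

/-- The path `v 0, …, v k` can be traversed when the battery is full at `v 0`. -/
def Traversable {n : ℕ} (B : ℝ) (M : Table n) (v : ℕ → Fin n) (k : ℕ) : Prop :=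
  0 ≤ charge B M v B k

/-- `C` is a charge drop schedule for a path `v 0, …, v k`: the charge `C i ≥ 0` is dropped at
`v i`, and nothing is dropped at `v 0`. -/
def IsSchedule (C : ℕ → ℝ) (k : ℕ) : Prop :=
  C 0 = 0 ∧ ∀ i ≤ k, 0 ≤ C i

/-- The gain at `v i` along `v 0, v 1, …` with respect to the schedule `C`: the sum of the gains
of the first `i` arcs minus the charge dropped at `v 1, …, v i`. -/
def gainAt {n : ℕ} (M : Table n) (v : ℕ → Fin n) (C : ℕ → ℝ) (i : ℕ) : Gain :=
  ∑ t ∈ Finset.range i, (M (v t) (v (t + 1)) + ((-C (t + 1) : ℝ) : Gain))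

/-- The path is ascending with respect to `C`. -/
def Ascending {n : ℕ} (M : Table n) (v : ℕ → Fin n) (k : ℕ) (C : ℕ → ℝ) : Prop :=
  ∀ i ≤ k, 0 ≤ gainAt M v C i ∧ gainAt M v C i ≤ gainAt M v C k

/-- The path is descending with respect to `C`. -/
def Descending {n : ℕ} (M : Table n) (v : ℕ → Fin n) (k : ℕ) (C : ℕ → ℝ) : Prop :=
  ∀ i ≤ k, gainAt M v C i ≤ 0 ∧ gainAt M v C k ≤ gainAt M v C i

/-- The path `v 0, …, v k` (with `k` arcs) is monotone in `G^M` with respect to the charge drop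
schedule `C`. Only the values of `v` and `C` at indices `≤ k` matter. -/
def IsMonotonePath {n : ℕ} (B : ℝ) (M : Table n) (v : ℕ → Fin n) (k : ℕ) (C : ℕ → ℝ) : Prop :=
  Traversable B M v k ∧ IsSchedule C k ∧ (Ascending M v k C ∨ Descending M v k C)

/-- The path `v 0, …, v k` is simple: it visits no vertex twice. -/
def IsSimplePath {n : ℕ} (v : ℕ → Fin n) (k : ℕ) : Prop :=
  Set.InjOn v (Set.Iic k)

/-! ## Loops and the data structure -/

/-- `for i in l do s ← f i s`. -/
def forEach {ι σ : Type} (l : List ι) (s : σ) (f : ι → σ → σ) : σ :=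
  l.foldl (fun s i => f i s) s

/-- All vertices, in increasing order. -/
def verts (n : ℕ) : List (Fin n) := List.finRange n

/-- The vertices of `U`, in increasing order. -/
def elems {n : ℕ} (U : Finset (Fin n)) : List (Fin n) := (verts n).filter (· ∈ U)

/-- `T[x][z] ← max {T[x][z], t}`. -/
def Table.raise {n : ℕ} (T : Table n) (x z : Fin n) (t : Gain) : Table n :=
  fun a b => if a = x ∧ b = z then max (T a b) t else T a b

/-- The result of a range tree query: the largest second key `key a` among the vertices `a` that
satisfy the range condition `p`, and `-∞` if there is none. -/
def rangeMax {n : ℕ} (p : Fin n → Prop) (key : Fin n → Gain) : Gain :=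
  open Classical in (Finset.univ.filter p).sup key

/-- The data structure: `short x y` is `D[x][y]`, `first x y z` is `D[xy][z]` and
`last x y z` is `D[x][yz]`. -/
structure DS (n : ℕ) where
  short : Table n
  first : Fin n → Fin n → Fin n → Gain
  last : Fin n → Fin n → Fin n → Gain

namespace DS

variable {n : ℕ}

/-- `D[x][z] ← max {D[x][z], t}`. -/
def raiseShort (D : DS n) (x z : Fin n) (t : Gain) : DS n :=
  { D with short := D.short.raise x z t }

/-- `D[uv][x] ← t`. -/
def setFirst (D : DS n) (u v x : Fin n) (t : Gain) : DS n :=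
  { D with first := fun a b c => if a = u ∧ b = v ∧ c = x then t else D.first a b c }

/-- `D[x][vu] ← t`. -/
def setLast (D : DS n) (x v u : Fin n) (t : Gain) : DS n :=
  { D with last := fun a b c => if a = x ∧ b = v ∧ c = u then t else D.last a b c }

/-- `D[uv][x] ← max {D[uv][x], t}`. -/
def raiseFirst (D : DS n) (u v x : Fin n) (t : Gain) : DS n :=
  D.setFirst u v x (max (D.first u v x) t)

/-- `D[x][vu] ← max {D[x][vu], t}`. -/
def raiseLast (D : DS n) (x v u : Fin n) (t : Gain) : DS n :=
  D.setLast x v u (max (D.last x v u) t)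

/-- Initialization: `D[x][y] = D[x][xy] = D[xy][y] = M[x][y]`, everything else is `-∞`. -/
def init (M : Table n) : DS n where
  short := M
  first := fun x y z => if z = y then M x y else ⊥
  last := fun x y z => if x = y then M y z else ⊥

end DS

/-! ## The deterministic procedures

In the range conditions below an inequality such as `-M[x][y] ≤ k₁` is written as
`0 ≤ M[x][y] + k₁`, since gains may be `-∞`. Likewise `k₁ ≤ |m|` is written `m + k₁ ≤ 0` and
`|m| ≤ k₁` is written `0 ≤ m + k₁` where `m ≤ 0`. -/

section Deterministic

variable {n : ℕ}

/-- The table `M₂` of 2-shortcuts. -/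
def twoShortcuts (B : ℝ) (M : Table n) : Table n :=
  forEach (verts n) (fun _ _ => ⊥) fun x T =>
  forEach (verts n) T fun y T =>
  forEach (verts n) T fun z T =>
    if 0 ≤ M x y ∧ 0 ≤ M y z then
      T.raise x z (M x y + M y z)
    else if ((-B : ℝ) : Gain) ≤ min (M x y) 0 + min (M y z) 0 then
      T.raise x z (min (M x y) 0 + min (M y z) 0)
    else T

/-- The table `M₃` of easy 3-shortcuts. -/
def threeShortcuts (B : ℝ) (M M₂ : Table n) : Table n :=
  forEach (verts n) (fun _ _ => ⊥) fun x T =>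
  forEach (verts n) T fun y T =>
  forEach (verts n) T fun z T =>
    if 0 ≤ M x y ∧ 0 ≤ M₂ y z then
      T.raise x z (M x y + M₂ y z)
    else if ((-B : ℝ) : Gain) ≤ min (M x y) 0 + min (M₂ y z) 0 then
      T.raise x z (min (M x y) 0 + min (M₂ y z) 0)
    else T

/-- Trivial-Shortcuts. -/
def trivialShortcuts (B : ℝ) (M : Table n) (D : DS n) : DS n :=
  { D with
    short := fun x z => max (D.short x z)
      (max (twoShortcuts B M x z) (threeShortcuts B M (twoShortcuts B M) x z)) }

/-- The body of the main loop of Short-Shortcuts. -/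
def shortStep (B : ℝ) (M : Table n) (x y z : Fin n) (D : DS n) : DS n :=
  let D :=
    if 0 ≤ M x y then
      let k₂ := rangeMax (fun a => 0 ≤ M x y + M y a ∧ M y a ≤ 0) (fun a => M y a + M a z)
      if M x y ≤ M x y + k₂ then D.raiseShort x z (M x y + k₂) else D
    else D
  if M x y ≤ 0 then
    let k₂ := rangeMax (fun a => 0 ≤ M y a ∧ M x y + M y a ≤ 0) (fun a => M y a + M a z)
    let D :=
      if M x y + k₂ ≤ M x y ∧ ((-B : ℝ) : Gain) ≤ M x y + k₂ then
        D.raiseShort x z (M x y + k₂)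
      else D
    let D := if M x y ≤ M x y + k₂ then D.raiseShort x z (M x y) else D
    let k₂' := rangeMax (fun a => 0 ≤ M x y + M y a) (fun a => M a z)
    D.raiseShort x z (min (M x y) k₂')
  else D

/-- Short-Shortcuts. -/
def shortShortcuts (B : ℝ) (M : Table n) : Table n :=
  (forEach (verts n) (trivialShortcuts B M (DS.init M)) fun x D =>
    forEach (verts n) D fun y D =>
    forEach (verts n) D fun z D => shortStep B M x y z D).short

/-- The body of the loop of Breadth-Search; `D₀` is the data structure at the beginning of the
call, from which the range trees were built. -/
def breadthStep (M : Table n) (D₀ : DS n) (x y z : Fin n) (D : DS n) : DS n :=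
  let D :=
    if 0 ≤ M x y then
      D.raiseFirst x y z (M x y +
        rangeMax (fun a => 0 ≤ M x y + M y a ∧ M y a ≤ 0) (fun a => D₀.first y a z))
    else
      D.raiseFirst x y z (M x y +
        rangeMax (fun a => 0 ≤ M y a ∧ M x y + M y a ≤ 0) (fun a => D₀.first y a z))
  if 0 ≤ M y x then
    D.raiseLast z y x (rangeMax (fun a => 0 ≤ M y x + M a y ∧ M a y ≤ 0)
      (fun a => D₀.last z a y) + M y x)
  else
    D.raiseLast z y x (rangeMax (fun a => 0 ≤ M a y ∧ M y x + M a y ≤ 0)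
      (fun a => D₀.last z a y) + M y x)

/-- Breadth-Search. -/
def breadthSearch (M : Table n) (D₀ : DS n) : DS n :=
  forEach (verts n) D₀ fun x D =>
  forEach (verts n) D fun y D =>
  forEach (verts n) D fun z D => breadthStep M D₀ x y z D

/-- The body of the loop of Concatenate. The range condition
`-(D[uv][w] - M[u][v]) ≤ M[w][a] ≤ 0` reads `M[u][v] ≤ D[uv][w] + M[w][a]` and `M[w][a] ≤ 0`. -/
def concatStep (M : Table n) (D₀ : DS n) (u v w x : Fin n) (D : DS n) : DS n :=
  let D :=
    if M u v < 0 then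
      D.raiseFirst u v x (D.first u v w +
        rangeMax (fun a => M u v ≤ D.first u v w + M w a ∧ M w a ≤ 0) (fun a => D₀.first w a x))
    else D
  if M v u < 0 then
    D.raiseLast x v u (rangeMax (fun a => M v u ≤ D.last w v u + M a w ∧ M a w ≤ 0)
      (fun a => D₀.last x a w) + D.last w v u)
  else D

/-- Concatenate. -/
def concatenate (M : Table n) (U W X : Finset (Fin n)) (D₀ : DS n) : DS n :=
  forEach (elems U) D₀ fun u D =>
  forEach (verts n) D fun v D =>
  forEach (elems W) D fun w D =>
  forEach (elems X) D fun x D => concatStep M D₀ u v w x D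

/-- The body of the loop of Concatenate-Opposite. Here `D[uv][w] ≤ 0` when `M[u][v] < 0`, so that
the range condition `M[a][x] - D[w][ax] ≤ D[uv][w] - M[u][v]` and `D[w][ax] ≤ |D[uv][w]|` reads
`M[a][x] + M[u][v] ≤ D[uv][w] + D[w][ax]` and `D[uv][w] + D[w][ax] ≤ 0`. -/
def concatOppositeStep (M : Table n) (D₀ : DS n) (u v w x : Fin n) (D : DS n) : DS n :=
  open Classical in
  let D :=
    if M u v < 0 then
      let m := D.first u v w
      let D := D.raiseFirst u v x (m + rangeMax
        (fun a => 0 ≤ M a x ∧ M a x + M u v ≤ m + D₀.last w a x ∧ m + D₀.last w a x ≤ 0)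
        (fun a => D₀.last w a x))
      let m := D.first u v w
      if ∃ a, 0 ≤ M a x ∧ 0 ≤ m + D₀.last w a x ∧ M a x + M u v ≤ 0 then D.setFirst u v x 0
      else D
    else D
  if M v u < 0 then
    let m := D.last w v u
    let D := D.raiseLast x v u (rangeMax
      (fun a => 0 ≤ M x a ∧ M x a + M v u ≤ D₀.first x a w + m ∧ D₀.first x a w + m ≤ 0)
      (fun a => D₀.first x a w) + m)
    let m := D.last w v u
    if ∃ a, 0 ≤ M x a ∧ 0 ≤ D₀.first x a w + m ∧ M x a + M v u ≤ 0 then D.setLast x v u 0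
    else D
  else D

/-- Concatenate-Opposite. -/
def concatOpposite (M : Table n) (U W X : Finset (Fin n)) (D₀ : DS n) : DS n :=
  forEach (elems U) D₀ fun u D =>
  forEach (verts n) D fun v D =>
  forEach (elems W) D fun w D =>
  forEach (elems X) D fun x D => concatOppositeStep M D₀ u v w x D

/-- The body of the loop of Arc-Bounded-To-Monotone. -/
def boundedStep (B : ℝ) (M : Table n) (u v x y : Fin n) (D : DS n) : DS n :=
  let D :=
    if M u v ≤ 0 then
      let t := D.first u v x + M x y
      let D := if ((-B : ℝ) : Gain) ≤ t ∧ t ≤ M u v then D.raiseShort u y t else D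
      let D := if M u v ≤ t then D.raiseShort u y (M u v) else D
      if 0 ≤ t then D.raiseShort v y (WithBot.map (fun r : ℝ => -r) (M u v) + t) else D
    else D
  if M v u ≤ 0 then
    let t := M y x + D.last x v u
    let D := if ((-B : ℝ) : Gain) ≤ t ∧ t ≤ M v u then D.raiseShort y u t else D
    let D := if M v u ≤ t then D.raiseShort y u (M v u) else D
    if 0 ≤ t then D.raiseShort y v (t + WithBot.map (fun r : ℝ => -r) (M v u)) else D
  else D

/-- Arc-Bounded-To-Monotone. -/
def arcBoundedToMonotone (B : ℝ) (M : Table n) (T : Finset (Fin n)) (D : DS n) : DS n :=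
  forEach (elems T) D fun u D =>
  forEach (verts n) D fun v D =>
  forEach (verts n) D fun x D =>
  forEach (verts n) D fun y D => boundedStep B M u v x y D

end Deterministic

/-! ## The randomized procedures -/

/-- A coin that shows `true` with probability `p`, where `p` is truncated to `[0, 1]`: the outcome
of the test `rand < p` for `rand` uniform in `[0, 1]`. -/
def coin (p : ℝ) : PMF Bool :=
  PMF.ofFintype
    (fun b => if b then ENNReal.ofReal (min 1 p) else 1 - ENNReal.ofReal (min 1 p))
    (by simp)

/-- Every element of the list is put into the sample independently with probability `p`. -/
def sampleList {n : ℕ} (p : ℝ) : List (Fin n) → PMF (Finset (Fin n))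
  | [] => PMF.pure ∅
  | v :: l => (coin p).bind fun b =>
      (sampleList p l).map fun S => if b then insert v S else S

/-- `Sample(V, p)`: every vertex is sampled independently with probability `p`. -/
def sample (n : ℕ) (p : ℝ) : PMF (Finset (Fin n)) := sampleList p (verts n)

/-- The constants of the algorithm: the exponents `α` and `β`, and the constant factors in
`r = ⌈cRounds · n^α⌉` (number of rounds), in `s = cFunnel · n^β`, in the probability
`cLong · log n / r` of a call of Long-Shortcuts, and in the sampling probabilities
`cSample · log n · s / n` of Compute-Funnels and `cLevel · log² n / (2^i n^α)` of Long-Shortcuts. -/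
structure Params where
  α : ℝ
  β : ℝ
  cRounds : ℝ
  cFunnel : ℝ
  cLong : ℝ
  cSample : ℝ
  cLevel : ℝ

section Randomized

variable {n : ℕ}

/-- Compute-Funnels. -/
def computeFunnels (Θ : Params) (M : Table n) : PMF (DS n) :=
  let s : ℝ := Θ.cFunnel * (n : ℝ) ^ Θ.β
  let q : ℕ := ⌈(n : ℝ) / s⌉₊
  (sample n (Θ.cSample * Real.logb 2 n * s / n)).map fun S =>
    let D := (breadthSearch M)^[q] (DS.init M)
    let D := (concatenate M S S S)^[Nat.clog 2 n] D
    let D := concatenate M S S Finset.univ D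
    (breadthSearch M)^[q] D

/-- The main loop of Long-Shortcuts over the levels `i` in a list; the state is the data structure
together with the set of all vertices sampled so far. -/
def longLevels (Θ : Params) (M : Table n) : List ℕ → DS n → Finset (Fin n) →
    PMF (DS n × Finset (Fin n))
  | [], D, T => PMF.pure (D, T)
  | i :: l, D, T =>
      (sample n (Θ.cLevel * Real.logb 2 n ^ 2 / (2 ^ i * (n : ℝ) ^ Θ.α))).bind fun Ti =>
        longLevels Θ M l
          ((fun D => concatenate M Ti Finset.univ Finset.univ
            (concatOpposite M Ti Finset.univ Finset.univ D))^[2 ^ i] D)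
          (T ∪ Ti)

/-- Long-Shortcuts. The levels are `i = 1, …, ⌈log (n^(1-α) log² n)⌉`. -/
def longShortcuts (Θ : Params) (B : ℝ) (M : Table n) : PMF (Table n) :=
  (computeFunnels Θ M).bind fun D =>
    (longLevels Θ M
      (List.range' 1 ⌈Real.logb 2 ((n : ℝ) ^ (1 - Θ.α) * Real.logb 2 n ^ 2)⌉₊) D ∅).map
      fun s => (arcBoundedToMonotone B M s.2 s.1).short

/-- The given number of rounds of Update-Shortcuts, where each round calls Long-Shortcuts with
probability `p`. The state is the pair `(M, M')`, and the result is `max {M, M'}`. -/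
def rounds (Θ : Params) (B p : ℝ) : ℕ → Table n → Table n → PMF (Table n)
  | 0, M, M' => PMF.pure (M ⊔ M')
  | j + 1, M, M' =>
      (coin p).bind fun b =>
        (if b then (longShortcuts Θ B M).map (fun L => M' ⊔ L) else PMF.pure M').bind fun M' =>
          rounds Θ B p j (shortShortcuts B M) M'

/-- Update-Shortcuts: the distribution of the table that it returns on the table `M`. -/
def updateShortcuts (Θ : Params) (B : ℝ) (M : Table n) : PMF (Table n) :=
  let r : ℕ := ⌈Θ.cRounds * (n : ℝ) ^ Θ.α⌉₊
  rounds Θ B (Θ.cLong * Real.logb 2 n / r) r M M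

end Randomized

end EnergyPaths

end

open EnergyPaths

/-! A monotone path with its drop schedule is replaced by a gain profile (`Profile`): real values at
the vertices that rise along an arc by at most its gain, never fall by more than `B`, and stay
between the two end values. A subsequence of the vertices inherits the profile. So everything
reduces to finding disjoint stretches of the path that a new table bridges at least as well as the
profile does (`exists_skip`, `Profile.skip`).

Short-Shortcuts bridges two neighbouring arcs of the same direction, and three arcs whose middle one
is a weak minimum in absolute value. This holds for the table gains as well as for the increments of
the profile. Call such places events. A monotone path with at least two arcs has a shortcut of this
kind (`Profile.exists_covers`): otherwise the increments would alternate and shrink strictly, and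
the last vertex could not be extremal. Hence every round saves an arc, which gives the first claim.
In general a round saves at least a third of the number of events (`Profile.exists_skip_events`).

For the second claim, the tables on which the rounds work do not depend on the random choices, so
one path can be followed through all rounds. Either Short-Shortcuts alone shortens it enough, or at
least half of the rounds see at most a fraction `1 / (1024 n^α)` of events (`card_good_rounds`). In
such a round the path is, between events, an expanding funnel followed by a contracting one
(`Walk.exists_peak`). A descending arc followed by a smaller one (a descent) bounds the path up to
its `exit`, and there is an event in between (`Walk.eventsInside_nonempty`). With constant
probability Compute-Funnels knows all funnels of the path. Then each repetition of the two
concatenations carries the entry of a sampled descent past one more event, up to the exit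
(`levelStep_iterate`), where Arc-Bounded-To-Monotone turns it into a shortcut (`Walk.covers_exit`).

Descents are sorted into levels by the number of events before the exit, up to a factor of two.
Inside an outermost descent, the descents of one level are nested (`Walk.level_nested`), and there
are few outermost ones because their events are disjoint. If the sample hits one of the first `c`
descents of each large nest, all but about `c` arcs per nest are saved (`Walk.exists_skip_level`).
Some level, in the path or its reversal, holds a share of order `1 / log n` of all arcs, so one call
of Long-Shortcuts in a good round succeeds with probability at least `1/2`
(`longShortcuts_success`). The failure probabilities of the good rounds multiply to `n^(-d)`
(`rounds_fail_le`, `rounds_success`). -/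

open scoped ENNReal

noncomputable section

namespace EnergyPaths

variable {n : ℕ}

/-! ### Invariants of nested loops -/

section Loops

variable {ι ι' ι₁ ι₂ ι₃ ι₄ σ τ : Type}

lemma forEach_inv {P : σ → Prop} {f : ι → σ → σ} {l : List ι} {s : σ}
    (h : ∀ i ∈ l, ∀ s, P s → P (f i s)) (hs : P s) : P (forEach l s f) := by
  unfold forEach
  induction l generalizing s with
  | nil => exact hs
  | cons a l ih =>
    exact ih (fun i hi => h i (List.mem_cons_of_mem _ hi)) (h a List.mem_cons_self s hs)

/-- One iteration establishes `Q` and no later one destroys it; `P` records what is known of every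
state, including those before the hit. The lower bounds on table entries all arise in this way. -/
lemma forEach_hit {P Q : σ → Prop} {f : ι → σ → σ} {l : List ι} {s : σ} {i : ι} (hi : i ∈ l)
    (hP : ∀ i ∈ l, ∀ s, P s → P (f i s)) (hQ : ∀ i ∈ l, ∀ s, P s → Q s → Q (f i s))
    (hit : ∀ s, P s → Q (f i s)) (hs : P s) : Q (forEach l s f) := by
  unfold forEach
  induction l generalizing s with
  | nil => simp at hi
  | cons a l ih =>
    have hP' := hP a List.mem_cons_self s hs
    rcases List.mem_cons.1 hi with rfl | hi
    · have := forEach_inv (P := fun s => P s ∧ Q s) (f := f) (l := l) (s := f i s)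
        (fun j hj s hs => ⟨hP j (List.mem_cons_of_mem _ hj) s hs.1,
          hQ j (List.mem_cons_of_mem _ hj) s hs.1 hs.2⟩) ⟨hP', hit s hs⟩
      exact this.2
    · exact ih hi (fun j hj => hP j (List.mem_cons_of_mem _ hj))
        (fun j hj => hQ j (List.mem_cons_of_mem _ hj)) hP'

lemma forEach_map {f : ι → σ → σ} {f' : ι → τ → τ} (φ : σ → τ) (l : List ι)
    (h : ∀ i s, φ (f i s) = f' i (φ s)) (s : σ) :
    φ (forEach l s f) = forEach l (φ s) f' := by
  unfold forEach
  induction l generalizing s with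
  | nil => rfl
  | cons a l ih => simp only [List.foldl_cons]; rw [ih, h]

lemma forEach3_inv {P : σ → Prop} {f : ι₁ → ι₂ → ι₃ → σ → σ} {l₁ : List ι₁} {l₂ : List ι₂}
    {l₃ : List ι₃} {s : σ} (h : ∀ a b c s, P s → P (f a b c s)) (hs : P s) :
    P (forEach l₁ s fun a s => forEach l₂ s fun b s => forEach l₃ s fun c s => f a b c s) :=
  forEach_inv (fun a _ _ hs => forEach_inv (fun b _ _ hs =>
    forEach_inv (fun c _ s hs => h a b c s hs) hs) hs) hs

lemma forEach3_hit {P Q : σ → Prop} {f : ι₁ → ι₂ → ι₃ → σ → σ} {l₁ : List ι₁} {l₂ : List ι₂}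
    {l₃ : List ι₃} {s : σ} {a : ι₁} {b : ι₂} {c : ι₃} (ha : a ∈ l₁) (hb : b ∈ l₂) (hc : c ∈ l₃)
    (hP : ∀ a b c s, P s → P (f a b c s)) (hQ : ∀ a b c s, P s → Q s → Q (f a b c s))
    (hit : ∀ s, P s → Q (f a b c s)) (hs : P s) :
    Q (forEach l₁ s fun a s => forEach l₂ s fun b s => forEach l₃ s fun c s => f a b c s) := by
  have hPQ : ∀ a b c s, P s ∧ Q s → P (f a b c s) ∧ Q (f a b c s) :=
    fun a b c s h => ⟨hP a b c s h.1, hQ a b c s h.1 h.2⟩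
  refine forEach_hit (P := P) ha (fun a _ s hs => ?_) (fun a _ s hs hq => ?_) (fun s hs => ?_) hs
  · exact forEach_inv (fun b _ _ hs => forEach_inv (fun c _ s hs => hP a b c s hs) hs) hs
  · exact (forEach_inv (P := fun s => P s ∧ Q s) (fun b _ _ hs =>
      forEach_inv (P := fun s => P s ∧ Q s) (fun c _ s hs => hPQ a b c s hs) hs) ⟨hs, hq⟩).2
  · refine forEach_hit (P := P) hb (fun b _ s hs => ?_) (fun b _ s hs hq => ?_) (fun s hs => ?_) hs
    · exact forEach_inv (fun c _ s hs => hP a b c s hs) hs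
    · exact (forEach_inv (P := fun s => P s ∧ Q s) (fun c _ s hs => hPQ a b c s hs) ⟨hs, hq⟩).2
    · exact forEach_hit (P := P) hc (fun c _ s hs => hP a b c s hs)
        (fun c _ s hs hq => hQ a b c s hs hq) hit hs

lemma forEach4_inv {P : σ → Prop} {f : ι₁ → ι₂ → ι₃ → ι₄ → σ → σ} {l₁ : List ι₁}
    {l₂ : List ι₂} {l₃ : List ι₃} {l₄ : List ι₄} {s : σ}
    (h : ∀ a b c d s, P s → P (f a b c d s)) (hs : P s) :
    P (forEach l₁ s fun a s => forEach l₂ s fun b s => forEach l₃ s fun c s =>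
      forEach l₄ s fun d s => f a b c d s) :=
  forEach_inv (fun a _ _ hs => forEach3_inv (h a) hs) hs

lemma forEach4_hit {P Q : σ → Prop} {f : ι₁ → ι₂ → ι₃ → ι₄ → σ → σ} {l₁ : List ι₁}
    {l₂ : List ι₂} {l₃ : List ι₃} {l₄ : List ι₄} {s : σ} {a : ι₁} {b : ι₂} {c : ι₃} {d : ι₄}
    (ha : a ∈ l₁) (hb : b ∈ l₂) (hc : c ∈ l₃) (hd : d ∈ l₄)
    (hP : ∀ a b c d s, P s → P (f a b c d s))
    (hQ : ∀ a b c d s, P s → Q s → Q (f a b c d s))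
    (hit : ∀ s, P s → Q (f a b c d s)) (hs : P s) :
    Q (forEach l₁ s fun a s => forEach l₂ s fun b s => forEach l₃ s fun c s =>
      forEach l₄ s fun d s => f a b c d s) := by
  refine forEach_hit (P := P) ha (fun a _ s hs => forEach3_inv (hP a) hs) (fun a _ s hs hq => ?_)
    (fun s hs => forEach3_hit hb hc hd (hP a) (hQ a) hit hs) hs
  exact (forEach3_inv (P := fun s => P s ∧ Q s)
    (fun b c d s h => ⟨hP a b c d s h.1, hQ a b c d s h.1 h.2⟩) ⟨hs, hq⟩).2

end Loops

lemma mem_verts {n : ℕ} (x : Fin n) : x ∈ verts n := List.mem_finRange x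

lemma mem_elems {n : ℕ} {U : Finset (Fin n)} {x : Fin n} : x ∈ elems U ↔ x ∈ U := by
  simp [elems, mem_verts]

lemma le_rangeMax {n : ℕ} {p : Fin n → Prop} {key : Fin n → Gain} {a : Fin n} (h : p a) :
    key a ≤ rangeMax p key := by
  classical
  unfold rangeMax
  exact Finset.le_sup (f := key) (by simp [h])

lemma rangeMax_le {n : ℕ} {p : Fin n → Prop} {key : Fin n → Gain} {c : Gain}
    (h : ∀ a, p a → key a ≤ c) : rangeMax p key ≤ c := by
  classical
  unfold rangeMax
  exact Finset.sup_le fun a ha => h a (by simpa using ha)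

/-! ### Symmetry of the data structure under reversal of the graph -/

/-- The table of the reversed graph. -/
def Table.rev {n : ℕ} (M : Table n) : Table n := fun x y => M y x

namespace DS

/-- The data structure for the reversed graph. -/
def swap (D : DS n) : DS n where
  short := fun x y => D.short y x
  first := fun x y z => D.last z y x
  last := fun x y z => D.first z y x

/-- The entries for paths of bounded gain increase from `D` to `D'`. -/
def Le (D D' : DS n) : Prop :=
  (∀ x y z, D.first x y z ≤ D'.first x y z) ∧ ∀ x y z, D.last x y z ≤ D'.last x y z

lemma Le.refl (D : DS n) : D.Le D := ⟨fun _ _ _ => le_rfl, fun _ _ _ => le_rfl⟩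

lemma Le.trans {D D' D'' : DS n} (h : D.Le D') (h' : D'.Le D'') : D.Le D'' :=
  ⟨fun x y z => (h.1 x y z).trans (h'.1 x y z), fun x y z => (h.2 x y z).trans (h'.2 x y z)⟩

lemma Le.swap {D D' : DS n} (h : D.Le D') : D.swap.Le D'.swap :=
  ⟨fun x y z => h.2 z y x, fun x y z => h.1 z y x⟩

/-- An entry for paths whose gain is bounded by a designated arc does not exceed the
upper end of the range of that arc. -/
def Bounded (M : Table n) (D : DS n) : Prop :=
  (∀ x y z, D.first x y z ≤ max 0 (M x y)) ∧ ∀ x y z, D.last x y z ≤ max 0 (M y z)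

lemma Bounded.swap {M : Table n} {D : DS n} (h : D.Bounded M) : D.swap.Bounded M.rev :=
  ⟨fun x y z => h.2 z y x, fun x y z => h.1 z y x⟩

lemma bounded_init (M : Table n) : (init M).Bounded M := by
  constructor <;> intro x y z <;> simp only [init] <;> split_ifs <;> simp_all

lemma swap_init (M : Table n) : (init M).swap = init M.rev := by
  simp only [init, swap, Table.rev]
  congr

lemma eq_of_fields {D D' : DS n} (h₁ : D.short = D'.short) (h₂ : D.first = D'.first)
    (h₃ : D.last = D'.last) : D = D' := by
  cases D; cases D'; simp_all

end DS

/-- The array `f` with the entry `f u v x` changed to `t`. -/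
def setEntry {n : ℕ} (f : Fin n → Fin n → Fin n → Gain) (u v x : Fin n) (t : Gain) :
    Fin n → Fin n → Fin n → Gain :=
  fun a b c => if a = u ∧ b = v ∧ c = x then t else f a b c

section Swap

lemma setEntry_reverse (L : Fin n → Fin n → Fin n → Gain) (u v x a b c : Fin n) (t : Gain) :
    setEntry (fun p q r => L r q p) u v x t c b a =
      if a = x ∧ b = v ∧ c = u then t else L a b c := by
  unfold setEntry
  congr 1
  exact propext ⟨fun h => ⟨h.2.2, h.2.1, h.1⟩, fun h => ⟨h.2.2, h.2.1, h.1⟩⟩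

/-- The effect of `breadthStep` on the field `first`. -/
def breadthFirst (M : Table n) (D₀ : DS n) (x y z : Fin n) (f : Fin n → Fin n → Fin n → Gain) :
    Fin n → Fin n → Fin n → Gain :=
  setEntry f x y z (max (f x y z) (M x y +
    if 0 ≤ M x y then
      rangeMax (fun a => 0 ≤ M x y + M y a ∧ M y a ≤ 0) (fun a => D₀.first y a z)
    else rangeMax (fun a => 0 ≤ M y a ∧ M x y + M y a ≤ 0) (fun a => D₀.first y a z)))

/-- The effect of `concatStep` on the field `first`. -/
def concatFirst (M : Table n) (D₀ : DS n) (u v w x : Fin n)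
    (f : Fin n → Fin n → Fin n → Gain) : Fin n → Fin n → Fin n → Gain :=
  if M u v < 0 then
    setEntry f u v x (max (f u v x) (f u v w +
      rangeMax (fun a => M u v ≤ f u v w + M w a ∧ M w a ≤ 0) (fun a => D₀.first w a x)))
  else f

/-- The effect of `concatOppositeStep` on the field `first`. -/
def concatOppositeFirst (M : Table n) (D₀ : DS n) (u v w x : Fin n)
    (f : Fin n → Fin n → Fin n → Gain) : Fin n → Fin n → Fin n → Gain :=
  open Classical in
  if M u v < 0 then
    let f' := setEntry f u v x (max (f u v x) (f u v w + rangeMax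
      (fun a => 0 ≤ M a x ∧ M a x + M u v ≤ f u v w + D₀.last w a x ∧ f u v w + D₀.last w a x ≤ 0)
      (fun a => D₀.last w a x)))
    if ∃ a, 0 ≤ M a x ∧ 0 ≤ f' u v w + D₀.last w a x ∧ M a x + M u v ≤ 0 then
      setEntry f' u v x 0
    else f'
  else f

/-- `step` acts on the field `first` by `F` and on the field `last` by `F` in the reversed graph. -/
structure ActsBy (step : Table n → DS n → DS n → DS n)
    (F : Table n → DS n → (Fin n → Fin n → Fin n → Gain) → Fin n → Fin n → Fin n → Gain) :
    Prop where
  short : ∀ M D₀ D, (step M D₀ D).short = D.short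
  first : ∀ M D₀ D, (step M D₀ D).first = F M D₀ D.first
  last : ∀ M D₀ D a b c, (step M D₀ D).last a b c = F M.rev D₀.swap D.swap.first c b a

/-- Swapping twice is the identity, so the action on `last` is the action on `first` in the reversed
graph. Facts about `last` can then be read off from facts about `first`. -/
lemma ActsBy.swap {step : Table n → DS n → DS n → DS n}
    {F : Table n → DS n → (Fin n → Fin n → Fin n → Gain) → Fin n → Fin n → Fin n → Gain}
    (h : ActsBy step F) (M : Table n) (D₀ D : DS n) :
    (step M D₀ D).swap = step M.rev D₀.swap D.swap := by
  apply DS.eq_of_fields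
  · rw [h.short]; funext a b; exact congrFun (congrFun (h.short M D₀ D) b) a
  · rw [h.first]; funext a b c; exact h.last M D₀ D c b a
  · funext a b c
    rw [h.last]
    exact congrFun (congrFun (congrFun (h.first M D₀ D) c) b) a

lemma breadthStep_acts (x y z : Fin n) :
    ActsBy (fun M D₀ D => breadthStep M D₀ x y z D) (fun M D₀ => breadthFirst M D₀ x y z) := by
  constructor
  · intro M D₀ D; simp only [breadthStep]; split_ifs <;> rfl
  · intro M D₀ D; simp only [breadthStep, breadthFirst]; split_ifs <;> rfl
  · intro M D₀ D a b c
    unfold breadthFirst breadthStep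
    by_cases h₁ : 0 ≤ M x y <;> by_cases h₂ : 0 ≤ M y x <;>
    [rw [if_pos (show 0 ≤ M.rev x y from h₂)]; rw [if_neg (show ¬ 0 ≤ M.rev x y from h₂)];
     rw [if_pos (show 0 ≤ M.rev x y from h₂)]; rw [if_neg (show ¬ 0 ≤ M.rev x y from h₂)]] <;>
    simp only [h₁, h₂, if_true, if_false, add_comm] <;>
    exact (setEntry_reverse D.last x y z a b c _).symm

lemma concatStep_acts (u v w x : Fin n) :
    ActsBy (fun M D₀ D => concatStep M D₀ u v w x D) (fun M D₀ => concatFirst M D₀ u v w x) := by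
  constructor
  · intro M D₀ D; simp only [concatStep]; split_ifs <;> rfl
  · intro M D₀ D; simp only [concatStep, concatFirst]; split_ifs <;> rfl
  · intro M D₀ D a b c
    unfold concatFirst concatStep
    by_cases h₁ : M u v < 0 <;> by_cases h₂ : M v u < 0 <;>
    [rw [if_pos (show M.rev u v < 0 from h₂)]; rw [if_neg (show ¬ M.rev u v < 0 from h₂)];
     rw [if_pos (show M.rev u v < 0 from h₂)]; rw [if_neg (show ¬ M.rev u v < 0 from h₂)]] <;>
    simp only [h₁, h₂, if_true, if_false, add_comm] <;>
    first | rfl | exact (setEntry_reverse D.last u v x a b c _).symm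

lemma concatOppositeStep_acts (u v w x : Fin n) :
    ActsBy (fun M D₀ D => concatOppositeStep M D₀ u v w x D)
      (fun M D₀ => concatOppositeFirst M D₀ u v w x) := by
  constructor
  · intro M D₀ D; simp only [concatOppositeStep]; split_ifs <;> rfl
  · intro M D₀ D
    by_cases h : M u v < 0 <;> by_cases h' : M v u < 0 <;>
      simp only [concatOppositeStep, concatOppositeFirst, h, h', if_true, if_false] <;>
      split_ifs <;> first | rfl | (exfalso; tauto)
  · intro M D₀ D a b c
    -- The first half of the body leaves `last` alone, so the second half may be analysed for any
    -- `D₁` with the same field `last`.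
    have key : ∀ D₁ : DS n, D₁.last = D.last →
        (open Classical in
        if M v u < 0 then
          let m := D₁.last w v u
          let D := D₁.raiseLast x v u (rangeMax
            (fun a => 0 ≤ M x a ∧ M x a + M v u ≤ D₀.first x a w + m ∧ D₀.first x a w + m ≤ 0)
            (fun a => D₀.first x a w) + m)
          let m := D.last w v u
          if ∃ a, 0 ≤ M x a ∧ 0 ≤ D₀.first x a w + m ∧ M x a + M v u ≤ 0 then D.setLast x v u 0
          else D
        else D₁).last a b c =
        concatOppositeFirst M.rev D₀.swap u v w x D.swap.first c b a := by
      rintro ⟨s, f, l⟩ hl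
      obtain rfl : l = D.last := hl
      unfold concatOppositeFirst
      by_cases h₂ : M v u < 0
      · rw [if_pos h₂, if_pos (show M.rev u v < 0 from h₂)]
        have e : ∀ (L : Fin n → Fin n → Fin n → Gain) t,
            setEntry (fun p q r => L r q p) u v x t =
              fun c b a => if a = x ∧ b = v ∧ c = u then t else L a b c :=
          fun L t => funext fun c => funext fun b => funext fun a => setEntry_reverse L u v x a b c t
        set T := max (D.last x v u) (rangeMax (fun a => 0 ≤ M x a ∧
            M x a + M v u ≤ D₀.first x a w + D.last w v u ∧ D₀.first x a w + D.last w v u ≤ 0)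
            (fun a => D₀.first x a w) + D.last w v u) with hT
        have hT' : max (D.last x v u) (D.last w v u + rangeMax (fun a => 0 ≤ M x a ∧
            M x a + M v u ≤ D.last w v u + D₀.first x a w ∧ D.last w v u + D₀.first x a w ≤ 0)
            (fun a => D₀.first x a w)) = T := by
          rw [hT]; simp only [add_comm (D.last w v u)]
        -- The test for the assignment of `0` reads the entry again after it was raised, which
        -- matters when `w = x`.
        have hPQ : (∃ a, 0 ≤ M x a ∧ 0 ≤ D₀.first x a w +
              (if w = x ∧ v = v ∧ u = u then T else D.last w v u) ∧ M x a + M v u ≤ 0) ↔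
            ∃ a, 0 ≤ M x a ∧ 0 ≤ setEntry (fun p q r => D.last r q p) u v x
              (max (D.last x v u) (D.last w v u + rangeMax (fun a => 0 ≤ M x a ∧
            M x a + M v u ≤ D.last w v u + D₀.first x a w ∧ D.last w v u + D₀.first x a w ≤ 0)
            (fun a => D₀.first x a w))) u v w + D₀.first x a w ∧ M x a + M v u ≤ 0 := by
          rw [hT', e]
          simp only [add_comm]
        by_cases hP : ∃ a, 0 ≤ M x a ∧ 0 ≤ D₀.first x a w +
              (if w = x ∧ v = v ∧ u = u then T else D.last w v u) ∧ M x a + M v u ≤ 0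
        · refine (congrArg (fun D : DS n => D.last a b c) (if_pos hP)).trans
            (Eq.trans ?_ (congrArg (fun f : Fin n → Fin n → Fin n → Gain => f c b a) (if_pos (hPQ.1 hP))).symm)
          simp only [DS.swap, e]
          by_cases hc : a = x ∧ b = v ∧ c = u
          · exact (if_pos hc).trans (if_pos hc).symm
          · exact ((if_neg hc).trans (if_neg hc)).trans ((if_neg hc).trans (if_neg hc)).symm
        · refine (congrArg (fun D : DS n => D.last a b c) (if_neg hP)).trans
            (Eq.trans ?_ (congrArg (fun f : Fin n → Fin n → Fin n → Gain => f c b a) (if_neg (mt hPQ.2 hP))).symm)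
          exact (congrArg (fun T => if a = x ∧ b = v ∧ c = u then T else D.last a b c) hT'.symm).trans
            (setEntry_reverse _ u v x a b c _).symm
      · rw [if_neg h₂, if_neg (show ¬ M.rev u v < 0 from h₂)]
        rfl
    refine key _ ?_
    dsimp only
    split_ifs <;> rfl

lemma breadthSearch_swap (M : Table n) (D : DS n) :
    (breadthSearch M D).swap = breadthSearch M.rev D.swap := by
  unfold breadthSearch
  refine forEach_map DS.swap _ (fun x s => ?_) D
  refine forEach_map DS.swap _ (fun y s => ?_) s
  exact forEach_map DS.swap _ (fun z s => (breadthStep_acts x y z).swap M D s) s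

lemma concatenate_swap (M : Table n) (U W X : Finset (Fin n)) (D : DS n) :
    (concatenate M U W X D).swap = concatenate M.rev U W X D.swap := by
  unfold concatenate
  refine forEach_map DS.swap _ (fun u s => ?_) D
  refine forEach_map DS.swap _ (fun v s => ?_) s
  refine forEach_map DS.swap _ (fun w s => ?_) s
  exact forEach_map DS.swap _ (fun x s => (concatStep_acts u v w x).swap M D s) s

lemma concatOpposite_swap (M : Table n) (U W X : Finset (Fin n)) (D : DS n) :
    (concatOpposite M U W X D).swap = concatOpposite M.rev U W X D.swap := by
  unfold concatOpposite
  refine forEach_map DS.swap _ (fun u s => ?_) D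
  refine forEach_map DS.swap _ (fun v s => ?_) s
  refine forEach_map DS.swap _ (fun w s => ?_) s
  exact forEach_map DS.swap _ (fun x s => (concatOppositeStep_acts u v w x).swap M D s) s

end Swap

/-! ### Growth and boundedness of the entries, and what one call achieves -/

/-- The array `f` is bounded as the field `first` of a bounded data structure. -/
def BoundedBy (M : Table n) (f : Fin n → Fin n → Fin n → Gain) : Prop :=
  ∀ x y z, f x y z ≤ max 0 (M x y)

lemma setEntry_self (f : Fin n → Fin n → Fin n → Gain) (u v x : Fin n) (t : Gain) :
    setEntry f u v x t u v x = t := by simp [setEntry]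

lemma le_setEntry {f : Fin n → Fin n → Fin n → Gain} {u v x : Fin n} {t : Gain}
    (h : f u v x ≤ t) (a b c : Fin n) : f a b c ≤ setEntry f u v x t a b c := by
  unfold setEntry
  split_ifs with h'
  · obtain ⟨rfl, rfl, rfl⟩ := h'; exact h
  · exact le_rfl

lemma BoundedBy.setEntry {M : Table n} {f : Fin n → Fin n → Fin n → Gain} (hf : BoundedBy M f)
    {u v x : Fin n} {t : Gain} (h : t ≤ max 0 (M u v)) : BoundedBy M (setEntry f u v x t) := by
  intro a b c
  unfold EnergyPaths.setEntry
  split_ifs with h'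
  · obtain ⟨rfl, rfl, rfl⟩ := h'; exact h
  · exact hf a b c

/-- The entries of `ya` do not exceed the upper end of the range of `ya`, and the condition on `M y
a` puts that end, shifted by `M x y`, below the upper end of the range of `xy`. -/
lemma breadthFirst_spec {M : Table n} {D₀ : DS n} (x y z : Fin n)
    {f : Fin n → Fin n → Fin n → Gain} (hD : D₀.Bounded M) (hf : BoundedBy M f) :
    BoundedBy M (breadthFirst M D₀ x y z f) ∧ ∀ a b c, f a b c ≤ breadthFirst M D₀ x y z f a b c := by
  refine ⟨hf.setEntry (max_le (hf x y z) ?_), le_setEntry (le_max_left _ _)⟩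
  split_ifs with h
  · refine le_max_of_le_right ?_
    have : rangeMax (fun a => 0 ≤ M x y + M y a ∧ M y a ≤ 0) (fun a => D₀.first y a z) ≤ 0 :=
      rangeMax_le fun a ha => (hD.1 y a z).trans (max_le le_rfl ha.2)
    calc _ ≤ M x y + 0 := by gcongr
      _ = _ := add_zero _
  · refine le_max_of_le_left ?_
    by_cases hb : M x y = ⊥
    · simp [hb]
    obtain ⟨m, hm⟩ := WithBot.ne_bot_iff_exists.1 hb
    have : rangeMax (fun a => 0 ≤ M y a ∧ M x y + M y a ≤ 0) (fun a => D₀.first y a z)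
        ≤ ((-m : ℝ) : Gain) := by
      refine rangeMax_le fun a ha => (hD.1 y a z).trans ?_
      rw [max_eq_right ha.1]
      have h2 := ha.2
      by_cases hb' : M y a = ⊥
      · simp [hb']
      obtain ⟨m', hm'⟩ := WithBot.ne_bot_iff_exists.1 hb'
      rw [← hm, ← hm'] at h2
      rw [← hm']
      have : m + m' ≤ 0 := by exact_mod_cast h2
      exact_mod_cast (by linarith : m' ≤ -m)
    calc _ ≤ M x y + ((-m : ℝ) : Gain) := by gcongr
      _ = 0 := by rw [← hm, ← WithBot.coe_add]; simp

lemma concatFirst_spec {M : Table n} {D₀ : DS n} (u v w x : Fin n)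
    {f : Fin n → Fin n → Fin n → Gain} (hD : D₀.Bounded M) (hf : BoundedBy M f) :
    BoundedBy M (concatFirst M D₀ u v w x f) ∧
      ∀ a b c, f a b c ≤ concatFirst M D₀ u v w x f a b c := by
  unfold concatFirst
  split_ifs with h
  · refine ⟨hf.setEntry (max_le (hf u v x) ?_), le_setEntry (le_max_left _ _)⟩
    have h1 : rangeMax (fun a => M u v ≤ f u v w + M w a ∧ M w a ≤ 0) (fun a => D₀.first w a x)
        ≤ 0 := rangeMax_le fun a ha => (hD.1 w a x).trans (max_le le_rfl ha.2)
    have h2 := hf u v w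
    rw [max_eq_left h.le] at h2 ⊢
    simpa using add_le_add h2 h1
  · exact ⟨hf, fun _ _ _ => le_rfl⟩

/-- The assignment of `0` takes no maximum. It cannot lower the entry only because entries are at
most `0` when `M u v < 0`; this is why boundedness is carried along as an invariant. -/
lemma concatOppositeFirst_spec {M : Table n} {D₀ : DS n} (u v w x : Fin n)
    {f : Fin n → Fin n → Fin n → Gain} (_hD : D₀.Bounded M) (hf : BoundedBy M f) :
    BoundedBy M (concatOppositeFirst M D₀ u v w x f) ∧
      ∀ a b c, f a b c ≤ concatOppositeFirst M D₀ u v w x f a b c := by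
  unfold concatOppositeFirst
  by_cases h : M u v < 0
  · rw [if_pos h]
    set R := rangeMax (fun a => 0 ≤ M a x ∧ M a x + M u v ≤ f u v w + D₀.last w a x ∧
      f u v w + D₀.last w a x ≤ 0) (fun a => D₀.last w a x) with hR
    have h1 : f u v w + R ≤ 0 := by
      by_cases hb : f u v w = ⊥
      · simp [hb]
      obtain ⟨m, hm⟩ := WithBot.ne_bot_iff_exists.1 hb
      have : R ≤ ((-m : ℝ) : Gain) := by
        refine rangeMax_le fun a ha => ?_
        have h2 := ha.2.2
        by_cases hb' : D₀.last w a x = ⊥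
        · simp [hb']
        obtain ⟨m', hm'⟩ := WithBot.ne_bot_iff_exists.1 hb'
        rw [← hm, ← hm'] at h2
        rw [← hm']
        have : m + m' ≤ 0 := by exact_mod_cast h2
        exact_mod_cast (by linarith : m' ≤ -m)
      calc _ ≤ f u v w + ((-m : ℝ) : Gain) := by gcongr
        _ = 0 := by rw [← hm, ← WithBot.coe_add]; simp
    have hm : max 0 (M u v) = 0 := max_eq_left h.le
    have hf' : BoundedBy M (setEntry f u v x (max (f u v x) (f u v w + R))) :=
      hf.setEntry (max_le (hf u v x) (hm.symm ▸ h1))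
    have hle : ∀ a b c, f a b c ≤ setEntry f u v x (max (f u v x) (f u v w + R)) a b c :=
      le_setEntry (le_max_left _ _)
    dsimp only
    split_ifs with h2
    · refine ⟨hf'.setEntry (le_max_left _ _), fun a b c => (hle a b c).trans (le_setEntry ?_ a b c)⟩
      exact (hf' u v x).trans hm.le
    · exact ⟨hf', hle⟩
  · rw [if_neg h]
    exact ⟨hf, fun _ _ _ => le_rfl⟩

lemma ActsBy.spec {step : Table n → DS n → DS n → DS n}
    {F : Table n → DS n → (Fin n → Fin n → Fin n → Gain) → Fin n → Fin n → Fin n → Gain}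
    (h : ActsBy step F)
    (hF : ∀ {M D₀ f}, D₀.Bounded M → BoundedBy M f →
      BoundedBy M (F M D₀ f) ∧ ∀ a b c, f a b c ≤ F M D₀ f a b c)
    {M : Table n} {D₀ D : DS n} (h₀ : D₀.Bounded M) (hD : D.Bounded M) :
    (step M D₀ D).Bounded M ∧ D.Le (step M D₀ D) := by
  have h1 := hF (M := M) (D₀ := D₀) (f := D.first) h₀ hD.1
  have h2 := hF (M := M.rev) (D₀ := D₀.swap) (f := D.swap.first) h₀.swap hD.swap.1
  refine ⟨⟨?_, fun x y z => ?_⟩, ?_, fun x y z => ?_⟩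
  · rw [h.first]; exact h1.1
  · rw [h.last]; exact h2.1 z y x
  · rw [h.first]; exact h1.2
  · rw [h.last]; exact h2.2 z y x

lemma stable_step {D₀ D D' : DS n} {M : Table n}
    (hs : D.Bounded M → D'.Bounded M ∧ D.Le D') (h : D.Bounded M ∧ D₀.Le D) :
    D'.Bounded M ∧ D₀.Le D' :=
  ⟨(hs h.1).1, h.2.trans (hs h.1).2⟩

lemma breadthSearch_spec {M : Table n} {D : DS n} (hD : D.Bounded M) :
    (breadthSearch M D).Bounded M ∧ D.Le (breadthSearch M D) :=
  forEach3_inv (P := fun s => s.Bounded M ∧ D.Le s)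
    (fun x y z _ h => stable_step
      (fun h' => (breadthStep_acts x y z).spec (breadthFirst_spec x y z) hD h') h)
    ⟨hD, DS.Le.refl D⟩

lemma concatenate_spec {M : Table n} {D : DS n} (U W X : Finset (Fin n)) (hD : D.Bounded M) :
    (concatenate M U W X D).Bounded M ∧ D.Le (concatenate M U W X D) :=
  forEach4_inv (P := fun s => s.Bounded M ∧ D.Le s)
    (fun u v w x _ h => stable_step
      (fun h' => (concatStep_acts u v w x).spec (concatFirst_spec u v w x) hD h') h)
    ⟨hD, DS.Le.refl D⟩

lemma concatOpposite_spec {M : Table n} {D : DS n} (U W X : Finset (Fin n))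
    (hD : D.Bounded M) :
    (concatOpposite M U W X D).Bounded M ∧ D.Le (concatOpposite M U W X D) :=
  forEach4_inv (P := fun s => s.Bounded M ∧ D.Le s)
    (fun u v w x _ h => stable_step
      (fun h' => (concatOppositeStep_acts u v w x).spec (concatOppositeFirst_spec u v w x) hD h') h)
    ⟨hD, DS.Le.refl D⟩

/-- An arc of gain `b` after an arc of gain `a` continues a contracting funnel. -/
def Contracts (a b : Gain) : Prop :=
  (0 ≤ a ∧ 0 ≤ a + b ∧ b ≤ 0) ∨ (a < 0 ∧ 0 ≤ b ∧ a + b ≤ 0)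

lemma le_breadthSearch_first {M : Table n} {D : DS n} (hD : D.Bounded M) {x y a z : Fin n}
    (h : Contracts (M x y) (M y a)) :
    M x y + D.first y a z ≤ (breadthSearch M D).first x y z := by
  refine forEach3_hit (P := fun s => s.Bounded M ∧ D.Le s)
    (Q := fun s => M x y + D.first y a z ≤ s.first x y z) (mem_verts x) (mem_verts y)
    (mem_verts z) (fun x y z _ h => stable_step
      (fun h' => (breadthStep_acts x y z).spec (breadthFirst_spec x y z) hD h') h)
    (fun x y z _ h hq => hq.trans
      (((breadthStep_acts x y z).spec (breadthFirst_spec x y z) hD h.1).2.1 _ _ _)) ?_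
    ⟨hD, DS.Le.refl D⟩
  intro s _
  rw [(breadthStep_acts x y z).first, breadthFirst, setEntry_self]
  refine le_max_of_le_right (add_le_add le_rfl ?_)
  rcases h with h | h
  · rw [if_pos h.1]
    exact le_rangeMax (p := fun a => 0 ≤ M x y + M y a ∧ M y a ≤ 0)
      (key := fun a => D.first y a z) h.2
  · rw [if_neg h.1.not_ge]
    exact le_rangeMax (p := fun a => 0 ≤ M y a ∧ M x y + M y a ≤ 0)
      (key := fun a => D.first y a z) h.2

/-- The entry for `uv, w` may have grown during the call before it is read. This only weakens the
range condition, so a lower bound `s` is enough. -/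
lemma le_concatenate_first {M : Table n} {D : DS n} (hD : D.Bounded M) {U W X : Finset (Fin n)}
    {u v w a x : Fin n} (hu : u ∈ U) (hw : w ∈ W) (hx : x ∈ X) {s : Gain} (huv : M u v < 0)
    (hs : s ≤ D.first u v w) (h₁ : M u v ≤ s + M w a) (h₂ : M w a ≤ 0) :
    s + D.first w a x ≤ (concatenate M U W X D).first u v x := by
  refine forEach4_hit (P := fun s => s.Bounded M ∧ D.Le s)
    (Q := fun D' => s + D.first w a x ≤ D'.first u v x) (mem_elems.2 hu) (mem_verts v)
    (mem_elems.2 hw) (mem_elems.2 hx) (fun u v w x _ h => stable_step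
      (fun h' => (concatStep_acts u v w x).spec (concatFirst_spec u v w x) hD h') h)
    (fun u v w x _ h hq => hq.trans
      (((concatStep_acts u v w x).spec (concatFirst_spec u v w x) hD h.1).2.1 _ _ _)) ?_
    ⟨hD, DS.Le.refl D⟩
  intro D' h
  rw [(concatStep_acts u v w x).first, concatFirst, if_pos huv, setEntry_self]
  have hs' := hs.trans (h.2.1 u v w)
  refine le_max_of_le_right (add_le_add hs' ?_)
  exact le_rangeMax (p := fun a => M u v ≤ D'.first u v w + M w a ∧ M w a ≤ 0)
    (key := fun a => D.first w a x) ⟨h₁.trans (add_le_add hs' le_rfl), h₂⟩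

/-- If the current entry is so large that the two parts together reach `0`, then `a` itself triggers
the assignment of `0`, which is at least `s + t`. Otherwise `a` satisfies the range condition. -/
lemma le_concatOpposite_first {M : Table n} {D : DS n} (hD : D.Bounded M)
    {U W X : Finset (Fin n)} {u v w a x : Fin n} (hu : u ∈ U) (hw : w ∈ W) (hx : x ∈ X)
    {s t : Gain} (huv : M u v < 0) (hs : s ≤ D.first u v w) (ht : t ≤ D.last w a x)
    (h₁ : 0 ≤ M a x) (h₂ : M a x + M u v ≤ 0) (h₃ : M a x + M u v ≤ s + D.last w a x)
    (h₄ : s + t ≤ 0) :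
    s + t ≤ (concatOpposite M U W X D).first u v x := by
  refine forEach4_hit (P := fun s => s.Bounded M ∧ D.Le s)
    (Q := fun D' => s + t ≤ D'.first u v x) (mem_elems.2 hu) (mem_verts v)
    (mem_elems.2 hw) (mem_elems.2 hx) (fun u v w x _ h => stable_step
      (fun h' => (concatOppositeStep_acts u v w x).spec (concatOppositeFirst_spec u v w x) hD h') h)
    (fun u v w x _ h hq => hq.trans (((concatOppositeStep_acts u v w x).spec
      (concatOppositeFirst_spec u v w x) hD h.1).2.1 _ _ _)) ?_
    ⟨hD, DS.Le.refl D⟩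
  intro D' h
  rw [(concatOppositeStep_acts u v w x).first, concatOppositeFirst, if_pos huv]
  have hs' := hs.trans (h.2.1 u v w)
  split_ifs with hc
  · rw [setEntry_self]; exact h₄
  · rw [setEntry_self]
    push Not at hc
    have hlt := lt_of_not_ge fun h0 => (hc a h₁ h0).not_ge h₂
    refine le_max_of_le_right (add_le_add hs' (ht.trans ?_))
    refine le_rangeMax (p := fun a => 0 ≤ M a x ∧ M a x + M u v ≤ D'.first u v w + D.last w a x ∧
      D'.first u v w + D.last w a x ≤ 0) (key := fun a => D.last w a x)
      ⟨h₁, h₃.trans (add_le_add hs' le_rfl), le_trans ?_ hlt.le⟩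
    exact add_le_add (le_setEntry (le_max_left _ _) u v w) le_rfl

/-! ### Monotone shortcuts obtained from arc-bounded paths -/

lemma Table.le_raise (T : Table n) (x z : Fin n) (t : Gain) (a b : Fin n) :
    T a b ≤ T.raise x z t a b := by
  unfold Table.raise; split_ifs <;> simp

lemma Table.le_raise_self (T : Table n) (x z : Fin n) (t : Gain) : t ≤ T.raise x z t x z := by
  simp [Table.raise]

namespace DS

/-- `D'` arises from `D` by raising entries for monotone paths. -/
def Grows (D D' : DS n) : Prop :=
  D'.first = D.first ∧ D'.last = D.last ∧ ∀ a b, D.short a b ≤ D'.short a b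

lemma Grows.refl (D : DS n) : D.Grows D := ⟨rfl, rfl, fun _ _ => le_rfl⟩

lemma Grows.trans {D D' D'' : DS n} (h : D.Grows D') (h' : D'.Grows D'') : D.Grows D'' :=
  ⟨h'.1.trans h.1, h'.2.1.trans h.2.1, fun a b => (h.2.2 a b).trans (h'.2.2 a b)⟩

lemma grows_raiseShort (D : DS n) (x z : Fin n) (t : Gain) : D.Grows (D.raiseShort x z t) :=
  ⟨rfl, rfl, D.short.le_raise x z t⟩

lemma le_raiseShort_self (D : DS n) (x z : Fin n) (t : Gain) :
    t ≤ (D.raiseShort x z t).short x z := D.short.le_raise_self x z t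

lemma grows_ite {D D' D'' : DS n} {p : Prop} [Decidable p] (h : D.Grows D') (h' : D.Grows D'') :
    D.Grows (if p then D' else D'') := by split_ifs <;> assumption

end DS

open DS in
lemma boundedStep_grows (B : ℝ) (M : Table n) (u v x y : Fin n) (D : DS n) :
    D.Grows (boundedStep B M u v x y D) := by
  unfold boundedStep
  extract_lets t D₁ D₂ D₃ t' E₁ E₂
  have h₁ : D.Grows D₁ := grows_ite (grows_raiseShort _ _ _ _) (Grows.refl D)
  have h₂ : D.Grows D₂ := h₁.trans (grows_ite (grows_raiseShort _ _ _ _) (Grows.refl _))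
  have h₃ : D.Grows D₃ := grows_ite
    (h₂.trans (grows_ite (grows_raiseShort _ _ _ _) (Grows.refl _))) (Grows.refl _)
  have k₁ : D₃.Grows E₁ := grows_ite (grows_raiseShort _ _ _ _) (Grows.refl _)
  have k₂ : D₃.Grows E₂ := k₁.trans (grows_ite (grows_raiseShort _ _ _ _) (Grows.refl _))
  exact h₃.trans (grows_ite
    (k₂.trans (grows_ite (grows_raiseShort _ _ _ _) (Grows.refl _))) (Grows.refl _))

lemma arcBoundedToMonotone_hit {B : ℝ} {M : Table n} {T : Finset (Fin n)} {D : DS n}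
    {u v x y a b : Fin n} {t : Gain} (hu : u ∈ T)
    (h : ∀ D' : DS n, D.Grows D' → t ≤ (boundedStep B M u v x y D').short a b) :
    t ≤ (arcBoundedToMonotone B M T D).short a b :=
  forEach4_hit (P := D.Grows) (Q := fun D' => t ≤ D'.short a b) (mem_elems.2 hu)
    (mem_verts v) (mem_verts x) (mem_verts y)
    (fun u v x y s hs => hs.trans (boundedStep_grows B M u v x y s))
    (fun u v x y s _ hq => hq.trans ((boundedStep_grows B M u v x y s).2.2 a b)) h
    (DS.Grows.refl D)

-- The computed value may exceed `t`. If it does not exceed `M u v` it is recorded, and otherwise `M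
-- u v` is recorded; both are at least `t`.
open DS in
lemma arcBounded_first_descending {B : ℝ} {M : Table n} {T : Finset (Fin n)} {D : DS n}
    {u v x y : Fin n} {t : Gain} (hu : u ∈ T) (hB : ((-B : ℝ) : Gain) ≤ t) (h₀ : M u v ≤ 0)
    (h₁ : t ≤ M u v) (h₂ : t ≤ D.first u v x + M x y) :
    t ≤ (arcBoundedToMonotone B M T D).short u y := by
  refine arcBoundedToMonotone_hit (v := v) (x := x) (y := y) hu fun D' h => ?_
  rw [← h.1] at h₂
  unfold boundedStep
  extract_lets s D₁ D₂ D₃ s' E₁ E₂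
  have h3 : t ≤ D₂.short u y := by
    rcases le_total s (M u v) with hs | hs
    · have : D₁ = D'.raiseShort u y s := if_pos ⟨hB.trans h₂, hs⟩
      refine le_trans ?_ ((show D₁.Grows D₂ from
        grows_ite (grows_raiseShort _ _ _ _) (Grows.refl _)).2.2 u y)
      rw [this]; exact h₂.trans (le_raiseShort_self _ _ _ _)
    · have : D₂ = D₁.raiseShort u y (M u v) := if_pos hs
      rw [this]; exact h₁.trans (le_raiseShort_self _ _ _ _)
  have h4 : D₂.Grows D₃ := by
    have : D₃ = if 0 ≤ s then D₂.raiseShort v y (WithBot.map (fun r : ℝ => -r) (M u v) + s)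
      else D₂ := if_pos h₀
    rw [this]; exact grows_ite (grows_raiseShort _ _ _ _) (Grows.refl _)
  have k₁ : D₃.Grows E₁ := grows_ite (grows_raiseShort _ _ _ _) (Grows.refl _)
  have k₂ : D₃.Grows E₂ := k₁.trans (grows_ite (grows_raiseShort _ _ _ _) (Grows.refl _))
  exact (h3.trans (h4.2.2 u y)).trans ((grows_ite
    (k₂.trans (grows_ite (grows_raiseShort _ _ _ _) (Grows.refl _))) (Grows.refl _)).2.2 u y)

-- Leaving out the designated arc, of gain `m ≤ 0`, adds `-m` to the gain; the shortcut then starts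
-- at the head of that arc.
open DS in
lemma arcBounded_first_ascending {B : ℝ} {M : Table n} {T : Finset (Fin n)} {D : DS n}
    {u v x y : Fin n} {m : ℝ} {t : Gain} (hu : u ∈ T) (hm : M u v = (m : Gain)) (h₀ : m ≤ 0)
    (ht : 0 ≤ t) (h₂ : t ≤ D.first u v x + M x y) :
    ((-m : ℝ) : Gain) + t ≤ (arcBoundedToMonotone B M T D).short v y := by
  refine arcBoundedToMonotone_hit (v := v) (x := x) (y := y) hu fun D' h => ?_
  rw [← h.1] at h₂
  unfold boundedStep
  extract_lets s D₁ D₂ D₃ s' E₁ E₂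
  have h4 : ((-m : ℝ) : Gain) + t ≤ D₃.short v y := by
    have : D₃ = if 0 ≤ s then D₂.raiseShort v y (WithBot.map (fun r : ℝ => -r) (M u v) + s)
      else D₂ := if_pos (by rw [hm]; exact_mod_cast h₀)
    rw [this, if_pos (ht.trans h₂), hm]
    exact (add_le_add le_rfl h₂).trans (le_raiseShort_self _ _ _ _)
  have k₁ : D₃.Grows E₁ := grows_ite (grows_raiseShort _ _ _ _) (Grows.refl _)
  have k₂ : D₃.Grows E₂ := k₁.trans (grows_ite (grows_raiseShort _ _ _ _) (Grows.refl _))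
  exact h4.trans ((grows_ite
    (k₂.trans (grows_ite (grows_raiseShort _ _ _ _) (Grows.refl _))) (Grows.refl _)).2.2 v y)

open DS in
lemma arcBounded_last_descending {B : ℝ} {M : Table n} {T : Finset (Fin n)} {D : DS n}
    {u v x y : Fin n} {t : Gain} (hu : u ∈ T) (hB : ((-B : ℝ) : Gain) ≤ t) (h₀ : M v u ≤ 0)
    (h₁ : t ≤ M v u) (h₂ : t ≤ M y x + D.last x v u) :
    t ≤ (arcBoundedToMonotone B M T D).short y u := by
  refine arcBoundedToMonotone_hit (v := v) (x := x) (y := y) hu fun D' h => ?_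
  rw [← h.2.1] at h₂
  unfold boundedStep
  extract_lets s D₁ D₂ D₃ s' E₁ E₂
  have g₁ : D'.Grows D₁ := grows_ite (grows_raiseShort _ _ _ _) (Grows.refl D')
  have g₂ : D'.Grows D₂ := g₁.trans (grows_ite (grows_raiseShort _ _ _ _) (Grows.refl _))
  have g₃ : D'.Grows D₃ := grows_ite
    (g₂.trans (grows_ite (grows_raiseShort _ _ _ _) (Grows.refl _))) (Grows.refl _)
  have h2' : t ≤ s' := by rw [← g₃.2.1] at h₂; exact h₂
  have h3 : t ≤ E₂.short y u := by
    rcases le_total s' (M v u) with hs | hs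
    · have : E₁ = D₃.raiseShort y u s' := if_pos ⟨hB.trans h2', hs⟩
      refine le_trans ?_ ((show E₁.Grows E₂ from
        grows_ite (grows_raiseShort _ _ _ _) (Grows.refl _)).2.2 y u)
      rw [this]; exact h2'.trans (le_raiseShort_self _ _ _ _)
    · have : E₂ = E₁.raiseShort y u (M v u) := if_pos hs
      rw [this]; exact h₁.trans (le_raiseShort_self _ _ _ _)
  rw [if_pos h₀]
  exact h3.trans ((grows_ite (grows_raiseShort _ _ _ _) (Grows.refl _)).2.2 y u)

open DS in
lemma arcBounded_last_ascending {B : ℝ} {M : Table n} {T : Finset (Fin n)} {D : DS n}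
    {u v x y : Fin n} {m : ℝ} {t : Gain} (hu : u ∈ T) (hm : M v u = (m : Gain)) (h₀ : m ≤ 0)
    (ht : 0 ≤ t) (h₂ : t ≤ M y x + D.last x v u) :
    t + ((-m : ℝ) : Gain) ≤ (arcBoundedToMonotone B M T D).short y v := by
  refine arcBoundedToMonotone_hit (v := v) (x := x) (y := y) hu fun D' h => ?_
  rw [← h.2.1] at h₂
  unfold boundedStep
  extract_lets s D₁ D₂ D₃ s' E₁ E₂
  have g₁ : D'.Grows D₁ := grows_ite (grows_raiseShort _ _ _ _) (Grows.refl D')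
  have g₂ : D'.Grows D₂ := g₁.trans (grows_ite (grows_raiseShort _ _ _ _) (Grows.refl _))
  have g₃ : D'.Grows D₃ := grows_ite
    (g₂.trans (grows_ite (grows_raiseShort _ _ _ _) (Grows.refl _))) (Grows.refl _)
  have h2' : t ≤ s' := by rw [← g₃.2.1] at h₂; exact h₂
  rw [if_pos (by rw [hm]; exact_mod_cast h₀), if_pos (ht.trans h2'), hm]
  exact (add_le_add h2' le_rfl).trans (le_raiseShort_self _ _ _ _)

/-! ### Short-Shortcuts -/

/-- The update made for `x, y, z` in the computation of the tables of 2- and 3-shortcuts. -/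
def combineStep (B : ℝ) (M M' : Table n) (x y z : Fin n) (T : Table n) : Table n :=
  if 0 ≤ M x y ∧ 0 ≤ M' y z then T.raise x z (M x y + M' y z)
  else if ((-B : ℝ) : Gain) ≤ min (M x y) 0 + min (M' y z) 0 then
    T.raise x z (min (M x y) 0 + min (M' y z) 0)
  else T

/-- The table of the gains of two consecutive arcs, the first from `M` and the second from `M'`. -/
def combine (B : ℝ) (M M' : Table n) : Table n :=
  forEach (verts n) (fun _ _ => ⊥) fun x T => forEach (verts n) T fun y T =>
    forEach (verts n) T fun z T => combineStep B M M' x y z T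

lemma combine_hit {B : ℝ} {M M' : Table n} {x y z : Fin n} {t : Gain}
    (h : ∀ T : Table n, t ≤ combineStep B M M' x y z T x z) : t ≤ combine B M M' x z := by
  refine forEach3_hit (P := fun _ => True) (Q := fun T : Table n => t ≤ T x z) (mem_verts x)
    (mem_verts y) (mem_verts z) (fun _ _ _ _ _ => trivial) (fun a b c T _ hT => hT.trans ?_)
    (fun T _ => h T) trivial
  unfold combineStep
  split_ifs <;> first | exact Table.le_raise _ _ _ _ _ _ | exact le_rfl

lemma add_le_combine {B : ℝ} {M M' : Table n} {x y z : Fin n} (h : 0 ≤ M x y) (h' : 0 ≤ M' y z) :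
    M x y + M' y z ≤ combine B M M' x z := by
  refine combine_hit (y := y) fun T => ?_
  rw [combineStep, if_pos ⟨h, h'⟩]
  exact Table.le_raise_self _ _ _ _

lemma min_add_min_le_combine {B : ℝ} {M M' : Table n} {x y z : Fin n}
    (h : ((-B : ℝ) : Gain) ≤ min (M x y) 0 + min (M' y z) 0) :
    min (M x y) 0 + min (M' y z) 0 ≤ combine B M M' x z := by
  refine combine_hit (y := y) fun T => ?_
  unfold combineStep
  split_ifs with h'
  · exact (add_le_add (min_le_left _ _) (min_le_left _ _)).trans (Table.le_raise_self _ _ _ _)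
  · exact Table.le_raise_self _ _ _ _

open DS in
lemma shortStep_grows (B : ℝ) (M : Table n) (x y z : Fin n) (D : DS n) :
    D.Grows (shortStep B M x y z D) := by
  unfold shortStep
  extract_lets k₁ D₁ k₂ D₂ D₃ k₃
  have h₁ : D.Grows D₁ :=
    grows_ite (grows_ite (grows_raiseShort _ _ _ _) (Grows.refl _)) (Grows.refl _)
  have h₂ : D₁.Grows D₂ := grows_ite (grows_raiseShort _ _ _ _) (Grows.refl _)
  have h₃ : D₂.Grows D₃ := grows_ite (grows_raiseShort _ _ _ _) (Grows.refl _)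
  exact h₁.trans (grows_ite (h₂.trans (h₃.trans (grows_raiseShort _ _ _ _))) (Grows.refl _))

lemma trivial_le_shortShortcuts (B : ℝ) (M : Table n) (x z : Fin n) :
    (trivialShortcuts B M (DS.init M)).short x z ≤ shortShortcuts B M x z :=
  (forEach3_inv (P := (trivialShortcuts B M (DS.init M)).Grows)
    (fun x y z s hs => hs.trans (shortStep_grows B M x y z s)) (DS.Grows.refl _)).2.2 x z

lemma le_shortShortcuts (B : ℝ) (M : Table n) (x z : Fin n) : M x z ≤ shortShortcuts B M x z :=
  (le_max_left _ _).trans (trivial_le_shortShortcuts B M x z)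

lemma two_le_shortShortcuts (B : ℝ) (M : Table n) (x z : Fin n) :
    combine B M M x z ≤ shortShortcuts B M x z :=
  ((le_max_left _ _).trans (le_max_right _ _)).trans (trivial_le_shortShortcuts B M x z)

lemma three_le_shortShortcuts (B : ℝ) (M : Table n) (x z : Fin n) :
    combine B M (combine B M M) x z ≤ shortShortcuts B M x z :=
  ((le_max_right _ _).trans (le_max_right _ _)).trans (trivial_le_shortShortcuts B M x z)

lemma shortShortcuts_hit {B : ℝ} {M : Table n} {x y z : Fin n} {t : Gain}
    (h : ∀ D : DS n, t ≤ (shortStep B M x y z D).short x z) : t ≤ shortShortcuts B M x z :=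
  forEach3_hit (P := fun _ => True) (Q := fun D : DS n => t ≤ D.short x z) (mem_verts x)
    (mem_verts y) (mem_verts z) (fun _ _ _ _ _ => trivial)
    (fun a b c D _ hD => hD.trans ((shortStep_grows B M a b c D).2.2 x z))
    (fun D _ => h D) trivial

open DS in
lemma ascending_le_shortShortcuts {B : ℝ} {M : Table n} {x y a z : Fin n} (h₁ : 0 ≤ M x y)
    (h₂ : 0 ≤ M x y + M y a) (h₃ : M y a ≤ 0) (h₄ : 0 ≤ M y a + M a z) :
    M x y + (M y a + M a z) ≤ shortShortcuts B M x z := by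
  refine shortShortcuts_hit (y := y) fun D => ?_
  unfold shortStep
  extract_lets k₁ D₁ k₂ D₂ D₃ k₃
  have hk : M y a + M a z ≤ k₁ :=
    le_rangeMax (p := fun a => 0 ≤ M x y + M y a ∧ M y a ≤ 0) (key := fun a => M y a + M a z)
      ⟨h₂, h₃⟩
  have h₅ : M x y + (M y a + M a z) ≤ D₁.short x z := by
    have : D₁ = if M x y ≤ M x y + k₁ then D.raiseShort x z (M x y + k₁) else D := if_pos h₁
    rw [this, if_pos (le_add_of_nonneg_right (h₄.trans hk))]
    exact (add_le_add le_rfl hk).trans (le_raiseShort_self _ _ _ _)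
  have g₂ : D₁.Grows D₂ := grows_ite (grows_raiseShort _ _ _ _) (Grows.refl _)
  have g₃ : D₂.Grows D₃ := grows_ite (grows_raiseShort _ _ _ _) (Grows.refl _)
  exact h₅.trans
    ((grows_ite (g₂.trans (g₃.trans (grows_raiseShort _ _ _ _))) (Grows.refl _)).2.2 x z)

open DS in
lemma descending_le_shortShortcuts {B : ℝ} {M : Table n} {x y a z : Fin n} {t : Gain}
    (h₁ : M x y ≤ 0) (h₂ : 0 ≤ M y a) (h₃ : M x y + M y a ≤ 0)
    (hB : ((-B : ℝ) : Gain) ≤ t) (h₄ : t ≤ M x y) (h₅ : t ≤ M x y + (M y a + M a z)) :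
    t ≤ shortShortcuts B M x z := by
  refine shortShortcuts_hit (y := y) fun D => ?_
  unfold shortStep
  extract_lets k₁ D₁ k₂ D₂ D₃ k₃
  have hk : M y a + M a z ≤ k₂ :=
    le_rangeMax (p := fun a => 0 ≤ M y a ∧ M x y + M y a ≤ 0) (key := fun a => M y a + M a z)
      ⟨h₂, h₃⟩
  have h₆ : t ≤ M x y + k₂ := h₅.trans (add_le_add le_rfl hk)
  rw [if_pos h₁]
  refine le_trans ?_ ((grows_raiseShort _ _ _ _).2.2 x z)
  rcases le_total (M x y + k₂) (M x y) with h | h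
  · have : D₂ = D₁.raiseShort x z (M x y + k₂) := if_pos ⟨h, hB.trans h₆⟩
    have g₃ : D₂.Grows D₃ := grows_ite (grows_raiseShort _ _ _ _) (Grows.refl _)
    refine le_trans ?_ (g₃.2.2 x z)
    rw [this]; exact h₆.trans (le_raiseShort_self _ _ _ _)
  · have : D₃ = D₂.raiseShort x z (M x y) := if_pos h
    rw [this]; exact h₄.trans (le_raiseShort_self _ _ _ _)

open DS in
lemma min_le_shortShortcuts {B : ℝ} {M : Table n} {x y a z : Fin n}
    (h₁ : M x y ≤ 0) (h₂ : 0 ≤ M x y + M y a) : min (M x y) (M a z) ≤ shortShortcuts B M x z := by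
  refine shortShortcuts_hit (y := y) fun D => ?_
  unfold shortStep
  extract_lets k₁ D₁ k₂ D₂ D₃ k₃
  rw [if_pos h₁]
  refine le_trans (min_le_min le_rfl ?_) (le_raiseShort_self _ _ _ _)
  exact le_rangeMax (p := fun a => 0 ≤ M x y + M y a) (key := fun a => M a z) h₂

/-- The `dᵢ` are gains after drops. Unless both table gains are nonnegative, the recorded value is
the sum of their truncations at `0`, and these dominate the `dᵢ` if the `dᵢ`, or the table gains,
are nonpositive. -/
lemma two_arcs_le_combine {B : ℝ} {M M' : Table n} {x y z : Fin n} {m₁ m₂ d₁ d₂ : ℝ}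
    (h₁ : M x y = (m₁ : Gain)) (h₂ : M' y z = (m₂ : Gain)) (hd₁ : d₁ ≤ m₁) (hd₂ : d₂ ≤ m₂)
    (hB : -B ≤ d₁ + d₂) (h : (0 ≤ m₁ ∧ 0 ≤ m₂) ∨ (d₁ ≤ 0 ∧ d₂ ≤ 0) ∨ (m₁ ≤ 0 ∧ m₂ ≤ 0)) :
    ((d₁ + d₂ : ℝ) : Gain) ≤ combine B M M' x z := by
  by_cases h0 : 0 ≤ m₁ ∧ 0 ≤ m₂
  · refine le_trans ?_ (add_le_combine (y := y) ?_ ?_)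
    · rw [h₁, h₂]; exact_mod_cast add_le_add hd₁ hd₂
    · rw [h₁]; exact_mod_cast h0.1
    · rw [h₂]; exact_mod_cast h0.2
  · have e : min (M x y) 0 + min (M' y z) 0 = ((min m₁ 0 + min m₂ 0 : ℝ) : Gain) := by
      rw [h₁, h₂]; push_cast; rfl
    have h3 : d₁ + d₂ ≤ min m₁ 0 + min m₂ 0 := by
      rcases h with h | h | h
      · exact absurd h h0
      · exact add_le_add (le_min hd₁ h.1) (le_min hd₂ h.2)
      · rw [min_eq_left h.1, min_eq_left h.2]; exact add_le_add hd₁ hd₂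
    refine le_trans ?_ (min_add_min_le_combine (y := y) ?_)
    · rw [e]; exact_mod_cast h3
    · rw [e]; exact_mod_cast hB.trans h3

/-- Two consecutive arcs of the same direction are shortcut in one round. -/
lemma two_arcs_le_shortShortcuts {B : ℝ} {M : Table n} {x y z : Fin n} {m₁ m₂ d₁ d₂ : ℝ}
    (h₁ : M x y = (m₁ : Gain)) (h₂ : M y z = (m₂ : Gain)) (hd₁ : d₁ ≤ m₁) (hd₂ : d₂ ≤ m₂)
    (hB : -B ≤ d₁ + d₂) (h : 0 ≤ m₁ * m₂ ∨ 0 ≤ d₁ * d₂) :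
    ((d₁ + d₂ : ℝ) : Gain) ≤ shortShortcuts B M x z := by
  refine (two_arcs_le_combine h₁ h₂ hd₁ hd₂ hB ?_).trans (two_le_shortShortcuts B M x z)
  simp only [mul_nonneg_iff] at h
  rcases h with (h | h) | h | h
  · exact Or.inl h
  · exact Or.inr (Or.inr h)
  · exact Or.inl ⟨h.1.trans hd₁, h.2.trans hd₂⟩
  · exact Or.inr (Or.inl h)

/-- Three consecutive arcs are shortcut in one round if the one in the middle is shortest. -/
lemma three_arcs_le_shortShortcuts {B : ℝ} {M : Table n} {x y a z : Fin n}
    {m₁ m₂ m₃ d₁ d₂ d₃ : ℝ}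
    (h₁ : M x y = (m₁ : Gain)) (h₂ : M y a = (m₂ : Gain)) (h₃ : M a z = (m₃ : Gain))
    (hd₁ : d₁ ≤ m₁) (hd₂ : d₂ ≤ m₂) (hd₃ : d₃ ≤ m₃) (hB : -B ≤ d₁ + d₂ + d₃)
    (h : (0 ≤ d₁ ∧ d₂ ≤ 0 ∧ 0 ≤ d₃ ∧ 0 ≤ d₁ + d₂ ∧ 0 ≤ d₂ + d₃) ∨
      (0 ≤ m₁ ∧ m₂ ≤ 0 ∧ 0 ≤ m₃ ∧ 0 ≤ m₁ + m₂ ∧ 0 ≤ m₂ + m₃) ∨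
      (d₁ ≤ 0 ∧ 0 ≤ d₂ ∧ d₃ ≤ 0 ∧ d₁ + d₂ ≤ 0 ∧ d₂ + d₃ ≤ 0) ∨
      (m₁ ≤ 0 ∧ 0 ≤ m₂ ∧ m₃ ≤ 0 ∧ m₁ + m₂ ≤ 0 ∧ m₂ + m₃ ≤ 0)) :
    ((d₁ + d₂ + d₃ : ℝ) : Gain) ≤ shortShortcuts B M x z := by
  have key₁ : 0 ≤ m₁ ∧ m₂ ≤ 0 ∧ 0 ≤ m₃ ∧ 0 ≤ m₁ + m₂ ∧ 0 ≤ m₂ + m₃ →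
      ((d₁ + d₂ + d₃ : ℝ) : Gain) ≤ shortShortcuts B M x z := by
    rintro ⟨h4, h5, h6, h7, h8⟩
    refine le_trans ?_ (ascending_le_shortShortcuts (y := y) (a := a) ?_ ?_ ?_ ?_) <;>
      simp only [h₁, h₂, h₃] <;> norm_cast
    linarith
  have key₂ : m₁ ≤ 0 ∧ 0 ≤ m₂ ∧ m₁ + m₂ ≤ 0 ∧ d₁ + d₂ + d₃ ≤ m₁ →
      ((d₁ + d₂ + d₃ : ℝ) : Gain) ≤ shortShortcuts B M x z := by
    rintro ⟨h4, h5, h6, h7⟩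
    refine descending_le_shortShortcuts (y := y) (a := a) ?_ ?_ ?_ ?_ ?_ ?_ <;>
      (try simp only [h₁, h₂, h₃]) <;> norm_cast
    linarith
  rcases h with h | h | h | h
  · rcases le_total m₂ 0 with h0 | h0
    · exact key₁ ⟨by linarith, h0, by linarith, by linarith, by linarith⟩
    -- The profile descends in the middle only because of a drop: in the table all three arcs
    -- ascend.
    · have h2 : ((m₂ + m₃ : ℝ) : Gain) ≤ combine B M M y z := by
        refine le_trans ?_ (add_le_combine (y := a) ?_ ?_) <;> simp only [h₂, h₃] <;> norm_cast
        linarith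
      have h4 : (0 : Gain) ≤ ((m₂ + m₃ : ℝ) : Gain) := by norm_cast; linarith
      refine le_trans ?_ ((add_le_combine (y := y) ?_ (h4.trans h2)).trans
        (three_le_shortShortcuts B M x z))
      · refine le_trans ?_ (add_le_add le_rfl h2)
        rw [h₁]; norm_cast; linarith
      · rw [h₁]; norm_cast; linarith
  · exact key₁ h
  · rcases le_total 0 m₁ with h0 | h0
    -- The first arc ascends in the table. Keeping only `0` of each of the first two arcs is good
    -- enough, since `d₁ + d₂ ≤ 0`.
    · have h2 : ((0 + d₃ : ℝ) : Gain) ≤ combine B M M y z :=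
        two_arcs_le_combine h₂ h₃ (h.2.1.trans hd₂) hd₃ (by linarith)
          (Or.inr (Or.inl ⟨le_rfl, h.2.2.1⟩))
      have h3 : min (M x y) 0 = 0 := min_eq_right (by rw [h₁]; exact_mod_cast h0)
      have h4 : ((0 + d₃ : ℝ) : Gain) ≤ min (M x y) 0 + min (combine B M M y z) 0 := by
        rw [h3, zero_add (min (combine B M M y z) 0)]
        exact le_min h2 (by norm_cast; linarith)
      refine le_trans ?_ ((min_add_min_le_combine (y := y) (le_trans ?_ h4)).trans
        (three_le_shortShortcuts B M x z))
      · refine le_trans ?_ h4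
        norm_cast; linarith
      · norm_cast; linarith
    · rcases le_total (m₁ + m₂) 0 with h1 | h1
      · exact key₂ ⟨h0, h.2.1.trans hd₂, h1, by linarith⟩
      -- The middle arc can undo the first one completely. The sum of the `dᵢ` is at most `m₁`
      -- because `d₂ + d₃ ≤ 0`, and at most `m₃` because `d₁ + d₂ ≤ 0`.
      · refine le_trans ?_ (min_le_shortShortcuts (y := y) (a := a) ?_ ?_) <;>
          simp only [h₁, h₂, h₃] <;> norm_cast
        exact le_min (by linarith) (by linarith)
  · exact key₂ ⟨h.1, h.2.1, h.2.2.2.1, by linarith⟩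

/-! ### Gain profiles and monotone paths -/

/-- `g` is a gain profile of the path `x 0, …, x k`: the gains at the vertices of the path for some
affordable charge drop schedule that makes the path monotone. -/
structure Profile (B : ℝ) (M : Table n) (x : ℕ → Fin n) (k : ℕ) (g : ℕ → ℝ) : Prop where
  zero : g 0 = 0
  arc : ∀ p < k, ((g (p + 1) - g p : ℝ) : Gain) ≤ M (x p) (x (p + 1))
  draw : ∀ i j, i ≤ j → j ≤ k → g i - B ≤ g j
  mono : (∀ i ≤ k, 0 ≤ g i ∧ g i ≤ g k) ∨ ∀ i ≤ k, g i ≤ 0 ∧ g k ≤ g i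

lemma Profile.mono_table {B : ℝ} {M M' : Table n} {x : ℕ → Fin n} {k : ℕ} {g : ℕ → ℝ}
    (h : Profile B M x k g) (hM : ∀ a b, M a b ≤ M' a b) : Profile B M' x k g :=
  ⟨h.zero, fun p hp => (h.arc p hp).trans (hM _ _), h.draw, h.mono⟩

/-- A car that got stuck stays stuck, so the charge is real at every vertex up to `k`. The charges
`b` lie in `[0, B]` and thus never fall by more than `B`. -/
lemma charge_bounds {B : ℝ} (hB : 0 ≤ B) {M : Table n} {v : ℕ → Fin n} {k : ℕ}
    (h : Traversable B M v k) :
    ∃ m b : ℕ → ℝ, (∀ p < k, M (v p) (v (p + 1)) = (m p : Gain)) ∧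
      (∀ p < k, b (p + 1) - b p ≤ m p) ∧ ∀ i ≤ k, 0 ≤ b i ∧ b i ≤ B := by
  have hstep : ∀ i, 0 ≤ charge B M v B (i + 1) →
      0 ≤ charge B M v B i + M (v i) (v (i + 1)) := by
    intro i hi
    by_contra h0
    rw [charge, if_neg h0] at hi
    exact absurd hi (by simp)
  have hne : ∀ i, charge B M v B (i + 1) ≤ B := by
    intro i
    rw [charge]
    split_ifs
    · exact min_le_left _ _
    · exact bot_le
  have hle : ∀ i, charge B M v B i ≤ B := by
    intro i
    cases i with
    | zero => simp [charge]
    | succ i => exact hne i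
  have hnonneg : ∀ i, 0 ≤ charge B M v B i + M (v i) (v (i + 1)) → 0 ≤ charge B M v B i := by
    intro i hi
    cases i with
    | zero => simp only [charge, min_self]; exact_mod_cast hB
    | succ i =>
      by_contra h0
      have : charge B M v B (i + 1) = ⊥ := by
        rw [charge] at h0 ⊢
        by_cases hc : 0 ≤ charge B M v B i + M (v i) (v (i + 1))
        · rw [if_pos hc] at h0
          exact absurd (le_min (by exact_mod_cast hB) hc) h0
        · rw [if_neg hc]
      rw [this] at hi
      simp at hi
  have hall : ∀ j ≤ k, 0 ≤ charge B M v B (k - j) := by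
    intro j
    induction j with
    | zero => intro _; exact h
    | succ j ih =>
      intro hj
      have h1 := ih (by omega)
      have e : k - j = (k - (j + 1)) + 1 := by omega
      rw [e] at h1
      exact hnonneg _ (hstep _ h1)
  have hall' : ∀ i ≤ k, 0 ≤ charge B M v B i := fun i hi => by
    have := hall (k - i) (by omega)
    rwa [show k - (k - i) = i by omega] at this
  refine ⟨fun p => (M (v p) (v (p + 1))).unbotD 0, fun p => (charge B M v B p).unbotD 0, ?_, ?_, ?_⟩
  · intro p hp
    have h1 := hstep p (hall' (p + 1) hp)
    have : M (v p) (v (p + 1)) ≠ ⊥ := fun h0 => by simp [h0] at h1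
    obtain ⟨m, hm⟩ := WithBot.ne_bot_iff_exists.1 this
    dsimp only
    rw [← hm]; rfl
  · intro p hp
    have h1 := hstep p (hall' (p + 1) hp)
    have h2 : M (v p) (v (p + 1)) ≠ ⊥ := fun h0 => by simp [h0] at h1
    have h3 : charge B M v B p ≠ ⊥ := fun h0 => by simp [h0] at h1
    obtain ⟨m, hm⟩ := WithBot.ne_bot_iff_exists.1 h2
    obtain ⟨b, hb⟩ := WithBot.ne_bot_iff_exists.1 h3
    have h4 : charge B M v B (p + 1) = ((min B (b + m) : ℝ) : Gain) := by
      rw [charge, if_pos h1, ← hm, ← hb]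
      push_cast; rfl
    simp only [h4, ← hm, ← hb, WithBot.unbotD_coe]
    linarith [min_le_right B (b + m)]
  · intro i hi
    have h1 := hall' i hi
    have h3 : charge B M v B i ≠ ⊥ := fun h0 => by simp [h0] at h1
    obtain ⟨b, hb⟩ := WithBot.ne_bot_iff_exists.1 h3
    have h4 := hle i
    dsimp only
    rw [← hb] at h1 h4 ⊢
    simp only [WithBot.unbotD_coe]
    exact ⟨by exact_mod_cast h1, by exact_mod_cast h4⟩

lemma gainAt_coe {M : Table n} {v : ℕ → Fin n} {C : ℕ → ℝ} {m : ℕ → ℝ} {k : ℕ}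
    (h : ∀ p < k, M (v p) (v (p + 1)) = (m p : Gain)) {i : ℕ} (hi : i ≤ k) :
    gainAt M v C i = ((∑ t ∈ Finset.range i, (m t - C (t + 1)) : ℝ) : Gain) := by
  induction i with
  | zero => simp [gainAt]
  | succ i ih =>
    have := ih (by omega)
    unfold gainAt at this ⊢
    rw [Finset.sum_range_succ, this, Finset.sum_range_succ, h i (by omega)]
    rw [← WithBot.coe_add, ← WithBot.coe_add, sub_eq_add_neg]

/-- The profile with as large gains as possible that are at most `c`. -/
def greedy (m : ℕ → ℝ) (c : ℝ) : ℕ → ℝ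
  | 0 => 0
  | i + 1 => min (greedy m c i + m i) c

lemma greedy_le {m : ℕ → ℝ} {c : ℝ} (hc : 0 ≤ c) (i : ℕ) : greedy m c i ≤ c := by
  cases i with
  | zero => exact hc
  | succ i => exact min_le_right _ _

lemma le_greedy {m g : ℕ → ℝ} {c : ℝ} {k : ℕ} (h₀ : g 0 = 0)
    (hg : ∀ p < k, g (p + 1) - g p ≤ m p) (hc : ∀ i ≤ k, g i ≤ c) :
    ∀ i ≤ k, g i ≤ greedy m c i := by
  intro i
  induction i with
  | zero => intro _; exact h₀.le
  | succ i ih =>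
    intro hi
    exact le_min (by linarith [ih (by omega), hg i hi]) (hc _ hi)

/-- After the last time the cap is active (or after `i`, if it is not), the greedy gains follow the
arc gains and so rise at least as much as `b` does. -/
lemma greedy_draw {m b : ℕ → ℝ} {B c : ℝ} {k : ℕ} (hc : 0 ≤ c)
    (hb : ∀ p < k, b (p + 1) - b p ≤ m p) (hd : ∀ i j, i ≤ j → j ≤ k → b i - B ≤ b j) :
    ∀ i j, i ≤ j → j ≤ k → greedy m c i - B ≤ greedy m c j := by
  intro i j hij hj
  have : ∃ l, i ≤ l ∧ l ≤ j ∧ greedy m c i + b j - b l ≤ greedy m c j := by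
    induction j, hij using Nat.le_induction with
    | base => exact ⟨i, le_rfl, le_rfl, by linarith⟩
    | succ j hij ih =>
      obtain ⟨l, hl, hlj, h⟩ := ih (by omega)
      have h1 := hb j hj
      rcases min_choice (greedy m c j + m j) c with h2 | h2
      · exact ⟨l, hl, by omega, by rw [greedy, h2]; linarith⟩
      · exact ⟨j + 1, by omega, le_rfl, by rw [greedy, h2]; linarith [greedy_le (m := m) hc i]⟩
  obtain ⟨l, _, hlj, h⟩ := this
  linarith [hd l j hlj hj]

/-- A profile is called tight if charge is dropped only at the top, or in the last vertex. -/
def Tight (m g : ℕ → ℝ) (k : ℕ) : Prop :=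
  ∀ p, p + 1 < k → g (p + 1) - g p = m p ∨ ∀ j ≤ k, g j ≤ g (p + 1)

/-- The greedy gains capped at the top value, `g k` for an ascending and `0` for a descending path,
dominate `g` and inherit the draw bound from `b`. Charge is dropped only where the cap is active,
that is, at the top. -/
lemma exists_tight {m g b : ℕ → ℝ} {B : ℝ} {k : ℕ} (hB : 0 ≤ B) (h₀ : g 0 = 0)
    (hg : ∀ p < k, g (p + 1) - g p ≤ m p) (hb : ∀ p < k, b (p + 1) - b p ≤ m p)
    (hd : ∀ i j, i ≤ j → j ≤ k → b i - B ≤ b j)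
    (hmono : (∀ i ≤ k, 0 ≤ g i ∧ g i ≤ g k) ∨ ∀ i ≤ k, g i ≤ 0 ∧ g k ≤ g i) :
    ∃ G : ℕ → ℝ, G 0 = 0 ∧ (∀ p < k, G (p + 1) - G p ≤ m p) ∧
      (∀ i j, i ≤ j → j ≤ k → G i - B ≤ G j) ∧
      ((∀ i ≤ k, 0 ≤ G i ∧ G i ≤ G k) ∨ ∀ i ≤ k, G i ≤ 0 ∧ G k ≤ G i) ∧
      g k ≤ G k ∧ Tight m G k := by
  have hinc : ∀ c p, greedy m c (p + 1) - greedy m c p ≤ m p := fun c p => by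
    rw [greedy]; linarith [min_le_left (greedy m c p + m p) c]
  have htop : ∀ c p, greedy m c (p + 1) - greedy m c p = m p ∨ greedy m c (p + 1) = c := by
    intro c p
    rw [greedy]
    rcases min_choice (greedy m c p + m p) c with h | h
    · left; rw [h]; ring
    · right; exact h
  rcases hmono with hm | hm
  · have hc := (hm k le_rfl).1
    have hle := le_greedy h₀ hg (fun i hi => (hm i hi).2)
    have hk : greedy m (g k) k = g k := le_antisymm (greedy_le hc k) (hle k le_rfl)
    refine ⟨greedy m (g k), rfl, fun p _ => hinc _ p, greedy_draw hc hb hd,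
      Or.inl fun i hi => ⟨(hm i hi).1.trans (hle i hi), by rw [hk]; exact greedy_le hc i⟩,
      hk.ge, fun p _ => ?_⟩
    rcases htop (g k) p with h | h
    · exact Or.inl h
    · exact Or.inr fun j _ => by rw [h]; exact greedy_le hc j
  · have hle := le_greedy h₀ hg (fun i hi => (hm i hi).1)
    have hdr := greedy_draw le_rfl hb hd
    -- A descending path must end at its minimum, so the surplus is dropped at the last vertex. The
    -- bound `-B` is needed because traversability ignores the schedule and `g k` may lie below
    -- `-B`.
    set G : ℕ → ℝ := fun i => if i < k then greedy m 0 i else max (g k) (-B) with hG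
    have hGk : G k = max (g k) (-B) := by simp [hG]
    have hGi : ∀ i < k, G i = greedy m 0 i := fun i hi => by simp [hG, hi]
    have hB' : ∀ i ≤ k, -B ≤ greedy m 0 i := fun i hi => by
      have := hdr 0 i (by omega) hi
      simpa [greedy] using this
    have hGle : ∀ i ≤ k, G i ≤ greedy m 0 i := by
      intro i hi
      rcases hi.lt_or_eq with h | rfl
      · rw [hGi i h]
      · rw [hGk]; exact max_le (hle i le_rfl) (hB' i le_rfl)
    have hGk' : ∀ i ≤ k, G k ≤ G i := by
      intro i hi
      rcases hi.lt_or_eq with h | rfl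
      · rw [hGi i h, hGk]; exact max_le ((hm i hi).2.trans (hle i hi)) (hB' i hi)
      · rfl
    have hGB : ∀ i ≤ k, -B ≤ G i := fun i hi => (le_max_right _ _).trans (hGk ▸ hGk' i hi)
    refine ⟨G, ?_, fun p hp => ?_, fun i j hij hj => ?_, Or.inr fun i hi =>
      ⟨(hGle i hi).trans (greedy_le le_rfl i), hGk' i hi⟩, hGk ▸ le_max_left _ _, fun p hp => ?_⟩
    · rcases Nat.eq_zero_or_pos k with rfl | hk
      · rw [hGk, h₀]; simp [hB]
      · rw [hGi 0 hk]; rfl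
    · rw [hGi p hp]
      linarith [hGle (p + 1) hp, hinc 0 p]
    · linarith [hGB j hj, (hGle i (hij.trans hj)).trans (greedy_le (m := m) le_rfl i)]
    · rw [hGi p (by omega), hGi (p + 1) hp]
      rcases htop 0 p with h | h
      · exact Or.inl h
      · exact Or.inr fun j hj => by rw [h]; exact (hGle j hj).trans (greedy_le le_rfl j)

lemma Profile.of_isMonotonePath {B : ℝ} (hB : 0 < B) {M : Table n} {v : ℕ → Fin n} {k : ℕ}
    {C : ℕ → ℝ} (h : IsMonotonePath B M v k C) :
    ∃ g, Profile B M v k g ∧ gainAt M v C k ≤ (g k : Gain) := by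
  obtain ⟨ht, ⟨-, hC⟩, hmono⟩ := h
  obtain ⟨m, b, hm, hb, hb'⟩ := charge_bounds hB.le ht
  set g : ℕ → ℝ := fun i => ∑ t ∈ Finset.range i, (m t - C (t + 1)) with hg
  have hgain : ∀ i ≤ k, gainAt M v C i = (g i : Gain) := fun i hi => gainAt_coe hm hi
  have hmono' : (∀ i ≤ k, 0 ≤ g i ∧ g i ≤ g k) ∨ ∀ i ≤ k, g i ≤ 0 ∧ g k ≤ g i := by
    refine hmono.imp (fun h i hi => ?_) (fun h i hi => ?_) <;>
    · have := h i hi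
      rw [hgain i hi, hgain k le_rfl] at this
      exact_mod_cast this
  obtain ⟨G, h0, h1, h2, h3, h4, -⟩ := exists_tight (g := g) hB.le (by simp [hg])
    (fun p hp => by
      simp only [hg, Finset.sum_range_succ]; linarith [hC (p + 1) hp]) hb
    (fun i j hij hj => by linarith [hb' j hj, hb' i (hij.trans hj)]) hmono'
  refine ⟨G, ⟨h0, fun p hp => ?_, h2, h3⟩, ?_⟩
  · rw [hm p hp]; exact_mod_cast h1 p hp
  · rw [hgain k le_rfl]; exact_mod_cast h4

lemma Profile.exists_gains {B : ℝ} {M : Table n} {x : ℕ → Fin n} {k : ℕ} {g : ℕ → ℝ}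
    (h : Profile B M x k g) : ∃ m : ℕ → ℝ, (∀ p < k, M (x p) (x (p + 1)) = (m p : Gain)) ∧
      ∀ p < k, g (p + 1) - g p ≤ m p := by
  have hm : ∀ p < k, M (x p) (x (p + 1)) = (((M (x p) (x (p + 1))).unbotD 0 : ℝ) : Gain) := by
    intro p hp
    have : M (x p) (x (p + 1)) ≠ ⊥ := fun h0 => by simpa [h0] using h.arc p hp
    obtain ⟨m, hm⟩ := WithBot.ne_bot_iff_exists.1 this
    rw [← hm]; rfl
  refine ⟨fun p => (M (x p) (x (p + 1))).unbotD 0, hm, fun p hp => ?_⟩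
  have := h.arc p hp
  rw [hm p hp] at this
  exact_mod_cast this

lemma Profile.exists_tight {B : ℝ} (hB : 0 < B) {M : Table n} {x : ℕ → Fin n} {k : ℕ}
    {g : ℕ → ℝ} (h : Profile B M x k g) :
    ∃ m G : ℕ → ℝ, Profile B M x k G ∧ g k ≤ G k ∧
      (∀ p < k, M (x p) (x (p + 1)) = (m p : Gain)) ∧ Tight m G k := by
  obtain ⟨m, hm, hg⟩ := h.exists_gains
  obtain ⟨G, h0, h1, h2, h3, h4, h5⟩ := EnergyPaths.exists_tight hB.le h.zero hg hg h.draw h.mono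
  refine ⟨m, G, ⟨h0, fun p hp => ?_, h2, h3⟩, h4, hm, h5⟩
  rw [hm p hp]; exact_mod_cast h1 p hp

/-- The slack of each arc is dropped at its head. The charge at `i` is at least `B + g i - g j` for
the last `j ≤ i` at which the battery was full, so `draw` keeps it nonnegative. -/
lemma Profile.isMonotonePath {B : ℝ} {M : Table n} {x : ℕ → Fin n} {k : ℕ} {g : ℕ → ℝ}
    (h : Profile B M x k g) :
    ∃ C, IsMonotonePath B M x k C ∧ gainAt M x C k = (g k : Gain) := by
  obtain ⟨m, hm, hg⟩ := h.exists_gains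
  set C : ℕ → ℝ := fun i => if i = 0 ∨ k < i then 0 else m (i - 1) - (g i - g (i - 1)) with hC
  have hgain : ∀ i ≤ k, gainAt M x C i = (g i : Gain) := by
    intro i hi
    rw [gainAt_coe hm hi]
    norm_cast
    have : ∀ i ≤ k, ∑ t ∈ Finset.range i, (m t - C (t + 1)) = g i := by
      intro i
      induction i with
      | zero => intro _; simp [h.zero]
      | succ i ih =>
        intro hi
        rw [Finset.sum_range_succ, ih (by omega)]
        simp [hC, show ¬ k ≤ i by omega]
    exact this i hi
  refine ⟨C, ⟨?_, ⟨by simp [hC], fun i hi => ?_⟩, ?_⟩, hgain k le_rfl⟩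
  · have hch : ∀ i ≤ k, ∃ c : ℝ, charge B M x B i = (c : Gain) ∧
        ∃ j ≤ i, B + g i - g j ≤ c := by
      intro i
      induction i with
      | zero => intro _; exact ⟨B, by simp [charge], 0, le_rfl, by linarith⟩
      | succ i ih =>
        intro hi
        obtain ⟨c, hc, j, hj, hcj⟩ := ih (by omega)
        have h1 := hg i hi
        have h2 := h.draw j (i + 1) (by omega) hi
        have h3 : charge B M x B i + M (x i) (x (i + 1)) = ((c + m i : ℝ) : Gain) := by
          rw [hc, hm i hi]; rfl
        refine ⟨min B (c + m i), ?_, ?_⟩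
        · rw [charge, h3, if_pos (by norm_cast; linarith)]
          push_cast; rfl
        · rcases min_choice B (c + m i) with h4 | h4
          · exact ⟨i + 1, le_rfl, by rw [h4]; linarith⟩
          · exact ⟨j, by omega, by rw [h4]; linarith⟩
    obtain ⟨c, hc, j, hj, hcj⟩ := hch k le_rfl
    have := h.draw j k hj le_rfl
    unfold Traversable
    rw [hc]
    norm_cast; linarith
  · simp only [hC]
    split_ifs with h0
    · exact le_rfl
    · have := hg (i - 1) (by omega)
      rw [show i - 1 + 1 = i by omega] at this
      linarith
  · refine h.mono.imp (fun h' i hi => ?_) (fun h' i hi => ?_) <;>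
    · rw [hgain i hi, hgain k le_rfl]
      exact_mod_cast h' i hi

/-! ### Shortcutting a path -/

/-- From `0` one can get to `k` by `l` increasing steps that satisfy `A`. -/
def Skip (A : ℕ → ℕ → Prop) (k l : ℕ) : Prop :=
  ∃ φ : ℕ → ℕ, φ 0 = 0 ∧ φ l = k ∧ ∀ i < l, φ i < φ (i + 1) ∧ A (φ i) (φ (i + 1))

lemma Skip.zero (A : ℕ → ℕ → Prop) : Skip A 0 0 := ⟨id, rfl, rfl, by simp⟩

lemma Skip.step {A : ℕ → ℕ → Prop} {p q l : ℕ} (h : Skip A p l) (hpq : p < q) (hA : A p q) :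
    Skip A q (l + 1) := by
  obtain ⟨φ, h0, hl, hφ⟩ := h
  refine ⟨fun i => if i ≤ l then φ i else q, by simp [h0], by simp, fun i hi => ?_⟩
  rcases Nat.lt_succ_iff_lt_or_eq.1 hi with h | rfl
  · have h1 : i ≤ l := h.le
    have h2 : i + 1 ≤ l := h
    simp only [h1, h2, if_true]
    exact hφ i h
  · simp only [le_refl, if_true, Nat.not_succ_le_self, if_false, hl]
    exact ⟨hpq, hA⟩

lemma Skip.mono {A A' : ℕ → ℕ → Prop} {k l : ℕ} (h : Skip A k l)
    (hA : ∀ a b, a < b → b ≤ k → A a b → A' a b) : Skip A' k l := by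
  obtain ⟨φ, h0, hl, hφ⟩ := h
  have hle : ∀ j, ∀ i, i + j = l → φ i ≤ k := by
    intro j
    induction j with
    | zero => intro i hi; rw [show i = l by omega, hl]
    | succ j ih => intro i hi; exact (hφ i (by omega)).1.le.trans (ih (i + 1) (by omega))
  exact ⟨φ, h0, hl, fun i hi => ⟨(hφ i hi).1,
    hA _ _ (hφ i hi).1 (hle (l - (i + 1)) _ (by omega)) (hφ i hi).2⟩⟩

lemma Skip.reverse {A A' : ℕ → ℕ → Prop} {k l : ℕ} (h : Skip A k l)
    (hA : ∀ a b, a < b → b ≤ k → A a b → A' (k - b) (k - a)) : Skip A' k l := by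
  have h' := Skip.mono (A' := fun a b => b ≤ k ∧ A' (k - b) (k - a)) h
    fun a b hab hb h => ⟨hb, hA a b hab hb h⟩
  obtain ⟨φ, h0, hl, hφ⟩ := h'
  refine ⟨fun i => k - φ (l - i), by simp [hl], by simp [h0], fun i hi => ?_⟩
  have h1 := hφ (l - (i + 1)) (by omega)
  rw [show l - (i + 1) + 1 = l - i by omega] at h1
  exact ⟨by dsimp only; omega, h1.2.2⟩

/-- Disjoint shortcuts can be used together. -/
lemma exists_skip {A : ℕ → ℕ → Prop} {k : ℕ} (hA : ∀ p < k, A p (p + 1)) (R : Finset ℕ)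
    (a b : ℕ → ℕ) (hab : ∀ r ∈ R, a r < b r ∧ b r ≤ k ∧ A (a r) (b r))
    (hR : ∀ r ∈ R, ∀ r' ∈ R, r ≠ r' → b r ≤ a r' ∨ b r' ≤ a r) :
    ∃ l, Skip A k l ∧ l + ∑ r ∈ R, (b r - a r - 1) ≤ k := by
  -- Only positions outside the interiors of the shortcuts are visited: from the end of a shortcut
  -- the induction jumps to its start, and from elsewhere it goes back by one arc.
  have key : ∀ p ≤ k, (∀ r ∈ R, ¬ (a r < p ∧ p < b r)) →
      ∃ l, Skip A p l ∧ l + ∑ r ∈ R with b r ≤ p, (b r - a r - 1) ≤ p := by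
    intro p
    induction p using Nat.strong_induction_on with
    | _ p ih =>
    intro hp hfree
    rcases Nat.eq_zero_or_pos p with rfl | hpos
    · refine ⟨0, Skip.zero A, ?_⟩
      rw [Finset.filter_false_of_mem fun r hr => by have := hab r hr; omega]
      simp
    by_cases hex : ∃ r ∈ R, b r = p
    · obtain ⟨r, hr, rfl⟩ := hex
      have h1 := hab r hr
      obtain ⟨l, hl, hsum⟩ := ih (a r) h1.1 (by omega) fun r' hr' h2 => by
        have hne : r ≠ r' := by rintro rfl; omega
        have := hR r hr r' hr' hne
        omega
      refine ⟨l + 1, hl.step h1.1 h1.2.2, ?_⟩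
      have : (R.filter fun r' => b r' ≤ b r) = insert r (R.filter fun r' => b r' ≤ a r) := by
        ext r'
        simp only [Finset.mem_filter, Finset.mem_insert]
        constructor
        · rintro ⟨hr', hle⟩
          by_cases hne : r' = r
          · exact Or.inl hne
          · have := hR r' hr' r hr hne
            have := hab r' hr'
            exact Or.inr ⟨hr', by omega⟩
        · rintro (rfl | ⟨hr', hle⟩)
          · exact ⟨hr, le_rfl⟩
          · exact ⟨hr', by omega⟩
      rw [this, Finset.sum_insert (by simp; omega)]
      omega
    · push Not at hex
      obtain ⟨l, hl, hsum⟩ := ih (p - 1) (by omega) (by omega) fun r hr h2 => by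
        have := hex r hr
        exact hfree r hr ⟨by omega, by omega⟩
      have h2 := hl.step (show p - 1 < p by omega) (by
        have := hA (p - 1) (by omega); rwa [show p - 1 + 1 = p by omega] at this)
      refine ⟨l + 1, h2, ?_⟩
      have : (R.filter fun r' => b r' ≤ p) = R.filter fun r' => b r' ≤ p - 1 := by
        refine Finset.filter_congr fun r hr => ?_
        have := hex r hr
        omega
      rw [this]; omega
  obtain ⟨l, hl, hsum⟩ := key k le_rfl fun r hr h => by have := hab r hr; omega
  rw [Finset.filter_true_of_mem fun r hr => (hab r hr).2.1] at hsum
  exact ⟨l, hl, hsum⟩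

/-- The arc from `x a` to `x b` in the table `M` is at least as good as the gain profile `g`. -/
def Covers (M : Table n) (x : ℕ → Fin n) (g : ℕ → ℝ) (a b : ℕ) : Prop :=
  ((g b - g a : ℝ) : Gain) ≤ M (x a) (x b)

/-- Apart from `arc`, the conditions on a profile concern its ends and arbitrary ordered pairs of
vertices, so they pass to subsequences with the same ends. -/
lemma Profile.skip {B : ℝ} {M M' : Table n} {x : ℕ → Fin n} {k l : ℕ} {g : ℕ → ℝ}
    (h : Profile B M x k g) (hs : Skip (Covers M' x g) k l) :
    ∃ (x' : ℕ → Fin n) (g' : ℕ → ℝ), Profile B M' x' l g' ∧ g' l = g k ∧ x' 0 = x 0 ∧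
      x' l = x k ∧ (Set.InjOn x (Set.Iic k) → Set.InjOn x' (Set.Iic l)) := by
  obtain ⟨φ, h0, hl, hφ⟩ := hs
  have hlt : ∀ i j, i < j → j ≤ l → φ i < φ j := by
    intro i j hij
    induction j, hij using Nat.le_induction with
    | base => intro hj; exact (hφ i hj).1
    | succ j hij ih => intro hj; exact (ih (by omega)).trans (hφ j hj).1
  have hle : ∀ i j, i ≤ j → j ≤ l → φ i ≤ φ j := fun i j hij hj => by
    rcases hij.lt_or_eq with h | rfl
    · exact (hlt i j h hj).le
    · exact le_rfl
  have hk : ∀ i ≤ l, φ i ≤ k := fun i hi => hl ▸ hle i l hi le_rfl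
  refine ⟨x ∘ φ, g ∘ φ, ⟨by simp [h0, h.zero], fun p hp => (hφ p hp).2,
    fun i j hij hj => h.draw _ _ (hle i j hij hj) (hk j hj), ?_⟩, by simp [hl], by simp [h0],
    by simp [hl], fun hinj i hi j hj hij => ?_⟩
  · simp only [Function.comp, hl]
    exact h.mono.imp (fun h i hi => h _ (hk i hi)) (fun h i hi => h _ (hk i hi))
  · have := hinj (hk i hi) (hk j hj) hij
    by_contra hne
    rcases Nat.lt_or_gt_of_ne hne with h1 | h1
    · exact absurd this (hlt i j h1 hj).ne
    · exact absurd this (hlt j i h1 hi).ne'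

/-- The arc `p` is neither in the direction of a neighbouring arc nor a weak local minimum of the
absolute values. -/
def Alternates (f : ℕ → ℝ) (p : ℕ) : Prop :=
  f (p - 1) * f p < 0 ∧ f p * f (p + 1) < 0 ∧ (|f (p - 1)| < |f p| ∨ |f (p + 1)| < |f p|)

/-- A shortcut for a part of the path next to the arc `p` is available in the table `S`. -/
def Event (S : Table n) (x : ℕ → Fin n) (g : ℕ → ℝ) (p : ℕ) : Prop :=
  Covers S x g (p - 1) (p + 1) ∨ Covers S x g p (p + 2) ∨ Covers S x g (p - 1) (p + 2)

lemma weak_min_cases {a b c : ℝ} (h₁ : a * b < 0) (h₂ : b * c < 0) (h₃ : |b| ≤ |a|)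
    (h₄ : |b| ≤ |c|) : (0 ≤ a ∧ b ≤ 0 ∧ 0 ≤ c ∧ 0 ≤ a + b ∧ 0 ≤ b + c) ∨
      (a ≤ 0 ∧ 0 ≤ b ∧ c ≤ 0 ∧ a + b ≤ 0 ∧ b + c ≤ 0) := by
  rcases mul_neg_iff.1 h₁ with ⟨h5, h6⟩ | ⟨h5, h6⟩ <;>
    rcases mul_neg_iff.1 h₂ with ⟨h7, h8⟩ | ⟨h7, h8⟩
  · linarith
  · left
    rw [abs_of_neg h6, abs_of_pos h5] at h₃
    rw [abs_of_neg h6, abs_of_pos h8] at h₄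
    exact ⟨h5.le, h6.le, h8.le, by linarith, by linarith⟩
  · right
    rw [abs_of_pos h6, abs_of_neg h5] at h₃
    rw [abs_of_pos h6, abs_of_neg h8] at h₄
    exact ⟨h5.le, h6.le, h8.le, by linarith, by linarith⟩
  · linarith

section

variable {B : ℝ} {M : Table n} {x : ℕ → Fin n} {k : ℕ} {g m : ℕ → ℝ}

lemma Profile.covers_two (h : Profile B M x k g)
    (hm : ∀ p < k, M (x p) (x (p + 1)) = (m p : Gain)) {p : ℕ} (hp : p + 2 ≤ k)
    (hs : 0 ≤ m p * m (p + 1) ∨ 0 ≤ (g (p + 1) - g p) * (g (p + 2) - g (p + 1))) :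
    Covers (shortShortcuts B M) x g p (p + 2) := by
  have h1 := h.arc p (by omega)
  have h2 := h.arc (p + 1) (by omega)
  rw [hm p (by omega)] at h1
  rw [hm (p + 1) (by omega)] at h2
  have h3 := h.draw p (p + 2) (by omega) hp
  have := two_arcs_le_shortShortcuts (B := B) (hm p (by omega)) (hm (p + 1) (by omega))
    (by exact_mod_cast h1) (by exact_mod_cast h2) (by linarith) hs
  unfold Covers
  rwa [show g (p + 2) - g p = (g (p + 1) - g p) + (g (p + 2) - g (p + 1)) by ring]

lemma Profile.covers_three (h : Profile B M x k g)
    (hm : ∀ p < k, M (x p) (x (p + 1)) = (m p : Gain)) {p : ℕ} (hp : p + 3 ≤ k)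
    (hs : (m p * m (p + 1) < 0 ∧ m (p + 1) * m (p + 2) < 0 ∧ |m (p + 1)| ≤ |m p| ∧
        |m (p + 1)| ≤ |m (p + 2)|) ∨
      ((g (p + 1) - g p) * (g (p + 2) - g (p + 1)) < 0 ∧
        (g (p + 2) - g (p + 1)) * (g (p + 3) - g (p + 2)) < 0 ∧
        |g (p + 2) - g (p + 1)| ≤ |g (p + 1) - g p| ∧
        |g (p + 2) - g (p + 1)| ≤ |g (p + 3) - g (p + 2)|)) :
    Covers (shortShortcuts B M) x g p (p + 3) := by
  have h1 := h.arc p (by omega)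
  have h2 := h.arc (p + 1) (by omega)
  have h3 := h.arc (p + 2) (by omega)
  rw [hm p (by omega)] at h1
  rw [hm (p + 1) (by omega)] at h2
  rw [hm (p + 2) (by omega)] at h3
  have h4 := h.draw p (p + 3) (by omega) hp
  have h1 : g (p + 1) - g p ≤ m p := by exact_mod_cast h1
  have h2 : g (p + 2) - g (p + 1) ≤ m (p + 1) := by exact_mod_cast h2
  have h3 : g (p + 3) - g (p + 2) ≤ m (p + 2) := by exact_mod_cast h3
  unfold Covers
  rw [show g (p + 3) - g p = (g (p + 1) - g p) + (g (p + 2) - g (p + 1)) +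
    (g (p + 3) - g (p + 2)) by ring]
  refine three_arcs_le_shortShortcuts (hm p (by omega)) (hm (p + 1) (by omega))
    (hm (p + 2) (by omega)) h1 h2 h3 (by linarith) ?_
  rcases hs with hs | hs
  · rcases weak_min_cases hs.1 hs.2.1 hs.2.2.1 hs.2.2.2 with h | h
    · exact Or.inr (Or.inl h)
    · exact Or.inr (Or.inr (Or.inr h))
  · rcases weak_min_cases hs.1 hs.2.1 hs.2.2.1 hs.2.2.2 with h | h
    · exact Or.inl h
    · exact Or.inr (Or.inr (Or.inl h))

/-- Arcs without an available shortcut alternate, both in the graph and in the profile. -/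
lemma Profile.alternates (h : Profile B M x k g)
    (hm : ∀ p < k, M (x p) (x (p + 1)) = (m p : Gain)) {p : ℕ} (hp₀ : 0 < p) (hp : p + 1 < k)
    (hev : ¬ Event (shortShortcuts B M) x g p) :
    Alternates m p ∧ Alternates (fun i => g (i + 1) - g i) p := by
  obtain ⟨p, rfl⟩ : ∃ q, p = q + 1 := ⟨p - 1, by omega⟩
  unfold Event at hev
  simp only [Nat.add_sub_cancel] at hev
  push Not at hev
  obtain ⟨h1, h2, h3⟩ := hev
  have h1 := mt (h.covers_two hm (by omega)) h1
  have h2 := mt (h.covers_two hm (by omega)) h2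
  have h3 := mt (h.covers_three hm (by omega)) h3
  push Not at h1 h2 h3
  unfold Alternates
  simp only [Nat.add_sub_cancel]
  refine ⟨⟨h1.1, h2.1, ?_⟩, h1.2, h2.2, ?_⟩
  · by_contra! h4
    exact absurd (h3.1 h1.1 h2.1 h4.1) (not_lt.2 h4.2)
  · by_contra! h4
    exact absurd (h3.2 h1.2 h2.2 h4.1) (not_lt.2 h4.2)

lemma Profile.covers_short (h : Profile B M x k g) {p : ℕ} (hp : p < k) :
    Covers (shortShortcuts B M) x g p (p + 1) :=
  (h.arc p hp).trans (le_shortShortcuts B M _ _)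

/-- A path with at least two arcs has a shortcut. -/
lemma Profile.exists_covers (h : Profile B M x k g) (hk : 2 ≤ k) :
    ∃ a b, a + 2 ≤ b ∧ b ≤ k ∧ Covers (shortShortcuts B M) x g a b := by
  by_contra! hno
  obtain ⟨m, hm, -⟩ := h.exists_gains
  have h2 : ∀ p, p + 2 ≤ k → (g (p + 1) - g p) * (g (p + 2) - g (p + 1)) < 0 := fun p hp => by
    by_contra! h0
    exact hno p (p + 2) le_rfl hp (h.covers_two hm hp (Or.inr h0))
  have h3 : ∀ p, p + 3 ≤ k → |g (p + 2) - g (p + 1)| ≤ |g (p + 1) - g p| →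
      |g (p + 3) - g (p + 2)| < |g (p + 2) - g (p + 1)| := fun p hp h0 => by
    by_contra! h1
    exact hno p (p + 3) (by omega) hp (h.covers_three hm hp
      (Or.inr ⟨h2 p (by omega), h2 (p + 1) (by omega), h0, h1⟩))
  -- The gain stays on one side of `g 0 = 0`, so the second increment cannot outweigh the first.
  have hbase : |g 2 - g 1| ≤ |g 1 - g 0| := by
    have h4 := h2 0 hk
    have h0 := h.zero
    rcases h.mono with hmo | hmo
    · have h5 := hmo 1 (by omega)
      have h6 := hmo 2 hk
      rcases mul_neg_iff.1 h4 with ⟨h7, h8⟩ | ⟨h7, h8⟩ <;> norm_num at h7 h8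
      · rw [abs_of_neg (sub_neg.2 h8), abs_of_pos (sub_pos.2 h7)]; linarith
      · linarith
    · have h5 := hmo 1 (by omega)
      have h6 := hmo 2 hk
      rcases mul_neg_iff.1 h4 with ⟨h7, h8⟩ | ⟨h7, h8⟩ <;> norm_num at h7 h8
      · linarith
      · rw [abs_of_pos (sub_pos.2 h8), abs_of_neg (sub_neg.2 h7)]; linarith
  have hall : ∀ p, p + 2 ≤ k → |g (p + 2) - g (p + 1)| ≤ |g (p + 1) - g p| := by
    intro p
    induction p with
    | zero => intro _; exact hbase
    | succ p ih => intro hp; exact (h3 p hp (ih (by omega))).le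
  obtain ⟨q, rfl⟩ : ∃ q, k = q + 2 := ⟨k - 2, by omega⟩
  have h4 := h2 q le_rfl
  rcases Nat.eq_zero_or_pos q with rfl | hq
  · have h0 := h.zero
    rcases h.mono with hmo | hmo
    · have h5 := hmo 1 (by omega)
      norm_num at h4 h5
      nlinarith
    · have h5 := hmo 1 (by omega)
      norm_num at h4 h5
      nlinarith
  obtain ⟨r, rfl⟩ : ∃ r, q = r + 1 := ⟨q - 1, by omega⟩
  -- The last increment is smaller than the one before it and of opposite sign, so the last vertex
  -- is not extremal.
  have h5 := h3 r (by omega) (hall r (by omega))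
  rw [show r + 1 + 2 = r + 3 by ring, show r + 1 + 1 = r + 2 by ring] at h4
  rcases h.mono with hmo | hmo
  · have h6 := (hmo (r + 1) (by omega)).2
    have h7 := (hmo (r + 2) (by omega)).2
    rw [show r + 1 + 2 = r + 3 by ring] at h6 h7
    rcases mul_neg_iff.1 h4 with ⟨h8, h9⟩ | ⟨h8, h9⟩
    · linarith
    · rw [abs_of_pos h9, abs_of_neg h8] at h5; linarith
  · have h6 := (hmo (r + 1) (by omega)).2
    have h7 := (hmo (r + 2) (by omega)).2
    rw [show r + 1 + 2 = r + 3 by ring] at h6 h7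
    rcases mul_neg_iff.1 h4 with ⟨h8, h9⟩ | ⟨h8, h9⟩
    · rw [abs_of_neg h9, abs_of_pos h8] at h5; linarith
    · linarith

lemma Profile.exists_skip_short (h : Profile B M x k g) (hk : 2 ≤ k) :
    ∃ l, Skip (Covers (shortShortcuts B M) x g) k l ∧ l < k := by
  obtain ⟨a, b, hab, hb, hc⟩ := h.exists_covers hk
  obtain ⟨l, hl, hsum⟩ := exists_skip (fun p hp => h.covers_short hp) {0} (fun _ => a)
    (fun _ => b) (by simp only [Finset.mem_singleton]; rintro r -; exact ⟨by omega, hb, hc⟩)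
    (by simp only [Finset.mem_singleton]; omega)
  rw [Finset.sum_singleton] at hsum
  exact ⟨l, hl, by omega⟩

open Classical in
/-- One round of Short-Shortcuts saves a third of the number of events. -/
lemma Profile.exists_skip_events (h : Profile B M x k g) :
    ∃ l, Skip (Covers (shortShortcuts B M) x g) k l ∧
      3 * l + ((Finset.range k).filter fun p => 0 < p ∧ p + 1 < k ∧
        Event (shortShortcuts B M) x g p).card ≤ 3 * k := by
  set E := (Finset.range k).filter fun p => 0 < p ∧ p + 1 < k ∧
        Event (shortShortcuts B M) x g p with hE
  -- The shortcut of an event `p` lies in `[p - 1, p + 2]`, so events in one residue class modulo 3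
  -- have disjoint shortcuts.
  have hcard : ∃ c < 3, E.card ≤ 3 * (E.filter fun p => p % 3 = c).card := by
    have h1 : E.card = ∑ c ∈ Finset.range 3, (E.filter fun p => p % 3 = c).card :=
      Finset.card_eq_sum_card_fiberwise fun p _ => by
        simp only [Finset.coe_range, Set.mem_Iio]; exact Nat.mod_lt _ (by omega)
    simp only [Finset.sum_range_succ, Finset.sum_range_zero] at h1
    by_contra! h2
    have := h2 0 (by omega)
    have := h2 1 (by omega)
    have := h2 2 (by omega)
    omega
  obtain ⟨c, -, hc⟩ := hcard
  have hmem : ∀ p ∈ E.filter fun p => p % 3 = c, ∃ a b, p - 1 ≤ a ∧ a + 2 ≤ b ∧ b ≤ p + 2 ∧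
      0 < p ∧ p + 1 < k ∧ p % 3 = c ∧ Covers (shortShortcuts B M) x g a b := by
    intro p hp
    simp only [hE, Finset.mem_filter] at hp
    obtain ⟨⟨-, h1, h2, h3⟩, h4⟩ := hp
    rcases h3 with h3 | h3 | h3
    · exact ⟨p - 1, p + 1, by omega, by omega, by omega, h1, h2, h4, h3⟩
    · exact ⟨p, p + 2, by omega, by omega, by omega, h1, h2, h4, h3⟩
    · exact ⟨p - 1, p + 2, by omega, by omega, by omega, h1, h2, h4, h3⟩
  choose! a b hab using hmem
  obtain ⟨l, hl, hsum⟩ := exists_skip (fun p hp => h.covers_short hp)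
    (E.filter fun p => p % 3 = c) a b (fun p hp => by
      have := hab p hp
      exact ⟨by omega, by omega, this.2.2.2.2.2.2⟩) (fun p hp q hq hne => by
      have h1 := hab p hp
      have h2 := hab q hq
      omega)
  refine ⟨l, hl, ?_⟩
  have : (E.filter fun p => p % 3 = c).card ≤ ∑ p ∈ E.filter (fun p => p % 3 = c), (b p - a p - 1) := by
    rw [Finset.card_eq_sum_ones]
    refine Finset.sum_le_sum fun p hp => ?_
    have := hab p hp
    omega
  omega

end

/-! ### The rounds of Update-Shortcuts -/

lemma le_iterate_shortShortcuts (B : ℝ) (M : Table n) (j : ℕ) (a b : Fin n) :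
    M a b ≤ (shortShortcuts B)^[j] M a b := by
  induction j with
  | zero => exact le_rfl
  | succ j ih => rw [Function.iterate_succ_apply']; exact ih.trans (le_shortShortcuts B _ a b)

lemma le_of_mem_support_rounds {Θ : Params} {B p : ℝ} (r : ℕ) {M M₀ M' : Table n}
    (h : M' ∈ (rounds Θ B p r M M₀).support) :
    (∀ a b, (shortShortcuts B)^[r] M a b ≤ M' a b) ∧ ∀ a b, M₀ a b ≤ M' a b := by
  induction r generalizing M M₀ with
  | zero =>
    simp only [rounds, PMF.support_pure, Set.mem_singleton_iff] at h
    subst h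
    exact ⟨fun a b => le_sup_left, fun a b => le_sup_right⟩
  | succ r ih =>
    simp only [rounds, PMF.mem_support_bind_iff] at h
    obtain ⟨b, -, M₁, hM₁, hM'⟩ := h
    have h1 := ih hM'
    refine ⟨h1.1, fun a c => le_trans ?_ (h1.2 a c)⟩
    split_ifs at hM₁
    · simp only [PMF.support_map, Set.mem_image] at hM₁
      obtain ⟨L, -, rfl⟩ := hM₁
      exact le_sup_left
    · simp only [PMF.support_pure, Set.mem_singleton_iff] at hM₁
      rw [hM₁]

/-- A path that is shortened by at least one arc in every round. -/
lemma exists_profile_iterate {B : ℝ} {M : Table n} {x : ℕ → Fin n} {k : ℕ} {g : ℕ → ℝ}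
    (h : Profile B M x k g) (j : ℕ) :
    ∃ (x' : ℕ → Fin n) (k' : ℕ) (g' : ℕ → ℝ), Profile B ((shortShortcuts B)^[j] M) x' k' g' ∧
      g' k' = g k ∧ x' 0 = x 0 ∧ x' k' = x k ∧ k' ≤ max (k - j) (min k 1) := by
  induction j with
  | zero => exact ⟨x, k, g, h, rfl, rfl, rfl, by omega⟩
  | succ j ih =>
    obtain ⟨x', k', g', h1, h2, h3, h4, h5⟩ := ih
    rw [Function.iterate_succ_apply']
    by_cases hk : 2 ≤ k'
    · obtain ⟨l, hl, hlk⟩ := h1.exists_skip_short hk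
      obtain ⟨x'', g'', h6, h7, h8, h9, -⟩ := h1.skip hl
      exact ⟨x'', l, g'', h6, h7.trans h2, h8.trans h3, h9.trans h4, by omega⟩
    · exact ⟨x', k', g', h1.mono_table (le_shortShortcuts B _), h2, h3, h4, by omega⟩

/-- Every round saves an arc as long as there are two, and there are at least `n^α ≥ k` rounds. The
condition `0 ≤ M x x` settles paths without arcs. -/
lemma gain_le_of_short {α β cRounds cFunnel cLong cSample cLevel : ℝ} (hRounds : 1 ≤ cRounds)
    {B : ℝ} (hB : 0 < B) {M : Table n} (hM : ∀ x, 0 ≤ M x x) {v : ℕ → Fin n} {k : ℕ}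
    {C : ℕ → ℝ} (h : IsMonotonePath B M v k C) (hk : (k : ℝ) ≤ (n : ℝ) ^ α) (M' : Table n)
    (hM' : M' ∈ (updateShortcuts
      ⟨α, β, cRounds, cFunnel, cLong, cSample, cLevel⟩ B M).support) :
    gainAt M v C k ≤ M' (v 0) (v k) := by
  obtain ⟨g, hg, hgain⟩ := Profile.of_isMonotonePath hB h
  refine hgain.trans ?_
  unfold updateShortcuts at hM'
  set r := ⌈cRounds * (n : ℝ) ^ α⌉₊ with hr
  have hkr : k ≤ r := by
    have : (k : ℝ) ≤ r := calc
      (k : ℝ) ≤ (n : ℝ) ^ α := hk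
      _ ≤ cRounds * (n : ℝ) ^ α := le_mul_of_one_le_left (by positivity) hRounds
      _ ≤ r := Nat.le_ceil _
    exact_mod_cast this
  have h1 := (le_of_mem_support_rounds r hM').1
  obtain ⟨x, k', g', h2, h3, h4, h5, h6⟩ := exists_profile_iterate hg r
  rw [← h3, ← h4, ← h5]
  refine le_trans ?_ (h1 _ _)
  obtain rfl | rfl : k' = 0 ∨ k' = 1 := by omega
  · rw [h2.zero]
    exact (hM _).trans (le_iterate_shortShortcuts B M r _ _)
  · have := h2.arc 0 (by omega)
    rwa [h2.zero, sub_zero, zero_add] at this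

/-! ### Funnels and the deterministic part of Compute-Funnels -/

/-- The sum of the gains of the arcs from `a` to `b` of a path. -/
def arcSum (m : ℕ → ℝ) (a b : ℕ) : ℝ := ∑ t ∈ Finset.Ico a b, m t

lemma arcSum_add (m : ℕ → ℝ) {a b c : ℕ} (hab : a ≤ b) (hbc : b ≤ c) :
    arcSum m a b + arcSum m b c = arcSum m a c := Finset.sum_Ico_consecutive m hab hbc

lemma arcSum_succ (m : ℕ → ℝ) (a : ℕ) : arcSum m a (a + 1) = m a := by simp [arcSum]

lemma arcSum_eq_add (m : ℕ → ℝ) {a b : ℕ} (hab : a < b) :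
    arcSum m a b = m a + arcSum m (a + 1) b := by
  rw [← arcSum_add m (Nat.le_succ a) hab, arcSum_succ]

/-- The arcs `a, …, b - 1` of the path form a contracting funnel. -/
def ConRun (m : ℕ → ℝ) (a b : ℕ) : Prop :=
  ∀ p, a < p → p < b → m (p - 1) * m p < 0 ∧ |m p| ≤ |m (p - 1)|

/-- The arcs `a, …, b - 1` of the path form an expanding funnel. -/
def ExpRun (m : ℕ → ℝ) (a b : ℕ) : Prop :=
  ∀ p, a < p → p < b → m (p - 1) * m p < 0 ∧ |m (p - 1)| ≤ |m p|

lemma ConRun.mono {m : ℕ → ℝ} {a b a' b' : ℕ} (h : ConRun m a b) (ha : a ≤ a') (hb : b' ≤ b) :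
    ConRun m a' b' := fun p h1 h2 => h p (ha.trans_lt h1) (h2.trans_le hb)

lemma contracts_coe {a b : ℝ} (h : a * b < 0) (h' : |b| ≤ |a|) :
    Contracts (a : Gain) (b : Gain) := by
  rcases mul_neg_iff.1 h with ⟨h1, h2⟩ | ⟨h1, h2⟩
  · rw [abs_of_neg h2, abs_of_pos h1] at h'
    left
    norm_cast
    exact ⟨h1.le, by linarith, h2.le⟩
  · rw [abs_of_pos h2, abs_of_neg h1] at h'
    right
    norm_cast
    exact ⟨h1, h2.le, by linarith⟩

/-- An alternating sum with weakly decreasing absolute values lies between `0` and its first term.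
This supplies the range conditions of Concatenate. -/
lemma ConRun.arcSum_mem {m : ℕ → ℝ} {a b : ℕ} (hab : a < b) (h : ConRun m a b) :
    (0 ≤ m a → 0 ≤ arcSum m a b ∧ arcSum m a b ≤ m a) ∧
      (m a ≤ 0 → m a ≤ arcSum m a b ∧ arcSum m a b ≤ 0) := by
  obtain ⟨d, rfl⟩ : ∃ d, b = a + 1 + d := ⟨b - (a + 1), by omega⟩
  induction d generalizing a with
  | zero =>
    rw [add_zero, arcSum_succ]
    exact ⟨fun h => ⟨h, le_rfl⟩, fun h => ⟨le_rfl, h⟩⟩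
  | succ d ih =>
    have h1 := h (a + 1) (by omega) (by omega)
    rw [Nat.add_sub_cancel] at h1
    have h2 := ih (a := a + 1) (by omega) (by
      rw [show a + 1 + 1 + d = a + 1 + (d + 1) by ring]; exact h.mono (by omega) le_rfl)
    rw [show a + 1 + 1 + d = a + 1 + (d + 1) by ring] at h2
    rw [arcSum_eq_add m hab]
    rcases mul_neg_iff.1 h1.1 with ⟨h3, h4⟩ | ⟨h3, h4⟩
    · have h5 := h1.2
      rw [abs_of_neg h4, abs_of_pos h3] at h5
      have := h2.2 h4.le
      exact ⟨fun _ => ⟨by linarith, by linarith⟩, fun _ => by linarith⟩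
    · have h5 := h1.2
      rw [abs_of_pos h4, abs_of_neg h3] at h5
      have := h2.1 h4.le
      exact ⟨fun _ => by linarith, fun _ => ⟨by linarith, by linarith⟩⟩

/-- `D` has the gains of all contracting funnels on the path. -/
def FirstComplete (x : ℕ → Fin n) (m : ℕ → ℝ) (k : ℕ) (D : DS n) : Prop :=
  ∀ a b, a < b → b ≤ k → ConRun m a b →
    (arcSum m a b : Gain) ≤ D.first (x a) (x (a + 1)) (x b)

lemma FirstComplete.mono {x : ℕ → Fin n} {m : ℕ → ℝ} {k : ℕ} {D D' : DS n}
    (h : FirstComplete x m k D) (hD : D.Le D') : FirstComplete x m k D' :=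
  fun a b hab hb hr => (h a b hab hb hr).trans (hD.1 _ _ _)

lemma iterate_spec {M : Table n} {F : DS n → DS n}
    (hF : ∀ D, D.Bounded M → (F D).Bounded M ∧ D.Le (F D)) (j : ℕ) {D : DS n}
    (hD : D.Bounded M) : (F^[j] D).Bounded M ∧ D.Le (F^[j] D) := by
  induction j with
  | zero => exact ⟨hD, DS.Le.refl D⟩
  | succ j ih =>
    rw [Function.iterate_succ_apply']
    exact ⟨(hF _ ih.1).1, ih.2.trans (hF _ ih.1).2⟩

section Path

variable {M : Table n} {x : ℕ → Fin n} {m : ℕ → ℝ} {k : ℕ}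

/-- Every call prepends one arc to the runs that are already known. -/
lemma breadthSearch_extend (hm : ∀ p < k, M (x p) (x (p + 1)) = (m p : Gain)) {D : DS n}
    (hD : D.Bounded M) {c b : ℕ} (hcb : c < b) (hb : b ≤ k)
    (h : (arcSum m c b : Gain) ≤ D.first (x c) (x (c + 1)) (x b)) (j : ℕ) {a : ℕ}
    (hac : a ≤ c) (hj : c - a ≤ j) (hr : ConRun m a b) :
    (arcSum m a b : Gain) ≤ ((breadthSearch M)^[j] D).first (x a) (x (a + 1)) (x b) := by
  induction j generalizing a with
  | zero =>
    obtain rfl : a = c := by omega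
    exact h
  | succ j ih =>
    have hB := iterate_spec (F := breadthSearch M) (fun D => breadthSearch_spec) j hD
    rw [Function.iterate_succ_apply']
    rcases Nat.lt_or_ge j (c - a) with h1 | h1
    · have h2 := ih (a := a + 1) (by omega) (by omega) (hr.mono (by omega) le_rfl)
      have h3 := hr (a + 1) (by omega) (by omega)
      rw [Nat.add_sub_cancel] at h3
      have h4 := le_breadthSearch_first (x := x a) (y := x (a + 1)) (a := x (a + 1 + 1))
        (z := x b) hB.1 (by
          rw [hm a (by omega), hm (a + 1) (by omega)]
          exact contracts_coe h3.1 h3.2)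
      refine le_trans ?_ h4
      rw [arcSum_eq_add m (by omega), hm a (by omega), WithBot.coe_add]
      exact add_le_add le_rfl h2
    · exact (ih hac h1 hr).trans ((breadthSearch_spec hB.1).2.1 _ _ _)

lemma breadthSearch_init (hm : ∀ p < k, M (x p) (x (p + 1)) = (m p : Gain)) {a b : ℕ}
    (hab : a < b) (hb : b ≤ k) (q : ℕ) (hq : b - a ≤ q + 1) (hr : ConRun m a b) :
    (arcSum m a b : Gain) ≤
      ((breadthSearch M)^[q] (DS.init M)).first (x a) (x (a + 1)) (x b) := by
  obtain ⟨c, rfl⟩ : ∃ c, b = c + 1 := ⟨b - 1, by omega⟩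
  refine breadthSearch_extend hm (DS.bounded_init M) (Nat.lt_succ_self c) hb ?_ q (by omega)
    (by omega) hr
  rw [arcSum_succ, ← hm c (by omega)]
  simp [DS.init]

/-- The run is cut at descending arcs with sampled tails. One call joins two blocks of pieces, so
the number of pieces that an entry spans doubles. -/
lemma concatenate_double (hm : ∀ p < k, M (x p) (x (p + 1)) = (m p : Gain)) {D : DS n}
    (hD : D.Bounded M) {S : Finset (Fin n)} {h : ℕ} {f : ℕ → ℕ}
    (hf : ∀ i < h, f i < f (i + 1)) (hk : f h ≤ k) (hS : ∀ i ≤ h, x (f i) ∈ S)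
    (hneg : ∀ i < h, m (f i) < 0) (hr : ConRun m (f 0) (f h))
    (hbase : ∀ i < h, (arcSum m (f i) (f (i + 1)) : Gain) ≤
      D.first (x (f i)) (x (f i + 1)) (x (f (i + 1)))) (l : ℕ) :
    ∀ i j, i < j → j ≤ h → j - i ≤ 2 ^ l → (arcSum m (f i) (f j) : Gain) ≤
      ((concatenate M S S S)^[l] D).first (x (f i)) (x (f i + 1)) (x (f j)) := by
  have hlt : ∀ i j, i < j → j ≤ h → f i < f j := by
    intro i j hij
    induction j, hij using Nat.le_induction with
    | base => intro hj; exact hf i hj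
    | succ j hij ih => intro hj; exact (ih (by omega)).trans (hf j hj)
  have hle : ∀ i j, i ≤ j → j ≤ h → f i ≤ f j := fun i j hij hj => by
    rcases hij.lt_or_eq with h | rfl
    · exact (hlt i j h hj).le
    · exact le_rfl
  induction l with
  | zero =>
    intro i j hij hj hl
    obtain rfl : j = i + 1 := by omega
    exact hbase i hj
  | succ l ih =>
    intro i j hij hj hl
    have hB := iterate_spec (F := concatenate M S S S) (fun D => concatenate_spec S S S) l hD
    rw [Function.iterate_succ_apply']
    rcases Nat.lt_or_ge (2 ^ l) (j - i) with h1 | h1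
    · have hpos : 0 < 2 ^ l := by positivity
      obtain ⟨t, ht⟩ : ∃ t, t = i + 2 ^ l := ⟨_, rfl⟩
      rw [pow_succ] at hl
      have hit := hlt i t (by omega) (by omega)
      have htj := hlt t j (by omega) (by omega)
      have hjk := hle j h hj le_rfl
      have h2 := ih i t (by omega) (by omega) (by omega)
      have h3 := ih t j (by omega) (by omega) (by omega)
      have hr' : ConRun m (f i) (f j) := hr.mono (hle 0 i (by omega) (by omega)) hjk
      -- The run is taken up to and including the arc `f t`, whose gain occurs in the range
      -- condition.
      have h4 := ((hr'.mono le_rfl htj).arcSum_mem (by omega)).2 (hneg i (by omega)).le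
      rw [← arcSum_add m hit.le htj.le, WithBot.coe_add]
      have h5 := hneg t (by omega)
      have h6 := hneg i (by omega)
      refine le_trans (add_le_add le_rfl h3) (le_concatenate_first (a := x (f t + 1)) hB.1 (hS i (by omega))
        (hS t (by omega)) (hS j hj) ?_ h2 ?_ ?_)
      · rw [hm _ (by omega)]; exact_mod_cast h6
      · rw [hm _ (by omega), hm _ (by omega)]
        rw [← arcSum_add m hit.le (Nat.le_succ _), arcSum_succ] at h4
        exact_mod_cast h4.1
      · rw [hm _ (by omega)]; exact_mod_cast h5.le
    · exact (ih i j hij hj h1).trans ((concatenate_spec S S S hB.1).2.1 _ _ _)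

end Path

/-- The data structure computed by Compute-Funnels with the sample `S`. -/
def funnels (M : Table n) (q : ℕ) (S : Finset (Fin n)) : DS n :=
  (breadthSearch M)^[q] (concatenate M S S Finset.univ
    ((concatenate M S S S)^[Nat.clog 2 n] ((breadthSearch M)^[q] (DS.init M))))

lemma iterate_swap {F G : DS n → DS n} (h : ∀ D, (F D).swap = G D.swap) (j : ℕ) (D : DS n) :
    (F^[j] D).swap = G^[j] D.swap := by
  induction j generalizing D with
  | zero => rfl
  | succ j ih => rw [Function.iterate_succ_apply, Function.iterate_succ_apply, ih, h]

lemma funnels_swap (M : Table n) (q : ℕ) (S : Finset (Fin n)) :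
    (funnels M q S).swap = funnels M.rev q S := by
  unfold funnels
  rw [iterate_swap (breadthSearch_swap M), concatenate_swap, iterate_swap (concatenate_swap M S S S),
    iterate_swap (breadthSearch_swap M), DS.swap_init]

lemma funnels_bounded (M : Table n) (q : ℕ) (S : Finset (Fin n)) : (funnels M q S).Bounded M :=
  (iterate_spec (fun _ => breadthSearch_spec) q (concatenate_spec S S Finset.univ
    (iterate_spec (fun _ => concatenate_spec S S S) _
      (iterate_spec (fun _ => breadthSearch_spec) q (DS.bounded_init M)).1).1).1).1

/-- Every contracting funnel with `2 * H` arcs has a sampled start of a descending arc. -/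
def HitsFunnels (x : ℕ → Fin n) (m : ℕ → ℝ) (k H : ℕ) (S : Finset (Fin n)) : Prop :=
  ∀ a, a + 2 * H ≤ k → ConRun m a (a + 2 * H) → ∃ p, a ≤ p ∧ p < a + 2 * H ∧ m p < 0 ∧ x p ∈ S

/-- The search for the next sampled arc restarts one arc after the current one, so consecutive hits
are at most `2 * H` apart. -/
lemma exists_hit_sequence {x : ℕ → Fin n} {m : ℕ → ℝ} {k H : ℕ} {S : Finset (Fin n)}
    (hS : HitsFunnels x m k H S) {b : ℕ} (hb : b ≤ k) (c : ℕ) (hcb : c < b)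
    (hr : ConRun m c b) (hc : m c < 0 ∧ x c ∈ S) :
    ∃ (h : ℕ) (f : ℕ → ℕ), f 0 = c ∧ (∀ i ≤ h, f i < b ∧ m (f i) < 0 ∧ x (f i) ∈ S) ∧
      (∀ i < h, f i < f (i + 1) ∧ f (i + 1) ≤ f i + 2 * H) ∧ b ≤ f h + 2 * H ∧ h ≤ b - c := by
  obtain ⟨d, hd⟩ : ∃ d, d = b - c := ⟨_, rfl⟩
  induction d using Nat.strong_induction_on generalizing c with
  | _ d ih =>
  by_cases hend : b ≤ c + 2 * H
  · exact ⟨0, fun _ => c, rfl, fun i _ => ⟨hcb, hc⟩, by simp, hend, by omega⟩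
  · obtain ⟨p, h1, h2, h3⟩ := hS (c + 1) (by omega) (hr.mono (by omega) (by omega))
    obtain ⟨h, f, h4, h5, h6, h7, h8⟩ := ih (b - p) (by omega) p (by omega)
      (hr.mono (by omega) le_rfl) h3 rfl
    refine ⟨h + 1, fun i => Nat.casesOn i c f, rfl, fun i hi => ?_, fun i hi => ?_, h7, by omega⟩
    · cases i with
      | zero => exact ⟨hcb, hc⟩
      | succ i => exact h5 i (by omega)
    · cases i with
      | zero =>
        change c < f 0 ∧ f 0 ≤ c + 2 * H
        rw [h4]
        omega
      | succ i => exact h6 i (by omega)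

/-- A run of at most `q + 1` arcs is found by the first breadth searches. In a longer one, the
pieces between sampled descending arcs are joined by doubling, the last piece is appended by the
single Concatenate into all vertices, and the arcs before the first sampled one are prepended by the
final breadth searches. -/
lemma funnels_firstComplete {M : Table n} {x : ℕ → Fin n} {m : ℕ → ℝ} {k : ℕ}
    (hm : ∀ p < k, M (x p) (x (p + 1)) = (m p : Gain)) (hkn : k ≤ n) {q H : ℕ} (hq : 2 * H ≤ q)
    {S : Finset (Fin n)} (hS : HitsFunnels x m k H S) : FirstComplete x m k (funnels M q S) := by
  intro a b hab hb hr
  unfold funnels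
  set D₁ := (breadthSearch M)^[q] (DS.init M) with hD₁
  have hB₁ : D₁.Bounded M := (iterate_spec (fun _ => breadthSearch_spec) q (DS.bounded_init M)).1
  set D₂ := (concatenate M S S S)^[Nat.clog 2 n] D₁ with hD₂
  have hB₂ := iterate_spec (fun _ => concatenate_spec S S S) (Nat.clog 2 n) hB₁
  rw [← hD₂] at hB₂
  have hB₃ := concatenate_spec S S Finset.univ hB₂.1
  set D₃ := concatenate M S S Finset.univ D₂ with hD₃
  have hB₄ := iterate_spec (fun _ => breadthSearch_spec) q hB₃.1
  have hinit : ∀ a b, a < b → b ≤ k → b - a ≤ q + 1 → ConRun m a b →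
      (arcSum m a b : Gain) ≤ D₁.first (x a) (x (a + 1)) (x b) :=
    fun a b hab hb hl hr => breadthSearch_init hm hab hb q hl hr
  by_cases hlen : b - a ≤ q + 1
  · exact (hinit a b hab hb hlen hr).trans ((hB₂.2.trans (hB₃.2.trans hB₄.2)).1 _ _ _)
  obtain ⟨c, h1, h2, h3⟩ := hS a (by omega) (hr.mono le_rfl (by omega))
  have hrc : ConRun m c b := hr.mono h1 le_rfl
  obtain ⟨h, f, hf0, hf1, hf2, hf3, hf4⟩ := exists_hit_sequence hS hb c (by omega) hrc h3
  have hmono : ∀ i ≤ h, c ≤ f i := by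
    intro i
    induction i with
    | zero => intro _; rw [hf0]
    | succ i ih => intro hi; exact (ih (by omega)).trans (hf2 i hi).1.le
  have hlast := hinit (f h) b (hf1 h le_rfl).1 hb (by omega) (hrc.mono (hmono h le_rfl) le_rfl)
  have hc : (arcSum m c b : Gain) ≤ D₃.first (x c) (x (c + 1)) (x b) := by
    rcases Nat.eq_zero_or_pos h with rfl | hpos
    · rw [hf0] at hlast
      exact hlast.trans ((hB₂.2.trans hB₃.2).1 _ _ _)
    · have hch : c < f h := by
        have := hmono (h - 1) (by omega)
        have := (hf2 (h - 1) (by omega)).1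
        rw [show h - 1 + 1 = h by omega] at this
        omega
      have hfb := (hf1 h le_rfl).1
      have h4 : (arcSum m c (f h) : Gain) ≤ D₂.first (x c) (x (c + 1)) (x (f h)) := by
        have := concatenate_double hm hB₁ (S := S) (h := h) (f := f) (fun i hi => (hf2 i hi).1)
          (by omega) (fun i hi => (hf1 i hi).2.2) (fun i hi => (hf1 i hi.le).2.1)
          (by rw [hf0]; exact hrc.mono le_rfl hfb.le) (fun i hi => by
            have h5 := (hf1 (i + 1) hi).1
            have h6 := hf2 i hi
            exact hinit _ _ h6.1 (by omega) (by omega)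
              (hrc.mono (hmono i hi.le) h5.le)) (Nat.clog 2 n) 0 h hpos le_rfl (by
            have := Nat.le_pow_clog (b := 2) (by omega) n
            omega)
        rwa [hf0] at this
      have h5 := ((hrc.mono le_rfl hfb).arcSum_mem (by omega)).2 h3.1.le
      rw [← arcSum_add m hch.le hfb.le, WithBot.coe_add]
      refine le_trans (add_le_add le_rfl (hlast.trans (hB₂.2.1 _ _ _)))
        (le_concatenate_first (a := x (f h + 1)) hB₂.1 h3.2 (hf1 h le_rfl).2.2 (Finset.mem_univ _) ?_ h4 ?_ ?_)
      · rw [hm _ (by omega)]; exact_mod_cast h3.1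
      · rw [hm _ (by omega), hm _ (by omega)]
        rw [← arcSum_add m hch.le (Nat.le_succ _), arcSum_succ] at h5
        exact_mod_cast h5.1
      · rw [hm _ (by omega)]; exact_mod_cast (hf1 h le_rfl).2.1.le
  exact breadthSearch_extend hm hB₃.1 (by omega) hb hc q h1 (by omega) hr

/-- The reversed path. -/
def revPath (x : ℕ → Fin n) (k i : ℕ) : Fin n := x (k - i)

/-- The gains of the arcs of the reversed path. -/
def revGain (m : ℕ → ℝ) (k i : ℕ) : ℝ := m (k - 1 - i)

lemma revGain_eq {M : Table n} {x : ℕ → Fin n} {m : ℕ → ℝ} {k : ℕ}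
    (hm : ∀ p < k, M (x p) (x (p + 1)) = (m p : Gain)) :
    ∀ p < k, M.rev (revPath x k p) (revPath x k (p + 1)) = (revGain m k p : Gain) := by
  intro p hp
  have := hm (k - 1 - p) (by omega)
  rw [show k - 1 - p + 1 = k - p by omega] at this
  unfold revPath revGain Table.rev
  rwa [show k - (p + 1) = k - 1 - p by omega]

lemma arcSum_revGain (m : ℕ → ℝ) {k a b : ℕ} (hab : a ≤ b) (hb : b ≤ k) :
    arcSum (revGain m k) (k - b) (k - a) = arcSum m a b := by
  unfold arcSum revGain
  refine Finset.sum_nbij' (fun i => k - 1 - i) (fun i => k - 1 - i) ?_ ?_ ?_ ?_ ?_ <;>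
    simp only [Finset.mem_Ico] <;> intros <;> first | omega | rfl | trivial

lemma ExpRun.rev {m : ℕ → ℝ} {k a b : ℕ} (h : ExpRun m a b) (hb : b ≤ k) :
    ConRun (revGain m k) (k - b) (k - a) := by
  intro p h1 h2
  have h3 := h (k - p) (by omega) (by omega)
  unfold revGain
  rw [show k - 1 - (p - 1) = k - p by omega, show k - 1 - p = k - p - 1 by omega, mul_comm]
  exact h3

lemma FirstComplete.last {x : ℕ → Fin n} {m : ℕ → ℝ} {k : ℕ} {D : DS n}
    (h : FirstComplete (revPath x k) (revGain m k) k D.swap) {a b : ℕ} (hab : a < b)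
    (hb : b ≤ k) (hr : ExpRun m a b) :
    (arcSum m a b : Gain) ≤ D.last (x a) (x (b - 1)) (x b) := by
  have := h (k - b) (k - a) (by omega) (by omega) (hr.rev hb)
  rw [arcSum_revGain m hab.le hb] at this
  unfold revPath at this
  rw [show k - (k - a) = a by omega, show k - (k - b) = b by omega,
    show k - (k - b + 1) = b - 1 by omega] at this
  exact this

/-! ### Descents, their exits, and the events in between -/

/-- The arc gains `m` and the profile `g` of a path with `k` arcs, where only the arcs in `Ev` have
a short shortcut in their neighbourhood. The notion is invariant under reversal. -/
structure Walk (m g : ℕ → ℝ) (k : ℕ) (Ev : Finset ℕ) : Prop where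
  le : ∀ p < k, g (p + 1) - g p ≤ m p
  ends : (∀ i ≤ k, g 0 ≤ g i ∧ g i ≤ g k) ∨ ∀ i ≤ k, g i ≤ g 0 ∧ g k ≤ g i
  down : ∀ p, 0 < p → p + 1 < k → m p < 0 → g (p + 1) - g p = m p
  inner : ∀ p, 0 < p → p + 1 < k → ∀ i ≤ k, ∀ j ≤ k, g i < g p → g i < g (p + 1) → g p < g j →
    g (p + 1) < g j → g (p + 1) - g p = m p
  alt : ∀ p, 0 < p → p + 1 < k → p ∉ Ev →
    Alternates m p ∧ Alternates (fun i => g (i + 1) - g i) p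

/-- The profile of the reversed path. -/
def revProfile (g : ℕ → ℝ) (k i : ℕ) : ℝ := -g (k - i)

/-- The arcs of the reversed path that correspond to the arcs in `Ev`. -/
def revArcs (Ev : Finset ℕ) (k : ℕ) : Finset ℕ := Ev.image fun p => k - 1 - p

lemma Alternates.rev {f f' : ℕ → ℝ} {k p : ℕ} (hp₀ : 0 < p) (hp : p + 1 < k)
    (h : Alternates f (k - 1 - p)) (hf : ∀ i < k, f' i = f (k - 1 - i)) : Alternates f' p := by
  unfold Alternates at h ⊢
  rw [hf _ (by omega), hf _ (by omega), hf _ (by omega)]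
  rw [show k - 1 - p - 1 = k - 1 - (p + 1) by omega, show k - 1 - p + 1 = k - 1 - (p - 1) by omega]
    at h
  rw [mul_comm (f (k - 1 - (p - 1))), mul_comm (f (k - 1 - p)) (f (k - 1 - (p + 1)))]
  exact ⟨h.2.1, h.1, h.2.2.symm⟩

lemma revProfile_diff (g : ℕ → ℝ) {k p : ℕ} (hp : p < k) :
    revProfile g k (p + 1) - revProfile g k p = g (k - 1 - p + 1) - g (k - 1 - p) := by
  unfold revProfile
  rw [show k - (p + 1) = k - 1 - p by omega, show k - 1 - p + 1 = k - p by omega]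
  ring

/-- The profile is negated and turned around, so the increments survive. Reversal does not preserve
`Tight`, but it preserves `inner`, which places both ends of an arc strictly between two values of
the profile. -/
lemma Walk.rev {m g : ℕ → ℝ} {k : ℕ} {Ev : Finset ℕ} (h : Walk m g k Ev) :
    Walk (revGain m k) (revProfile g k) k (revArcs Ev k) where
  le p hp := by
    rw [revProfile_diff g hp]
    exact h.le _ (by omega)
  ends := by
    unfold revProfile
    rw [Nat.sub_self, Nat.sub_zero]
    refine h.ends.imp (fun h i _ => ?_) (fun h i _ => ?_) <;>
    · have := h (k - i) (by omega)
      exact ⟨by linarith, by linarith⟩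
  down p hp₀ hp hm := by
    rw [revProfile_diff g (by omega)]
    exact h.down _ (by omega) (by omega) hm
  inner p hp₀ hp i hi j hj h1 h2 h3 h4 := by
    rw [revProfile_diff g (by omega)]
    unfold revProfile at h1 h2 h3 h4
    rw [show k - p = k - 1 - p + 1 by omega] at h1 h3
    rw [show k - (p + 1) = k - 1 - p by omega] at h2 h4
    exact h.inner _ (by omega) (by omega) (k - j) (by omega) (k - i) (by omega) (by linarith)
      (by linarith) (by linarith) (by linarith)
  alt p hp₀ hp hev := by
    have hev' : k - 1 - p ∉ Ev := fun h0 =>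
      hev (Finset.mem_image.2 ⟨_, h0, by omega⟩)
    have := h.alt _ (by omega) (by omega) hev'
    exact ⟨this.1.rev hp₀ hp fun i _ => rfl, this.2.rev hp₀ hp fun i hi => revProfile_diff g hi⟩

/-- In a tight profile an inner arc with a drop ends at the maximum of the profile. A descending arc
cannot do so, and neither can an arc whose head lies below another vertex. -/
lemma Walk.of_profile {B : ℝ} {M : Table n} {x : ℕ → Fin n} {k : ℕ} {m g : ℕ → ℝ}
    (h : Profile B M x k g) (hm : ∀ p < k, M (x p) (x (p + 1)) = (m p : Gain)) (ht : Tight m g k)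
    {Ev : Finset ℕ} (hEv : ∀ p, 0 < p → p + 1 < k → Event (shortShortcuts B M) x g p → p ∈ Ev) :
    Walk m g k Ev where
  le p hp := by
    have := h.arc p hp
    rw [hm p hp] at this
    exact_mod_cast this
  ends := by simpa only [h.zero] using h.mono
  down p hp₀ hp hneg := by
    rcases ht p hp with h1 | h1
    · exact h1
    · have := h.arc p (by omega)
      rw [hm p (by omega)] at this
      have : g (p + 1) - g p ≤ m p := by exact_mod_cast this
      linarith [h1 p (by omega)]
  inner p hp₀ hp i hi j hj h1 h2 h3 h4 := by
    rcases ht p hp with h5 | h5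
    · exact h5
    · linarith [h5 j hj]
  alt p hp₀ hp hev := h.alternates hm hp₀ hp fun h0 => hev (hEv p hp₀ hp h0)

/-- The first index `≥ e + 2` at which the profile leaves the range of the arc `e`. -/
def exit (g : ℕ → ℝ) (k e : ℕ) : ℕ :=
  sInf {j | e + 2 ≤ j ∧ (k ≤ j ∨ ¬ (g (e + 1) < g j ∧ g j < g e))}

/-- The descending arcs outside `Ev` that are followed by a smaller arc. -/
def descents (m : ℕ → ℝ) (k : ℕ) (Ev : Finset ℕ) : Finset ℕ :=
  open Classical in (Finset.range k).filter fun e =>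
    0 < e ∧ e + 1 < k ∧ e ∉ Ev ∧ m e < 0 ∧ |m (e + 1)| < |m e|

/-- The arcs in `Ev` strictly between the arc `e` and its exit arc. -/
def eventsInside (g : ℕ → ℝ) (k : ℕ) (Ev : Finset ℕ) (e : ℕ) : Finset ℕ :=
  Ev.filter fun p => e < p ∧ p + 1 < exit g k e

lemma exit_mem (g : ℕ → ℝ) (k e : ℕ) :
    e + 2 ≤ exit g k e ∧ (k ≤ exit g k e ∨
      ¬ (g (e + 1) < g (exit g k e) ∧ g (exit g k e) < g e)) :=
  Nat.sInf_mem (s := {j | e + 2 ≤ j ∧ (k ≤ j ∨ ¬ (g (e + 1) < g j ∧ g j < g e))})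
    ⟨max k (e + 2), le_max_right _ _, Or.inl (le_max_left _ _)⟩

lemma exit_le {g : ℕ → ℝ} {k e j : ℕ} (hj : e + 2 ≤ j)
    (h : k ≤ j ∨ ¬ (g (e + 1) < g j ∧ g j < g e)) : exit g k e ≤ j :=
  Nat.sInf_le ⟨hj, h⟩

lemma inside_of_lt_exit {g : ℕ → ℝ} {k e j : ℕ} (hj : e + 2 ≤ j) (h : j < exit g k e) :
    j < k ∧ g (e + 1) < g j ∧ g j < g e := by
  have := mt (exit_le (g := g) (k := k) hj) (not_le.2 h)
  push Not at this
  exact this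

lemma mem_descents {m : ℕ → ℝ} {k : ℕ} {Ev : Finset ℕ} {e : ℕ} :
    e ∈ descents m k Ev ↔ 0 < e ∧ e + 1 < k ∧ e ∉ Ev ∧ m e < 0 ∧ |m (e + 1)| < |m e| := by
  classical
  simp only [descents, Finset.mem_filter, Finset.mem_range]
  exact ⟨fun h => h.2, fun h => ⟨by omega, h⟩⟩

section Walk

variable {m g : ℕ → ℝ} {k : ℕ} {Ev : Finset ℕ} {e : ℕ}

/-- The range is left at `k` at the latest, because `g k` is an extreme value of the profile. -/
lemma Walk.exit_spec (h : Walk m g k Ev) (he : e + 1 < k) :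
    exit g k e ≤ k ∧ (g (exit g k e) ≤ g (e + 1) ∨ g e ≤ g (exit g k e)) := by
  have h1 : exit g k e ≤ k := exit_le he (Or.inl le_rfl)
  refine ⟨h1, ?_⟩
  rcases (exit_mem g k e).2 with h2 | h2
  · rw [le_antisymm h1 h2]
    rcases h.ends with h3 | h3
    · exact Or.inr (h3 e (by omega)).2
    · exact Or.inl (h3 (e + 1) (by omega)).2
  · by_contra! h3
    exact h2 h3

/-- Gains of the arcs that follow a descent. -/
lemma Walk.descent_facts (h : Walk m g k Ev) (he : e ∈ descents m k Ev) :
    m e < 0 ∧ g (e + 1) - g e = m e ∧ 0 < m (e + 1) ∧ m (e + 1) < -m e ∧ m e * m (e + 1) < 0 := by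
  obtain ⟨h1, h2, h3, h4, h5⟩ := mem_descents.1 he
  have h6 := (h.alt e h1 h2 h3).1.2.1
  have h7 : 0 < m (e + 1) := by
    rcases mul_neg_iff.1 h6 with h | h
    · linarith
    · exact h.2
  rw [abs_of_neg h4, abs_of_pos h7] at h5
  exact ⟨h4, h.down e h1 h2 h4, h7, h5, h6⟩

lemma Walk.succ_notMem_descents (h : Walk m g k Ev) (he : e ∈ descents m k Ev) :
    e + 1 ∉ descents m k Ev := fun h' => by
  have h1 := (h.descent_facts he).2.2.1
  have h2 := (mem_descents.1 h').2.2.2.1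
  linarith

/-- Strictly inside the range nothing is dropped, so `m p` is an increment within an interval of
length `-m e`. The arc after `e` starts on the boundary and is handled by the definition of a
descent. -/
lemma Walk.inner_le (h : Walk m g k Ev) (he : e ∈ descents m k Ev) {p : ℕ} (hep : e < p)
    (hp : p + 1 < exit g k e) : m p ≤ -m e := by
  have h1 := h.descent_facts he
  have h2 := (mem_descents.1 he).2.1
  rcases eq_or_lt_of_le (Nat.succ_le_of_lt hep) with rfl | hep
  · exact h1.2.2.2.1.le
  · have h3 := inside_of_lt_exit (g := g) (k := k) (e := e) (j := p) (by omega) (by omega)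
    have h4 := inside_of_lt_exit (g := g) (k := k) (e := e) (j := p + 1) (by omega) hp
    rw [← h.inner p (by omega) h4.1 (e + 1) (by omega) e (by omega) h3.2.1 h4.2.1 h3.2.2 h4.2.2]
    linarith

lemma Walk.arcSum_ge (h : Walk m g k Ev) {a b : ℕ} (hab : a ≤ b) (hb : b ≤ k) :
    g b - g a ≤ arcSum m a b := by
  induction b, hab using Nat.le_induction with
  | base => simp [arcSum]
  | succ b hab ih =>
    rw [← arcSum_add m hab (Nat.le_succ b), arcSum_succ]
    linarith [ih (by omega), h.le b (by omega)]

/-- An arc that is not larger than its predecessor and not a weak local minimum has a smaller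
successor. -/
lemma Walk.conRun_of_noEvent (h : Walk m g k Ev) (he : e ∈ descents m k Ev) {b : ℕ} (hb : b < k)
    (hev : ∀ p ∈ Ev, e < p → b ≤ p) : ConRun m e b := by
  obtain ⟨h1, h2, h3, h4, h5⟩ := mem_descents.1 he
  intro p hp hpb
  induction p, hp using Nat.le_induction with
  | base => exact ⟨(h.descent_facts he).2.2.2.2, by simpa using h5.le⟩
  | succ p hp ih =>
    have h6 := ih (by omega)
    have h7 := (h.alt p (by omega) (by omega) fun h0 => by
      have := hev p h0 hp; omega).1
    rw [Nat.add_sub_cancel]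
    refine ⟨h7.2.1, ?_⟩
    rcases h7.2.2 with h8 | h8
    · exact absurd h6.2 (not_le.2 h8)
    · exact h8.le

/-- Between two events the arcs form an expanding funnel followed by a contracting one. -/
lemma Walk.exists_peak (h : Walk m g k Ev) {a b : ℕ} (hab : a < b) (hb : b < k)
    (hev : ∀ p ∈ Ev, a < p → b ≤ p) :
    ∃ c, a ≤ c ∧ c < b ∧ ExpRun m a (c + 1) ∧ ConRun m c b := by
  induction b, hab using Nat.le_induction with
  | base => exact ⟨a, le_rfl, Nat.lt_succ_self a, fun p h1 h2 => by omega, fun p h1 h2 => by omega⟩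
  | succ b hab ih =>
    obtain ⟨c, h1, h2, h3, h4⟩ := ih (by omega) fun p hp hap => by
      have := hev p hp hap; omega
    have hneg : m (b - 1) * m b < 0 := (h.alt b (by omega) (by omega) fun h0 => by
      have := hev b h0 hab; omega).1.1
    by_cases hle : |m b| ≤ |m (b - 1)|
    · refine ⟨c, h1, by omega, h3, fun p h5 h6 => ?_⟩
      rcases Nat.lt_succ_iff_lt_or_eq.1 h6 with h6 | rfl
      · exact h4 p h5 h6
      · exact ⟨hneg, hle⟩
    · rcases Nat.lt_or_ge c (b - 1) with h5 | h5
      -- The absolute values would fall weakly and then rise, which makes `b - 1` a weak local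
      -- minimum.
      · exfalso
        have h6 := (h.alt (b - 1) (by omega) (by omega) fun h0 => by
          have := hev (b - 1) h0 (by omega); omega).1.2.2
        rw [show b - 1 + 1 = b by omega] at h6
        have h7 := (h4 (b - 1) h5 (by omega)).2
        rcases h6 with h6 | h6
        · linarith
        · exact hle h6.le
      · obtain rfl : c = b - 1 := by omega
        refine ⟨b, by omega, by omega, fun p h6 h7 => ?_, fun p h6 h7 => by omega⟩
        rcases Nat.lt_succ_iff_lt_or_eq.1 h7 with h8 | rfl
        · exact h3 p h6 (by omega)
        · exact ⟨hneg, (not_le.1 hle).le⟩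

/-- The arcs between a descent and its exit cannot all be free of events. -/
lemma Walk.eventsInside_nonempty (h : Walk m g k Ev) (he : e ∈ descents m k Ev) :
    (eventsInside g k Ev e).Nonempty := by
  by_contra hno
  rw [Finset.not_nonempty_iff_eq_empty] at hno
  have hev : ∀ p, e < p → p + 1 < exit g k e → p ∉ Ev := fun p h1 h2 h3 => by
    have : p ∈ eventsInside g k Ev e := Finset.mem_filter.2 ⟨h3, h1, h2⟩
    simp [hno] at this
  obtain ⟨h1, h2, h3, h4, h5⟩ := mem_descents.1 he
  have hf := h.descent_facts he
  have hx := h.exit_spec h2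
  have hx2 := (exit_mem g k e).1
  have hδ := (h.alt e h1 h2 h3).2.2.1
  simp only at hδ
  rw [hf.2.1] at hδ
  have hpos : 0 < g (e + 1 + 1) - g (e + 1) := by
    rcases mul_neg_iff.1 hδ with h | h
    · linarith
    · exact h.2
  have hlt : g (e + 1 + 1) - g (e + 1) < -m e := (h.le (e + 1) (by omega)).trans_lt hf.2.2.2.1
  -- Without events the increments after `e` alternate and shrink strictly, including the one into
  -- the exit. Then the exit lies between two values of the range and is no exit.
  have key : ∀ p, e + 1 ≤ p → p < exit g k e →
      (g p - g (p - 1)) * (g (p + 1) - g p) < 0 ∧ |g (p + 1) - g p| < |g p - g (p - 1)| := by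
    intro p hp
    induction p, hp using Nat.le_induction with
    | base =>
      intro _
      rw [Nat.add_sub_cancel, hf.2.1]
      refine ⟨hδ, ?_⟩
      rw [abs_of_pos hpos, abs_of_neg hf.1]
      exact hlt
    | succ p hp ih =>
      intro hpx
      have h6 := ih (by omega)
      have h7 := (h.alt p (by omega) (by omega) (hev p hp hpx)).2
      unfold Alternates at h7
      dsimp only at h7
      rw [show p - 1 + 1 = p by omega] at h7
      rw [Nat.add_sub_cancel]
      refine ⟨h7.2.1, ?_⟩
      rcases h7.2.2 with h8 | h8
      · linarith
      · exact h8
  obtain ⟨t, ht⟩ : ∃ t, exit g k e = t + 2 := ⟨exit g k e - 2, by omega⟩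
  have hbd : ∀ j, e + 1 ≤ j → j < exit g k e → g (e + 1) ≤ g j ∧ g j < g e := by
    intro j hj hjx
    rcases eq_or_lt_of_le hj with rfl | hj
    · exact ⟨le_rfl, by linarith [hf.1, hf.2.1]⟩
    · have := inside_of_lt_exit hj hjx
      exact ⟨this.2.1.le, this.2.2⟩
  have h6 := key (t + 1) (by omega) (by omega)
  rw [Nat.add_sub_cancel] at h6
  have h7 := hbd (t + 1) (by omega) (by omega)
  have h8 : g (e + 1) ≤ g t ∧ g t ≤ g e := by
    rcases Nat.lt_or_ge e t with h9 | h9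
    · have := hbd t h9 (by omega)
      exact ⟨this.1, this.2.le⟩
    · obtain rfl : t = e := by omega
      exact ⟨by linarith [hf.1, hf.2.1], le_rfl⟩
  have hx' := hx.2
  rw [ht] at hx'
  rw [show t + 1 + 1 = t + 2 by ring] at h6
  rcases mul_neg_iff.1 h6.1 with ⟨h9, h10⟩ | ⟨h9, h10⟩
  · rw [abs_of_neg h10, abs_of_pos h9] at h6
    rcases hx' with hx' | hx' <;> linarith
  · rw [abs_of_pos h10, abs_of_neg h9] at h6
    rcases hx' with hx' | hx' <;> linarith

/-! ### Propagating the entry of a sampled descent to its exit -/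

/-- One round of the main loop of Long-Shortcuts. -/
def levelStep (M : Table n) (T : Finset (Fin n)) (D : DS n) : DS n :=
  concatenate M T Finset.univ Finset.univ (concatOpposite M T Finset.univ Finset.univ D)

lemma levelStep_spec {M : Table n} (T : Finset (Fin n)) {D : DS n} (hD : D.Bounded M) :
    (levelStep M T D).Bounded M ∧ D.Le (levelStep M T D) := by
  have h1 := concatOpposite_spec T Finset.univ Finset.univ hD
  have h2 := concatenate_spec T Finset.univ Finset.univ h1.1
  exact ⟨h2.1, h1.2.trans h2.2⟩

lemma levelStep_swap (M : Table n) (T : Finset (Fin n)) (D : DS n) :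
    (levelStep M T D).swap = levelStep M.rev T D.swap := by
  unfold levelStep
  rw [concatenate_swap, concatOpposite_swap]

/-- The data structure has the gains of all funnels on the path. -/
structure Complete (M : Table n) (x : ℕ → Fin n) (m : ℕ → ℝ) (k : ℕ) (D : DS n) : Prop where
  bounded : D.Bounded M
  first : FirstComplete x m k D
  last : FirstComplete (revPath x k) (revGain m k) k D.swap

lemma Complete.mono {M : Table n} {x : ℕ → Fin n} {D D' : DS n} (h : Complete M x m k D)
    (hb : D'.Bounded M) (hD : D.Le D') : Complete M x m k D' :=
  ⟨hb, h.first.mono hD, h.last.mono hD.swap⟩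

/-- The stretch from `a` to `b` is an expanding funnel followed by a contracting one.
Concatenate-Opposite appends the first, which is stored in `last`, and Concatenate the second, which
is stored in `first`. The range conditions hold because the profile stays in the range of `e`. -/
lemma levelStep_extend {M : Table n} {x : ℕ → Fin n}
    (hm : ∀ p < k, M (x p) (x (p + 1)) = (m p : Gain)) (h : Walk m g k Ev)
    (he : e ∈ descents m k Ev) {T : Finset (Fin n)} (hT : x e ∈ T) {D : DS n}
    (hD : Complete M x m k D) {a b : ℕ} (hea : e < a) (hab : a < b) (hb : b < exit g k e)
    (hev : ∀ p ∈ Ev, a < p → b ≤ p)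
    (hfirst : ((g a - g e : ℝ) : Gain) ≤ D.first (x e) (x (e + 1)) (x a)) :
    ((g b - g e : ℝ) : Gain) ≤ (levelStep M T D).first (x e) (x (e + 1)) (x b) := by
  have hx := h.exit_spec (mem_descents.1 he).2.1
  have hf := h.descent_facts he
  have hek := (mem_descents.1 he).2.1
  obtain ⟨c, hac, hcb, hexp, hcon⟩ := h.exists_peak hab (by omega) hev
  have hge : ∀ j, e < j → j ≤ b → g (e + 1) ≤ g j ∧ g j < g e := by
    intro j hj hjx
    rcases eq_or_lt_of_le (Nat.succ_le_of_lt hj) with rfl | hj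
    · exact ⟨le_rfl, by linarith [hf.1, hf.2.1]⟩
    · have := inside_of_lt_exit (g := g) (k := k) hj (by omega)
      exact ⟨this.2.1.le, this.2.2⟩
  have hneg : M (x e) (x (e + 1)) < 0 := by rw [hm e (by omega)]; exact_mod_cast hf.1
  -- The peak arc joins the expanding part if it ascends and the contracting part otherwise. Then
  -- the former ends with an ascending arc and the latter starts with a descending one, as the two
  -- procedures require.
  have hsplit : ∃ c', a ≤ c' ∧ c' ≤ b ∧ ExpRun m a c' ∧ ConRun m c' b ∧
      (a < c' → 0 ≤ m (c' - 1)) ∧ (c' < b → m c' ≤ 0) := by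
    by_cases hc : 0 ≤ m c
    · refine ⟨c + 1, by omega, by omega, hexp, hcon.mono (Nat.le_succ c) le_rfl,
        fun _ => by simpa using hc, fun h0 => ?_⟩
      have := (hcon (c + 1) (by omega) h0).1
      rw [Nat.add_sub_cancel] at this
      rcases mul_neg_iff.1 this with h | h <;> linarith
    · refine ⟨c, hac, hcb.le, fun p h1 h2 => hexp p h1 (by omega), hcon, fun h0 => ?_,
        fun _ => (not_le.1 hc).le⟩
      have := (hexp c h0 (by omega)).1
      rcases mul_neg_iff.1 this with h | h <;> linarith
  obtain ⟨c', h1, h2, h3, h4, h5, h6⟩ := hsplit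
  have hD₁ := concatOpposite_spec T Finset.univ Finset.univ hD.bounded
  have hmid : ((g c' - g e : ℝ) : Gain) ≤
      (concatOpposite M T Finset.univ Finset.univ D).first (x e) (x (e + 1)) (x c') := by
    rcases eq_or_lt_of_le h1 with rfl | h1
    · exact hfirst.trans (hD₁.2.1 _ _ _)
    · have h7 := hD.last.last h1 (by omega) h3
      have h8 := hm (c' - 1) (by omega)
      rw [show c' - 1 + 1 = c' by omega] at h8
      have h9 : g c' - g a ≤ arcSum m a c' := h.arcSum_ge h1.le (by omega)
      -- The lower end of the range has to be respected before the final ascending arc, at `c' - 1`.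
      have h10 : g (c' - 1) - g a ≤ arcSum m a (c' - 1) := h.arcSum_ge (by omega) (by omega)
      have h11 : arcSum m a c' = arcSum m a (c' - 1) + m (c' - 1) := by
        rw [← arcSum_add m (show a ≤ c' - 1 by omega) (show c' - 1 ≤ c' by omega)]
        congr 1
        have := arcSum_succ m (c' - 1)
        rwa [show c' - 1 + 1 = c' by omega] at this
      have h12 := hge (c' - 1) (by omega) (by omega)
      have h13 := hge c' (by omega) (by omega)
      rw [show g c' - g e = (g a - g e) + (g c' - g a) by ring, WithBot.coe_add]
      refine le_concatOpposite_first (a := x (c' - 1)) hD.bounded hT (Finset.mem_univ _)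
        (Finset.mem_univ _) hneg hfirst ((WithBot.coe_le_coe.2 h9).trans h7) ?_ ?_ ?_ ?_
      · rw [h8]; exact_mod_cast h5 h1
      · rw [h8, hm e (by omega)]
        have := h.inner_le he (p := c' - 1) (by omega) (by omega)
        norm_cast
        linarith
      · refine le_trans ?_ (add_le_add le_rfl h7)
        rw [h8, hm e (by omega)]
        norm_cast
        linarith [hf.2.1]
      · norm_cast
        linarith
  rcases eq_or_lt_of_le h2 with rfl | h2
  · exact hmid.trans ((concatenate_spec T Finset.univ Finset.univ hD₁.1).2.1 _ _ _)
  · have h7 := (hD.mono hD₁.1 hD₁.2).first c' b h2 (by omega) h4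
    have h8 := h.arcSum_ge h2.le (by omega : b ≤ k)
    have h9 := h.le c' (by omega)
    have h10 := hge (c' + 1) (by omega) (by omega)
    rw [show g b - g e = (g c' - g e) + (g b - g c') by ring, WithBot.coe_add]
    refine le_trans (add_le_add le_rfl ((WithBot.coe_le_coe.2 h8).trans h7))
      (le_concatenate_first (a := x (c' + 1)) hD₁.1 hT (Finset.mem_univ _) (Finset.mem_univ _)
        hneg hmid ?_ ?_)
    · rw [hm e (by omega), hm c' (by omega)]
      norm_cast
      linarith [hf.2.1]
    · rw [hm c' (by omega)]; exact_mod_cast h6 h2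

/-- Up to the first event the path is a contracting funnel, which `D` already knows. Every further
round passes one event. -/
lemma levelStep_iterate {M : Table n} {x : ℕ → Fin n}
    (hm : ∀ p < k, M (x p) (x (p + 1)) = (m p : Gain)) (h : Walk m g k Ev)
    (he : e ∈ descents m k Ev) {T : Finset (Fin n)} (hT : x e ∈ T) {D : DS n}
    (hD : Complete M x m k D) (j : ℕ) :
    ∀ b, e < b → b < exit g k e → (Ev.filter fun p => e < p ∧ p < b).card ≤ j →
      ((g b - g e : ℝ) : Gain) ≤ ((levelStep M T)^[j] D).first (x e) (x (e + 1)) (x b) := by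
  have hx := h.exit_spec (mem_descents.1 he).2.1
  induction j with
  | zero =>
    intro b heb hb hc
    have hev : ∀ p ∈ Ev, e < p → b ≤ p := fun p hp hep => by
      by_contra! h0
      have : p ∈ Ev.filter fun p => e < p ∧ p < b := Finset.mem_filter.2 ⟨hp, hep, h0⟩
      have := Finset.card_pos.2 ⟨p, this⟩
      omega
    have h1 := hD.first e b heb (by omega) (h.conRun_of_noEvent he (by omega) hev)
    exact (WithBot.coe_le_coe.2 (h.arcSum_ge heb.le (by omega))).trans h1
  | succ j ih =>
    intro b heb hb hc
    have hspec := iterate_spec (F := levelStep M T) (fun _ => levelStep_spec T) j hD.bounded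
    rw [Function.iterate_succ_apply']
    rcases Nat.lt_or_ge j (Ev.filter fun p => e < p ∧ p < b).card with hc' | hc'
    · have hne : (Ev.filter fun p => e < p ∧ p < b).Nonempty := Finset.card_pos.1 (by omega)
      obtain ⟨a, ha, hmax⟩ : ∃ a ∈ Ev.filter (fun p => e < p ∧ p < b),
          ∀ p ∈ Ev.filter (fun p => e < p ∧ p < b), p ≤ a :=
        ⟨_, Finset.max'_mem _ hne, fun p hp => Finset.le_max' _ p hp⟩
      obtain ⟨ha₁, ha₂, ha₃⟩ := Finset.mem_filter.1 ha
      refine levelStep_extend hm h he hT (hD.mono hspec.1 hspec.2) ha₂ ha₃ hb (fun p hp hap => ?_)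
        (ih a ha₂ (by omega) ?_)
      · by_contra! h0
        have := hmax p (Finset.mem_filter.2 ⟨hp, by omega, h0⟩)
        omega
      · have hss : (Ev.filter fun p => e < p ∧ p < a) ⊂ Ev.filter fun p => e < p ∧ p < b := by
          refine (Finset.ssubset_iff_of_subset fun p hp => ?_).2 ⟨a, ha, by simp⟩
          simp only [Finset.mem_filter] at hp ⊢
          exact ⟨hp.1, hp.2.1, by omega⟩
        have := Finset.card_lt_card hss
        omega
    · exact (ih b heb hb hc').trans ((levelStep_spec T hspec.1).2.1 _ _ _)

lemma levelStep_exit {M : Table n} {x : ℕ → Fin n}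
    (hm : ∀ p < k, M (x p) (x (p + 1)) = (m p : Gain)) (h : Walk m g k Ev)
    (he : e ∈ descents m k Ev) {T : Finset (Fin n)} (hT : x e ∈ T) {D : DS n}
    (hD : Complete M x m k D) {j : ℕ} (hj : (eventsInside g k Ev e).card ≤ j) :
    ((g (exit g k e - 1) - g e : ℝ) : Gain) ≤
      ((levelStep M T)^[j] D).first (x e) (x (e + 1)) (x (exit g k e - 1)) := by
  have h1 := (exit_mem g k e).1
  refine levelStep_iterate hm h he hT hD j _ (by omega) (by omega) (le_trans ?_ hj)
  refine Finset.card_le_card fun p hp => ?_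
  simp only [eventsInside, Finset.mem_filter] at hp ⊢
  exact ⟨hp.1, hp.2.1, by omega⟩

/-- A descent whose tail is sampled yields a shortcut to its exit. -/
lemma Walk.covers_exit {B : ℝ} {M : Table n} {x : ℕ → Fin n}
    (hm : ∀ p < k, M (x p) (x (p + 1)) = (m p : Gain)) (h : Walk m g k Ev)
    (hdraw : ∀ i j, i ≤ j → j ≤ k → g i - B ≤ g j)
    (he : e ∈ descents m k Ev) {T : Finset (Fin n)} (hT : x e ∈ T) {D : DS n}
    (hD : ((g (exit g k e - 1) - g e : ℝ) : Gain) ≤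
      D.first (x e) (x (e + 1)) (x (exit g k e - 1))) :
    ∃ a, e ≤ a ∧ a ≤ e + 1 ∧
      Covers (arcBoundedToMonotone B M T D).short x g a (exit g k e) := by
  have h1 := (exit_mem g k e).1
  have hek := (mem_descents.1 he).2.1
  have hf := h.descent_facts he
  obtain ⟨h2, h3⟩ := h.exit_spec hek
  have h4 := hm (exit g k e - 1) (by omega)
  have h5 := h.le (exit g k e - 1) (by omega)
  rw [show exit g k e - 1 + 1 = exit g k e by omega] at h4 h5
  have hsum : ((g (exit g k e) - g e : ℝ) : Gain) ≤
      D.first (x e) (x (e + 1)) (x (exit g k e - 1)) +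
        M (x (exit g k e - 1)) (x (exit g k e)) := by
    rw [h4]
    refine le_trans ?_ (add_le_add hD le_rfl)
    norm_cast
    linarith
  unfold Covers
  -- If the range is left at the bottom, the shortcut contains the arc `e` and descends. If it is
  -- left at the top, the shortcut starts at the head of `e` and ascends.
  rcases h3 with h3 | h3
  · refine ⟨e, le_rfl, Nat.le_succ e, arcBounded_first_descending hT ?_ ?_ ?_ hsum⟩
    · norm_cast
      linarith [hdraw e (exit g k e) (by omega) h2]
    · rw [hm e (by omega)]; exact_mod_cast hf.1.le
    · rw [hm e (by omega)]; norm_cast; linarith [hf.2.1]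
  · refine ⟨e + 1, Nat.le_succ e, le_rfl, ?_⟩
    have := arcBounded_first_ascending (B := B) hT (hm e (by omega)) hf.1.le
      (by norm_cast; linarith) hsum
    rw [← WithBot.coe_add] at this
    rwa [show g (exit g k e) - g (e + 1) = -m e + (g (exit g k e) - g e) by linarith [hf.2.1]]

/-- The mirror image of `Walk.covers_exit`: here `h`, `e` and `D.swap` refer to the reversed
path. -/
lemma Walk.covers_exit_rev {B : ℝ} {M : Table n} {x : ℕ → Fin n}
    (hm : ∀ p < k, M (x p) (x (p + 1)) = (m p : Gain))
    (h : Walk (revGain m k) (revProfile g k) k Ev)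
    (hdraw : ∀ i j, i ≤ j → j ≤ k → g i - B ≤ g j)
    (he : e ∈ descents (revGain m k) k Ev) {T : Finset (Fin n)} (hT : revPath x k e ∈ T)
    {D : DS n}
    (hD : ((revProfile g k (exit (revProfile g k) k e - 1) - revProfile g k e : ℝ) : Gain) ≤
      D.swap.first (revPath x k e) (revPath x k (e + 1))
        (revPath x k (exit (revProfile g k) k e - 1))) :
    ∃ a, e ≤ a ∧ a ≤ e + 1 ∧ Covers (arcBoundedToMonotone B M T D).short x g
      (k - exit (revProfile g k) k e) (k - a) := by
  have h1 := (exit_mem (revProfile g k) k e).1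
  have hek := (mem_descents.1 he).2.1
  have hf := h.descent_facts he
  obtain ⟨h2, h3⟩ := h.exit_spec hek
  set t := exit (revProfile g k) k e with ht
  have hm' := hm (k - 1 - e) (by omega)
  have h4 := hm (k - t) (by omega)
  have h5 := h.le (t - 1) (by omega)
  unfold revPath at hT hD
  unfold revGain at hf
  rw [show t - 1 + 1 = t by omega] at h5
  unfold revProfile at hf h3 h5 hD
  unfold revGain at h5
  rw [show k - (e + 1) = k - 1 - e by omega] at hf h3 hD
  rw [show k - (t - 1) = k - t + 1 by omega] at h5 hD
  rw [show k - 1 - (t - 1) = k - t by omega] at h5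
  rw [show k - 1 - e + 1 = k - e by omega] at hm'
  change _ ≤ D.last (x (k - t + 1)) (x (k - 1 - e)) (x (k - e)) at hD
  have hsum : ((g (k - e) - g (k - t) : ℝ) : Gain) ≤
      M (x (k - t)) (x (k - t + 1)) + D.last (x (k - t + 1)) (x (k - 1 - e)) (x (k - e)) := by
    rw [h4]
    refine le_trans ?_ (add_le_add le_rfl hD)
    norm_cast
    linarith
  unfold Covers
  rcases h3 with h3 | h3
  · refine ⟨e, le_rfl, Nat.le_succ e, arcBounded_last_descending hT ?_ ?_ ?_ hsum⟩
    · norm_cast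
      linarith [hdraw (k - t) (k - e) (by omega) (by omega)]
    · rw [hm']; exact_mod_cast hf.1.le
    · rw [hm']; norm_cast; linarith [hf.2.1]
  · refine ⟨e + 1, Nat.le_succ e, le_rfl, ?_⟩
    have := arcBounded_last_ascending (B := B) hT hm' hf.1.le
      (by norm_cast; linarith) hsum
    rw [← WithBot.coe_add] at this
    rw [show k - (e + 1) = k - 1 - e by omega]
    rwa [show g (k - 1 - e) - g (k - t) = g (k - e) - g (k - t) + -m (k - 1 - e) by
      linarith [hf.2.1]]

end Walk

/-! ### Levels of nested descents and the arcs they save -/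

/-- Take the `c` smallest elements. -/
lemma exists_initial_subset (C : Finset ℕ) {c : ℕ} (hc : c ≤ C.card) :
    ∃ H ⊆ C, H.card = c ∧ ∀ e ∈ H, C.card ≤ c + (C.filter (e < ·)).card := by
  induction c with
  | zero => exact ⟨∅, by simp, rfl, by simp⟩
  | succ c ih =>
    obtain ⟨H, h1, h2, h3⟩ := ih (by omega)
    have hcard : (C \ H).card = C.card - c := by rw [Finset.card_sdiff_of_subset h1, h2]
    have hne : (C \ H).Nonempty := Finset.card_pos.1 (by omega)
    obtain ⟨ha, haH⟩ := Finset.mem_sdiff.1 (Finset.min'_mem _ hne)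
    refine ⟨insert ((C \ H).min' hne) H, Finset.insert_subset ha h1, ?_, fun e he => ?_⟩
    · rw [Finset.card_insert_of_notMem haH, h2]
    · rcases Finset.mem_insert.1 he with rfl | he
      · have : (C \ H).erase ((C \ H).min' hne) ⊆ C.filter ((C \ H).min' hne < ·) := by
          intro e he
          obtain ⟨he₁, he₂⟩ := Finset.mem_erase.1 he
          exact Finset.mem_filter.2 ⟨(Finset.mem_sdiff.1 he₂).1,
            lt_of_le_of_ne (Finset.min'_le _ _ he₂) he₁.symm⟩
        have := Finset.card_le_card this
        rw [Finset.card_erase_of_mem (Finset.min'_mem _ hne)] at this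
        omega
      · have := h3 e he
        omega

/-- Pick the smallest element, discard everything before the end of its interval, and repeat. -/
lemma exists_greedy_cover (t : ℕ → ℕ) (E : Finset ℕ) (ht : ∀ e ∈ E, e < t e) :
    ∃ R ⊆ E, (∀ r ∈ R, ∀ r' ∈ R, r < r' → t r ≤ r') ∧ ∀ e ∈ E, ∃ r ∈ R, r ≤ e ∧ e < t r := by
  induction E using Finset.strongInduction with
  | H E ih =>
  rcases E.eq_empty_or_nonempty with rfl | hne
  · exact ⟨∅, by simp, by simp, by simp⟩
  set r := E.min' hne with hr
  have hrE : r ∈ E := Finset.min'_mem _ hne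
  have hss : E.filter (t r ≤ ·) ⊂ E :=
    (Finset.ssubset_iff_of_subset (Finset.filter_subset _ _)).2
      ⟨r, hrE, by simpa using fun _ => ht r hrE⟩
  obtain ⟨R, h1, h2, h3⟩ := ih _ hss fun e he => ht e (Finset.mem_filter.1 he).1
  have hR : ∀ q ∈ R, t r ≤ q := fun q hq => (Finset.mem_filter.1 (h1 hq)).2
  refine ⟨insert r R, Finset.insert_subset hrE (h1.trans (Finset.filter_subset _ _)),
    fun a ha b hb hab => ?_, fun e he => ?_⟩
  · have := ht r hrE
    rcases Finset.mem_insert.1 ha with rfl | ha <;> rcases Finset.mem_insert.1 hb with rfl | hb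
    · omega
    · exact hR b hb
    · have := hR a ha
      omega
    · exact h2 a ha b hb hab
  · by_cases h4 : t r ≤ e
    · obtain ⟨q, hq, h5⟩ := h3 e (Finset.mem_filter.2 ⟨he, h4⟩)
      exact ⟨q, Finset.mem_insert_of_mem hq, h5⟩
    · exact ⟨r, Finset.mem_insert_self _ _, Finset.min'_le _ _ he, not_le.1 h4⟩

/-- The descents with at least `w` and less than `2 * w` events before the exit. -/
def level (m g : ℕ → ℝ) (k : ℕ) (Ev : Finset ℕ) (w : ℕ) : Finset ℕ :=
  (descents m k Ev).filter fun e =>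
    w ≤ (eventsInside g k Ev e).card ∧ (eventsInside g k Ev e).card < 2 * w

section Walk

variable {m g : ℕ → ℝ} {k : ℕ} {Ev : Finset ℕ}

/-- The range of `e'` lies inside that of `e`, so the profile has left it when it leaves the range
of `e`. -/
lemma Walk.exit_le_exit (h : Walk m g k Ev) {e e' : ℕ} (he : e ∈ descents m k Ev)
    (he' : e' ∈ descents m k Ev) (hlt : e < e') (hx : e' + 1 < exit g k e) :
    exit g k e' ≤ exit g k e := by
  have h1 : e + 2 ≤ e' := by
    by_contra h0
    obtain rfl : e' = e + 1 := by omega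
    exact h.succ_notMem_descents he he'
  have h2 := inside_of_lt_exit (g := g) (k := k) (e := e) (j := e') h1 (by omega)
  have h3 := inside_of_lt_exit (g := g) (k := k) (e := e) (j := e' + 1) (by omega) hx
  have h4 := (h.exit_spec (mem_descents.1 he).2.1).2
  refine exit_le (by omega) (Or.inr fun h5 => ?_)
  rcases h4 with h4 | h4 <;> linarith

lemma Walk.eventsInside_subset (h : Walk m g k Ev) {e e' : ℕ} (he : e ∈ descents m k Ev)
    (he' : e' ∈ descents m k Ev) (hlt : e ≤ e') (hx : e' + 1 < exit g k e) :
    eventsInside g k Ev e' ⊆ eventsInside g k Ev e := by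
  rcases eq_or_lt_of_le hlt with rfl | hlt
  · exact subset_rfl
  have h1 := h.exit_le_exit he he' hlt hx
  intro p hp
  simp only [eventsInside, Finset.mem_filter] at hp ⊢
  exact ⟨hp.1, by omega, by omega⟩

lemma disjoint_eventsInside {e e' : ℕ} (hx : exit g k e ≤ e' + 1) :
    Disjoint (eventsInside g k Ev e) (eventsInside g k Ev e') := by
  refine Finset.disjoint_left.2 fun p hp hp' => ?_
  simp only [eventsInside, Finset.mem_filter] at hp hp'
  omega

/-- The descents of one level below a given one are nested. -/
lemma Walk.level_nested (h : Walk m g k Ev) {w r e e' : ℕ} (hr : r ∈ level m g k Ev w)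
    (he : e ∈ level m g k Ev w) (he' : e' ∈ level m g k Ev w) (hre : r ≤ e)
    (hlt : e < e') (hx : e' + 1 < exit g k r) : e' + 1 < exit g k e ∧
      exit g k e' ≤ exit g k e := by
  simp only [level, Finset.mem_filter] at hr he he'
  suffices h1 : e' + 1 < exit g k e from ⟨h1, h.exit_le_exit he.1 he'.1 hlt h1⟩
  by_contra! h1
  -- Two descents side by side would have disjoint sets of at least `w` events each, all of them
  -- among the fewer than `2 * w` events of `r`.
  have h2 := Finset.card_union_of_disjoint (disjoint_eventsInside (Ev := Ev) h1)
  have h3 := Finset.card_le_card (Finset.union_subset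
    (h.eventsInside_subset hr.1 he.1 hre (by omega))
    (h.eventsInside_subset hr.1 he'.1 (by omega) hx))
  omega

/-- Shortcuts to the exits of few descents in each of few small sets save most arcs of a level. -/
lemma Walk.exists_skip_level (h : Walk m g k Ev) (w c : ℕ) :
    ∃ (ρ : ℕ) (Q : Finset ℕ) (H : ℕ → Finset ℕ), Q.card ≤ ρ ∧ ρ * w ≤ Ev.card ∧
      (∀ r ∈ Q, (H r).card = c ∧ H r ⊆ level m g k Ev w) ∧
      ∀ A : ℕ → ℕ → Prop, (∀ p < k, A p (p + 1)) →
        (∀ r ∈ Q, ∃ e ∈ H r, ∃ a, e ≤ a ∧ a ≤ e + 1 ∧ A a (exit g k e)) →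
        ∃ l, Skip A k l ∧ l + (level m g k Ev w).card ≤ k + (c + 1) * ρ := by
  set E := level m g k Ev w with hE
  have hdesc : ∀ e ∈ E, e ∈ descents m k Ev := fun e he => (Finset.mem_filter.1 he).1
  have hx2 : ∀ e, e + 2 ≤ exit g k e := fun e => (exit_mem g k e).1
  -- The outermost descents of the level: their stretches up to the exit are disjoint, and each has
  -- at least `w` events of its own.
  obtain ⟨R, hRE, hdis, hcov⟩ := exists_greedy_cover (exit g k) E fun e _ => by
    have := hx2 e
    omega
  set ch : ℕ → Finset ℕ := fun r => E.filter fun e => r ≤ e ∧ e + 1 < exit g k r with hch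
  have hchE : ∀ r, ch r ⊆ E := fun r => Finset.filter_subset _ _
  have hH : ∀ r ∈ R.filter (fun r => c ≤ (ch r).card), ∃ H ⊆ ch r, H.card = c ∧
      ∀ e ∈ H, (ch r).card ≤ c + ((ch r).filter (e < ·)).card := fun r hr =>
    exists_initial_subset _ (Finset.mem_filter.1 hr).2
  choose! H hH₁ hH₂ hH₃ using hH
  refine ⟨R.card, R.filter fun r => c ≤ (ch r).card, H,
    Finset.card_le_card (Finset.filter_subset _ _), ?_,
    fun r hr => ⟨hH₂ r hr, (hH₁ r hr).trans (hchE r)⟩, fun A hA hhit => ?_⟩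
  · calc R.card * w ≤ ∑ r ∈ R, (eventsInside g k Ev r).card := by
          rw [← smul_eq_mul]
          exact Finset.card_nsmul_le_sum _ _ _ fun r hr => by
            have := hRE hr
            simp only [hE, level, Finset.mem_filter] at this
            exact this.2.1
      _ = (R.biUnion (eventsInside g k Ev)).card := by
          refine (Finset.card_biUnion fun a ha b hb hab => ?_).symm
          rcases lt_or_gt_of_ne hab with hlt | hlt
          · exact disjoint_eventsInside ((hdis a ha b hb hlt).trans (Nat.le_succ _))
          · exact (disjoint_eventsInside ((hdis b hb a ha hlt).trans (Nat.le_succ _))).symm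
      _ ≤ Ev.card := Finset.card_le_card <| Finset.biUnion_subset.2 fun r _ =>
          Finset.filter_subset _ _
  choose! e he a hea hae hcover using hhit
  have hmem : ∀ r ∈ R.filter (fun r => c ≤ (ch r).card), r ∈ R ∧ e r ∈ E ∧ r ≤ e r ∧
      e r + 1 < exit g k r ∧ exit g k (e r) ≤ exit g k r := by
    intro r hr
    have h1 := (Finset.mem_filter.1 hr).1
    have h2 := Finset.mem_filter.1 (hH₁ r hr (he r hr))
    refine ⟨h1, h2.1, h2.2.1, h2.2.2, ?_⟩
    rcases eq_or_lt_of_le h2.2.1 with h3 | h3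
    · rw [← h3]
    · exact h.exit_le_exit (hdesc r (hRE h1)) (hdesc _ h2.1) h3 h2.2.2
  obtain ⟨l, hl, hsum⟩ := exists_skip hA (R.filter fun r => c ≤ (ch r).card) a
    (fun r => exit g k (e r)) (fun r hr => by
      have h1 := hmem r hr
      have h2 := hae r hr
      have h3 := hx2 (e r)
      exact ⟨by omega, (h.exit_spec (mem_descents.1 (hdesc _ h1.2.1)).2.1).1, hcover r hr⟩)
    (fun r hr r' hr' hne => by
      have h1 := hmem r hr
      have h2 := hmem r' hr'
      have h3 := hea r hr
      have h4 := hea r' hr'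
      rcases lt_or_gt_of_ne hne with hlt | hlt
      · have := hdis r h1.1 r' h2.1 hlt
        omega
      · have := hdis r' h2.1 r h1.1 hlt
        omega)
  refine ⟨l, hl, ?_⟩
  have hsave : ∀ r ∈ R.filter (fun r => c ≤ (ch r).card),
      (ch r).card ≤ c + (exit g k (e r) - a r - 1) := by
    intro r hr
    have h1 := hmem r hr
    have h2 := hae r hr
    -- A shortcut to the exit of `e r` jumps over all later descents of the nest. Two descents are
    -- never adjacent, so starting at `e r + 1` loses none of them.
    have hss : (ch r).filter (e r < ·) ⊆ Finset.Ico (e r + 2) (exit g k (e r) - 1) := by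
      intro e' he'
      obtain ⟨h3, h4⟩ := Finset.mem_filter.1 he'
      have h5 := Finset.mem_filter.1 h3
      have h6 := h.level_nested (hRE h1.1) h1.2.1 h5.1 h1.2.2.1 h4 h5.2.2
      have h7 : e' ≠ e r + 1 := fun h0 =>
        h.succ_notMem_descents (hdesc _ h1.2.1) (h0 ▸ hdesc _ h5.1)
      have h8 := hx2 e'
      rw [Finset.mem_Ico]
      omega
    have h3 := Finset.card_le_card hss
    rw [Nat.card_Ico] at h3
    have h4 := hH₃ r hr (e r) (he r hr)
    omega
  -- Besides its nest, `r` covers at most the arc into its exit; this is the `1` in `c + 1`.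
  have hE' : E ⊆ R.biUnion fun r => insert (exit g k r - 1) (ch r) := by
    intro e' he'
    obtain ⟨r, hr, h1, h2⟩ := hcov e' he'
    refine Finset.mem_biUnion.2 ⟨r, hr, ?_⟩
    by_cases h3 : e' + 1 < exit g k r
    · exact Finset.mem_insert_of_mem (Finset.mem_filter.2 ⟨he', h1, h3⟩)
    · exact Finset.mem_insert.2 (Or.inl (by omega))
  have h1 : E.card ≤ ∑ r ∈ R, ((ch r).card + 1) :=
    (Finset.card_le_card hE').trans (Finset.card_biUnion_le.trans
      (Finset.sum_le_sum fun r _ => Finset.card_insert_le _ _))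
  have h2 : ∑ r ∈ R, ((ch r).card + 1) ≤ ∑ r ∈ R,
      ((if c ≤ (ch r).card then exit g k (e r) - a r - 1 else 0) + (c + 1)) := by
    refine Finset.sum_le_sum fun r hr => ?_
    split_ifs with h3
    · have := hsave r (Finset.mem_filter.2 ⟨hr, h3⟩)
      omega
    · omega
  have h2 := h1.trans h2
  rw [Finset.sum_add_distrib, ← Finset.sum_filter, Finset.sum_const, smul_eq_mul] at h2
  have h3 : R.card * (c + 1) = (c + 1) * R.card := mul_comm _ _
  omega

/-- Some level contains a fair share of all descents. -/
lemma Walk.exists_large_level (h : Walk m g k Ev) {L : ℕ} (hL : Ev.card < 2 ^ L) :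
    descents m k Ev = ∅ ∨
      ∃ j < L, (descents m k Ev).card ≤ L * (level m g k Ev (2 ^ j)).card := by
  rcases (descents m k Ev).eq_empty_or_nonempty with h0 | hne
  · exact Or.inl h0
  right
  have hsub : descents m k Ev ⊆ (Finset.range L).biUnion fun j => level m g k Ev (2 ^ j) := by
    intro e he
    have hpos := Finset.card_pos.2 (h.eventsInside_nonempty he)
    have hle : (eventsInside g k Ev e).card ≤ Ev.card :=
      Finset.card_le_card (Finset.filter_subset _ _)
    refine Finset.mem_biUnion.2 ⟨Nat.log 2 (eventsInside g k Ev e).card, ?_, ?_⟩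
    · rw [Finset.mem_range]
      exact Nat.log_lt_of_lt_pow hpos.ne' (by omega)
    · refine Finset.mem_filter.2 ⟨he, Nat.pow_log_le_self 2 hpos.ne', ?_⟩
      rw [← pow_succ']
      exact Nat.lt_pow_succ_log_self (by omega) _
  have hcard := (Finset.card_le_card hsub).trans Finset.card_biUnion_le
  have hLpos : 0 < L := by
    rcases Nat.eq_zero_or_pos L with rfl | h1
    · have := Finset.card_pos.2 hne
      simp at hcard
      simp [hcard] at this
    · exact h1
  by_contra! h1
  have h2 : ∑ j ∈ Finset.range L, L * (level m g k Ev (2 ^ j)).card <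
      ∑ j ∈ Finset.range L, (descents m k Ev).card :=
    Finset.sum_lt_sum_of_nonempty (by simpa using hLpos.ne') fun j hj =>
      h1 j (Finset.mem_range.1 hj)
  rw [← Finset.mul_sum, Finset.sum_const, smul_eq_mul, Finset.card_range] at h2
  exact absurd (Nat.lt_of_mul_lt_mul_left h2) (not_lt.2 hcard)

/-- A descending inner arc outside `Ev` is larger than one of its neighbours, hence a descent of the
path or of its reversal. As signs alternate outside `Ev`, about every second arc descends or lies in
`Ev`. -/
lemma Walk.card_descents (h : Walk m g k Ev) : k ≤ 3 + 2 * Ev.card +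
    2 * ((descents m k Ev).card + (descents (revGain m k) k (revArcs Ev k)).card) := by
  classical
  set Dn := (Finset.range k).filter fun p => 0 < p ∧ p + 1 < k ∧ p ∉ Ev ∧ m p < 0 with hDn
  have h1 : Dn.card ≤ (descents m k Ev).card +
      (descents (revGain m k) k (revArcs Ev k)).card := by
    have hss : Dn ⊆ descents m k Ev ∪
        (descents (revGain m k) k (revArcs Ev k)).image fun p => k - 1 - p := by
      intro p hp
      obtain ⟨-, h1, h2, h3, h4⟩ := Finset.mem_filter.1 hp
      rw [Finset.mem_union]
      rcases (h.alt p h1 h2 h3).1.2.2 with h5 | h5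
      · right
        refine Finset.mem_image.2 ⟨k - 1 - p, mem_descents.2 ⟨by omega, by omega, ?_, ?_, ?_⟩,
          by omega⟩
        · intro h6
          obtain ⟨q, hq, h7⟩ := Finset.mem_image.1 h6
          by_cases h8 : q ≤ k - 1
          · obtain rfl : q = p := by omega
            exact h3 hq
          · omega
        · unfold revGain
          rwa [show k - 1 - (k - 1 - p) = p by omega]
        · unfold revGain
          rwa [show k - 1 - (k - 1 - p) = p by omega,
            show k - 1 - (k - 1 - p + 1) = p - 1 by omega]
      · left
        exact mem_descents.2 ⟨h1, h2, h3, h4, h5⟩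
    exact (Finset.card_le_card hss).trans ((Finset.card_union_le _ _).trans
      (add_le_add le_rfl Finset.card_image_le))
  have h2 : Finset.Ico 1 (k - 1) ⊆
      Ev ∪ (Dn ∪ (insert (k - 1) (Dn ∪ Ev)).image fun p => p - 1) := by
    intro p hp
    rw [Finset.mem_Ico] at hp
    simp only [Finset.mem_union, Finset.mem_image, Finset.mem_insert]
    by_cases h3 : p ∈ Ev
    · exact Or.inl h3
    right
    by_cases h4 : m p < 0
    · exact Or.inl (Finset.mem_filter.2 ⟨Finset.mem_range.2 (by omega), by omega, by omega, h3, h4⟩)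
    right
    refine ⟨p + 1, ?_, by omega⟩
    by_cases h5 : p + 1 = k - 1
    · exact Or.inl h5
    right
    by_cases h6 : p + 1 ∈ Ev
    · exact Or.inr h6
    left
    have h7 := (h.alt p (by omega) (by omega) h3).1.2.1
    refine Finset.mem_filter.2 ⟨Finset.mem_range.2 (by omega), by omega, by omega, h6, ?_⟩
    rcases mul_neg_iff.1 h7 with h8 | h8
    · exact h8.2
    · exact absurd h8.1 h4
  have h3 := (Finset.card_le_card h2).trans ((Finset.card_union_le _ _).trans
    (add_le_add le_rfl ((Finset.card_union_le _ _).trans (add_le_add le_rfl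
      (Finset.card_image_le.trans ((Finset.card_insert_le _ _).trans
        (add_le_add (Finset.card_union_le _ _) le_rfl)))))))
  rw [Nat.card_Ico] at h3
  omega

end Walk

/-! ### Probabilities of bad events -/

section PMF

variable {α β : Type}

lemma toOuterMeasure_add_compl (p : PMF α) (s : Set α) :
    p.toOuterMeasure s + p.toOuterMeasure sᶜ = 1 := by
  rw [PMF.toOuterMeasure_apply, PMF.toOuterMeasure_apply, ← ENNReal.tsum_add, ← p.tsum_coe]
  congr 1
  funext a
  by_cases h : a ∈ s <;> simp [h]

lemma toOuterMeasure_le_one (p : PMF α) (s : Set α) : p.toOuterMeasure s ≤ 1 :=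
  (toOuterMeasure_add_compl p s) ▸ le_self_add

lemma toOuterMeasure_bind_le (p : PMF α) (f : α → PMF β) (s : Set β) {δ : ℝ≥0∞}
    (h : ∀ a, (f a).toOuterMeasure s ≤ δ) : (p.bind f).toOuterMeasure s ≤ δ := by
  rw [PMF.toOuterMeasure_bind_apply]
  calc ∑' a, p a * (f a).toOuterMeasure s ≤ ∑' a, p a * δ :=
        ENNReal.tsum_le_tsum fun a => by gcongr; exact h a
    _ = δ := by rw [ENNReal.tsum_mul_right, p.tsum_coe, one_mul]

lemma toOuterMeasure_bind_le_add (p : PMF α) (f : α → PMF β) (s : Set β) (bad : Set α) {δ : ℝ≥0∞}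
    (h : ∀ a, a ∉ bad → (f a).toOuterMeasure s ≤ δ) :
    (p.bind f).toOuterMeasure s ≤ p.toOuterMeasure bad + δ := by
  rw [PMF.toOuterMeasure_bind_apply, PMF.toOuterMeasure_apply]
  calc ∑' a, p a * (f a).toOuterMeasure s ≤ ∑' a, (bad.indicator p a + p a * δ) := by
        refine ENNReal.tsum_le_tsum fun a => ?_
        by_cases ha : a ∈ bad
        · rw [Set.indicator_of_mem ha]
          exact (mul_le_of_le_one_right' (toOuterMeasure_le_one _ _)).trans le_self_add
        · rw [Set.indicator_of_notMem ha, zero_add]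
          gcongr
          exact h a ha
    _ = _ := by rw [ENNReal.tsum_add, ENNReal.tsum_mul_right, p.tsum_coe, one_mul]

/-- Failure requires a bad first stage and a failing second stage. The bound on the latter holds for
every first outcome, so the two bounds multiply. -/
lemma toOuterMeasure_bind_le_mul (p : PMF α) (f : α → PMF β) (s : Set β) (bad : Set α) {δ : ℝ≥0∞}
    (h : ∀ a, a ∉ bad → (f a).toOuterMeasure s = 0) (h' : ∀ a, (f a).toOuterMeasure s ≤ δ) :
    (p.bind f).toOuterMeasure s ≤ p.toOuterMeasure bad * δ := by
  rw [PMF.toOuterMeasure_bind_apply, PMF.toOuterMeasure_apply, ← ENNReal.tsum_mul_right]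
  refine ENNReal.tsum_le_tsum fun a => ?_
  by_cases ha : a ∈ bad
  · rw [Set.indicator_of_mem ha]
    gcongr
    exact h' a
  · rw [h a ha, mul_zero]
    exact bot_le

lemma toOuterMeasure_eq_zero (p : PMF α) (s : Set α) (h : ∀ a ∈ p.support, a ∉ s) :
    p.toOuterMeasure s = 0 :=
  (PMF.toOuterMeasure_apply_eq_zero_iff p s).2 (Set.disjoint_left.2 h)

lemma toOuterMeasure_bind_coin (p : ℝ) (f : Bool → PMF β) (s : Set β) :
    ((coin p).bind f).toOuterMeasure s =
      ENNReal.ofReal (min 1 p) * (f true).toOuterMeasure s +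
        (1 - ENNReal.ofReal (min 1 p)) * (f false).toOuterMeasure s := by
  rw [PMF.toOuterMeasure_bind_apply, tsum_bool, add_comm]
  simp [coin]

end PMF

/-- The truncation is harmless: for `1 ≤ p` the left side is `0`, and for `p ≤ 0` the right side is
at least `1`. -/
lemma one_sub_coin_le (p : ℝ) :
    1 - ENNReal.ofReal (min 1 p) ≤ ENNReal.ofReal (Real.exp (-p)) := by
  rcases le_total p 0 with hp | hp
  · refine tsub_le_self.trans ?_
    rw [← ENNReal.ofReal_one]
    exact ENNReal.ofReal_le_ofReal (Real.one_le_exp (by linarith))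
  · rw [← ENNReal.ofReal_one, ← ENNReal.ofReal_sub _ (le_min zero_le_one hp)]
    refine ENNReal.ofReal_le_ofReal ?_
    rcases le_total 1 p with h1 | h1
    · rw [min_eq_left h1, sub_self]
      exact (Real.exp_pos _).le
    · rw [min_eq_right h1]
      linarith [Real.add_one_le_exp (-p)]

lemma sampleList_misses_le (p : ℝ) (A : Finset (Fin n)) (l : List (Fin n)) :
    (sampleList p l).toOuterMeasure {S | ∀ a ∈ A, a ∉ S} ≤
      ENNReal.ofReal (Real.exp (-p)) ^ (l.filter (· ∈ A)).length := by
  induction l with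
  | nil =>
    rw [List.filter_nil, List.length_nil, pow_zero]
    exact toOuterMeasure_le_one _ _
  | cons v l ih =>
    rw [sampleList, toOuterMeasure_bind_coin]
    simp only [if_true, Bool.false_eq_true, if_false, PMF.toOuterMeasure_map_apply]
    by_cases hv : v ∈ A
    · have h1 : (fun S : Finset (Fin n) => insert v S) ⁻¹' {S | ∀ a ∈ A, a ∉ S} = ∅ := by
        ext S
        simp only [Set.mem_preimage, Set.mem_ofPred_eq, Set.mem_empty_iff_false, iff_false]
        exact fun h => h v hv (Finset.mem_insert_self _ _)
      rw [h1, List.filter_cons_of_pos (by simpa using hv), List.length_cons, pow_succ', MeasureTheory.measure_empty,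
        mul_zero, zero_add]
      exact mul_le_mul' (one_sub_coin_le p) ih
    · have h1 : (fun S : Finset (Fin n) => insert v S) ⁻¹' {S | ∀ a ∈ A, a ∉ S} =
          {S | ∀ a ∈ A, a ∉ S} := by
        ext S
        simp only [Set.mem_preimage, Set.mem_ofPred_eq, Finset.mem_insert, not_or]
        exact ⟨fun h a ha => (h a ha).2, fun h a ha => ⟨fun h0 => hv (h0 ▸ ha), h a ha⟩⟩
      rw [h1, List.filter_cons_of_neg (by simpa using hv), Set.preimage_id', ← add_mul,
        add_tsub_cancel_of_le (by
          rw [← ENNReal.ofReal_one]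
          exact ENNReal.ofReal_le_ofReal (min_le_left _ _)), one_mul]
      exact ih

lemma sample_misses_le (p : ℝ) (A : Finset (Fin n)) :
    (sample n p).toOuterMeasure {S | ∀ a ∈ A, a ∉ S} ≤
      ENNReal.ofReal (Real.exp (-(p * A.card))) := by
  refine (sampleList_misses_le p A (verts n)).trans ?_
  have h1 : ((verts n).filter (· ∈ A)).length = A.card := by
    rw [verts, ← List.toFinset_card_of_nodup ((List.nodup_finRange n).filter _)]
    congr 1
    ext a
    simp
  rw [h1, ← ENNReal.ofReal_pow (Real.exp_pos _).le, ← Real.exp_nat_mul]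
  refine ENNReal.ofReal_le_ofReal (le_of_eq ?_)
  congr 1
  ring

lemma sample_misses_family_le {p : ℝ} (hp : 0 ≤ p) {ι : Type} (Q : Finset ι)
    (A : ι → Finset (Fin n)) {c : ℕ} (hc : ∀ i ∈ Q, c ≤ (A i).card) :
    (sample n p).toOuterMeasure {S | ∃ i ∈ Q, ∀ a ∈ A i, a ∉ S} ≤
      ENNReal.ofReal (Q.card * Real.exp (-(p * c))) := by
  have h1 : {S : Finset (Fin n) | ∃ i ∈ Q, ∀ a ∈ A i, a ∉ S} =
      ⋃ i ∈ Q, {S | ∀ a ∈ A i, a ∉ S} := by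
    ext S
    simp
  rw [h1]
  refine (MeasureTheory.measure_biUnion_finset_le Q _).trans ?_
  calc ∑ i ∈ Q, (sample n p).toOuterMeasure {S | ∀ a ∈ A i, a ∉ S}
      ≤ ∑ i ∈ Q, ENNReal.ofReal (Real.exp (-(p * c))) := by
        refine Finset.sum_le_sum fun i hi => (sample_misses_le p (A i)).trans ?_
        refine ENNReal.ofReal_le_ofReal (Real.exp_le_exp.2 ?_)
        have : (c : ℝ) ≤ (A i).card := by exact_mod_cast hc i hi
        nlinarith
    _ = _ := by
        rw [Finset.sum_const, nsmul_eq_mul, ENNReal.ofReal_mul (Nat.cast_nonneg _),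
          ENNReal.ofReal_natCast]

/-- Of two consecutive arcs of a funnel one descends, so `2 * H` arcs offer `H` distinct vertices to
hit. A union bound over at most `k` starting points follows. -/
lemma sample_not_hitsFunnels_le {p : ℝ} (hp : 0 ≤ p) {x : ℕ → Fin n} {m : ℕ → ℝ} {k H : ℕ}
    (hx : Set.InjOn x (Set.Iic k)) (hH : 0 < H) :
    (sample n p).toOuterMeasure {S | ¬ HitsFunnels x m k H S} ≤
      ENNReal.ofReal (k * Real.exp (-(p * H))) := by
  classical
  set Q := (Finset.range k).filter fun a => a + 2 * H ≤ k ∧ ConRun m a (a + 2 * H) with hQ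
  set φ : ℕ → ℕ → ℕ := fun a i => if m (a + 2 * i) < 0 then a + 2 * i else a + 2 * i + 1 with hφ
  have hφb : ∀ a i, a + 2 * i ≤ φ a i ∧ φ a i ≤ a + 2 * i + 1 := by
    intro a i
    simp only [hφ]
    split_ifs <;> omega
  set A : ℕ → Finset (Fin n) := fun a => (Finset.range H).image fun i => x (φ a i) with hA
  have hcard : ∀ a ∈ Q, H ≤ (A a).card := by
    intro a ha
    obtain ⟨-, h1, -⟩ := Finset.mem_filter.1 ha
    rw [hA, Finset.card_image_of_injOn, Finset.card_range]
    intro i hi j hj hij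
    rw [Finset.coe_range, Set.mem_Iio] at hi hj
    have h2 := hφb a i
    have h3 := hφb a j
    have := hx (Set.mem_Iic.2 (by omega)) (Set.mem_Iic.2 (by omega)) hij
    omega
  have hsub : {S : Finset (Fin n) | ¬ HitsFunnels x m k H S} ⊆
      {S | ∃ a ∈ Q, ∀ v ∈ A a, v ∉ S} := by
    intro S hS
    by_contra h0
    refine hS fun a ha hr => ?_
    simp only [Set.mem_ofPred_eq] at h0
    push Not at h0
    obtain ⟨v, hv, hvS⟩ := h0 a (Finset.mem_filter.2 ⟨Finset.mem_range.2 (by omega), ha, hr⟩)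
    obtain ⟨i, hi, rfl⟩ := Finset.mem_image.1 hv
    have hi := Finset.mem_range.1 hi
    have h2 := hφb a i
    refine ⟨φ a i, by omega, by omega, ?_, hvS⟩
    simp only [hφ]
    split_ifs with h3
    · exact h3
    · have h4 := (hr (a + 2 * i + 1) (by omega) (by omega)).1
      rw [Nat.add_sub_cancel] at h4
      rcases mul_neg_iff.1 h4 with h | h
      · exact h.2
      · exact absurd h.1 h3
  refine (MeasureTheory.measure_mono hsub).trans ((sample_misses_family_le hp Q A hcard).trans ?_)
  refine ENNReal.ofReal_le_ofReal ?_
  have : (Q.card : ℝ) ≤ k := by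
    have := Finset.card_le_card (Finset.filter_subset (fun a => a + 2 * H ≤ k ∧
      ConRun m a (a + 2 * H)) (Finset.range k))
    rw [Finset.card_range] at this
    exact_mod_cast this
  have := Real.exp_pos (-(p * H))
  gcongr

/-! ### Compute-Funnels and the levels -/

lemma revPath_injOn {x : ℕ → Fin n} {k : ℕ} (hx : Set.InjOn x (Set.Iic k)) :
    Set.InjOn (revPath x k) (Set.Iic k) := by
  intro i hi j hj hij
  rw [Set.mem_Iic] at hi hj
  have := hx (Set.mem_Iic.2 (Nat.sub_le k i)) (Set.mem_Iic.2 (Nat.sub_le k j)) hij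
  omega

lemma length_lt_of_injOn {x : ℕ → Fin n} {k : ℕ} (hx : Set.InjOn x (Set.Iic k)) : k < n := by
  have := Finset.card_le_card_of_injOn (s := Finset.Iic k) (t := Finset.univ) x
    (fun _ _ => Finset.mem_coe.2 (Finset.mem_univ _)) (by simpa using hx)
  simpa using this

lemma funnels_complete {M : Table n} {x : ℕ → Fin n} {m : ℕ → ℝ} {k : ℕ}
    (hm : ∀ p < k, M (x p) (x (p + 1)) = (m p : Gain)) (hkn : k ≤ n) {q H : ℕ} (hq : 2 * H ≤ q)
    {S : Finset (Fin n)} (hS : HitsFunnels x m k H S)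
    (hS' : HitsFunnels (revPath x k) (revGain m k) k H S) : Complete M x m k (funnels M q S) := by
  refine ⟨funnels_bounded M q S, funnels_firstComplete hm hkn hq hS, ?_⟩
  rw [funnels_swap]
  exact funnels_firstComplete (revGain_eq hm) hkn hq hS'

lemma computeFunnels_not_complete_le {Θ : Params} {M : Table n} {x : ℕ → Fin n} {m : ℕ → ℝ}
    {k : ℕ} (hm : ∀ p < k, M (x p) (x (p + 1)) = (m p : Gain)) (hx : Set.InjOn x (Set.Iic k))
    {H : ℕ} (hH : 0 < H) (hq : 2 * H ≤ ⌈(n : ℝ) / (Θ.cFunnel * (n : ℝ) ^ Θ.β)⌉₊) {p : ℝ}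
    (hp : p = Θ.cSample * Real.logb 2 n * (Θ.cFunnel * (n : ℝ) ^ Θ.β) / n) (hp₀ : 0 ≤ p) :
    (computeFunnels Θ M).toOuterMeasure {D | ¬ Complete M x m k D} ≤
      ENNReal.ofReal (2 * (k * Real.exp (-(p * H)))) := by
  have h1 : computeFunnels Θ M = (sample n p).map
      (funnels M ⌈(n : ℝ) / (Θ.cFunnel * (n : ℝ) ^ Θ.β)⌉₊) := by
    rw [hp]; rfl
  rw [h1, PMF.toOuterMeasure_map_apply]
  have hsub : funnels M ⌈(n : ℝ) / (Θ.cFunnel * (n : ℝ) ^ Θ.β)⌉₊ ⁻¹' {D | ¬ Complete M x m k D} ⊆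
      {S | ¬ HitsFunnels x m k H S} ∪
        {S | ¬ HitsFunnels (revPath x k) (revGain m k) k H S} := by
    intro S hS
    by_contra h0
    rw [Set.mem_union, not_or] at h0
    simp only [Set.mem_ofPred_eq, not_not] at h0
    exact hS (funnels_complete hm (length_lt_of_injOn hx).le hq h0.1 h0.2)
  refine (MeasureTheory.measure_mono hsub).trans ((MeasureTheory.measure_union_le _ _).trans ?_)
  rw [two_mul, ENNReal.ofReal_add (by positivity) (by positivity)]
  exact add_le_add (sample_not_hitsFunnels_le hp₀ hx hH)
    (sample_not_hitsFunnels_le hp₀ (revPath_injOn hx) hH)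

/-- The probability with which Long-Shortcuts samples a vertex at level `i`. -/
def levelProb (n : ℕ) (Θ : Params) (i : ℕ) : ℝ :=
  Θ.cLevel * Real.logb 2 n ^ 2 / (2 ^ i * (n : ℝ) ^ Θ.α)

lemma longLevels_cons (Θ : Params) (M : Table n) (i : ℕ) (l : List ℕ) (D : DS n)
    (T : Finset (Fin n)) : longLevels Θ M (i :: l) D T =
      (sample n (levelProb n Θ i)).bind fun S =>
        longLevels Θ M l ((levelStep M S)^[2 ^ i] D) (T ∪ S) := rfl

lemma longLevels_grows {Θ : Params} {M : Table n} (l : List ℕ) {D : DS n} (hD : D.Bounded M)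
    {T : Finset (Fin n)} {s : DS n × Finset (Fin n)} (hs : s ∈ (longLevels Θ M l D T).support) :
    D.Le s.1 ∧ T ⊆ s.2 := by
  induction l generalizing D T with
  | nil =>
    simp only [longLevels, PMF.support_pure, Set.mem_singleton_iff] at hs
    rw [hs]
    exact ⟨DS.Le.refl D, subset_rfl⟩
  | cons i l ih =>
    rw [longLevels_cons, PMF.mem_support_bind_iff] at hs
    obtain ⟨S, -, hs⟩ := hs
    have h1 := iterate_spec (F := levelStep M S) (fun _ => levelStep_spec S) (2 ^ i) hD
    have h2 := ih h1.1 hs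
    exact ⟨h1.2.trans h2.1, Finset.subset_union_left.trans h2.2⟩

/-- The outcome of the main loop of Long-Shortcuts contains the outcome of level `i` for some
sample in `G`. -/
def LevelDone (M : Table n) (x : ℕ → Fin n) (m : ℕ → ℝ) (k i : ℕ) (G : Set (Finset (Fin n)))
    (D : DS n) (T : Finset (Fin n)) : Prop :=
  ∃ S ∈ G, S ⊆ T ∧ ∃ D₁, Complete M x m k D₁ ∧ ((levelStep M S)^[2 ^ i] D₁).Le D

/-- Only the sample of level `i` matters: the levels before it keep the data structure complete, and
those after it only raise entries and enlarge `T`. -/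
lemma longLevels_not_done_le {Θ : Params} {M : Table n} {x : ℕ → Fin n} {m : ℕ → ℝ} {k i : ℕ}
    (G : Set (Finset (Fin n))) {l : List ℕ} (hi : i ∈ l) {D : DS n} (hD : Complete M x m k D)
    (T : Finset (Fin n)) :
    (longLevels Θ M l D T).toOuterMeasure {s | ¬ LevelDone M x m k i G s.1 s.2} ≤
      (sample n (levelProb n Θ i)).toOuterMeasure Gᶜ := by
  induction l generalizing D T with
  | nil => simp at hi
  | cons i' l ih =>
    rw [longLevels_cons]
    have hspec := fun S => iterate_spec (F := levelStep M S) (fun _ => levelStep_spec S) (2 ^ i')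
      hD.bounded
    by_cases h : i = i'
    · subst h
      refine (toOuterMeasure_bind_le_add (δ := 0) _ _ _ Gᶜ fun S hS => ?_).trans (add_zero _).le
      refine (toOuterMeasure_eq_zero _ _ fun s hs hbad => ?_).le
      have h1 := longLevels_grows l (hspec S).1 hs
      exact hbad ⟨S, not_not.1 hS, Finset.subset_union_right.trans h1.2, D, hD, h1.1⟩
    · exact toOuterMeasure_bind_le _ _ _ fun S =>
        ih ((List.mem_cons.1 hi).resolve_left h) (hD.mono (hspec S).1 (hspec S).2) _

lemma longShortcuts_not_done_le {Θ : Params} {B : ℝ} {M : Table n} {x : ℕ → Fin n} {m : ℕ → ℝ}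
    {k i : ℕ} (G : Set (Finset (Fin n))) (hi : 1 ≤ i)
    (hi' : i ≤ ⌈Real.logb 2 ((n : ℝ) ^ (1 - Θ.α) * Real.logb 2 n ^ 2)⌉₊) :
    (longShortcuts Θ B M).toOuterMeasure {L | ¬ ∃ D T, LevelDone M x m k i G D T ∧
      L = (arcBoundedToMonotone B M T D).short} ≤
      (computeFunnels Θ M).toOuterMeasure {D | ¬ Complete M x m k D} +
        (sample n (levelProb n Θ i)).toOuterMeasure Gᶜ := by
  unfold longShortcuts
  refine toOuterMeasure_bind_le_add _ _ _ _ fun D hD => ?_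
  rw [PMF.toOuterMeasure_map_apply]
  refine (MeasureTheory.measure_mono ?_).trans (longLevels_not_done_le G
    (i := i) (by rw [List.mem_range'_1]; omega) (not_not.1 hD) ∅)
  intro s hs hdone
  exact hs ⟨s.1, s.2, hdone, rfl⟩

/-! ### The shortcuts found by Long-Shortcuts -/

section Skip

variable {B : ℝ} {M : Table n} {x : ℕ → Fin n} {k : ℕ} {m g : ℕ → ℝ} {Ev : Finset ℕ}

/-- A family of vertex sets of size `c` that a sample at level `j + 1` should hit. -/
lemma Profile.exists_family_forward (h : Profile B M x k g)
    (hm : ∀ p < k, M (x p) (x (p + 1)) = (m p : Gain)) (hx : Set.InjOn x (Set.Iic k))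
    (hw : Walk m g k Ev) (j c : ℕ) :
    ∃ (ρ : ℕ) (Q : Finset ℕ) (A : ℕ → Finset (Fin n)), Q.card ≤ ρ ∧ ρ * 2 ^ j ≤ Ev.card ∧
      (∀ r ∈ Q, (A r).card = c) ∧ ∀ D T,
        LevelDone M x m k (j + 1) {S | ∀ r ∈ Q, ∃ v ∈ A r, v ∈ S} D T →
        ∃ l, Skip (Covers (M ⊔ (arcBoundedToMonotone B M T D).short) x g) k l ∧
          l + (level m g k Ev (2 ^ j)).card ≤ k + (c + 1) * ρ := by
  obtain ⟨ρ, Q, H, h1, h2, h3, h4⟩ := hw.exists_skip_level (2 ^ j) c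
  -- These descents have fewer than `2 * 2 ^ j` events, so the `2 ^ (j + 1)` repetitions at level `j
  -- + 1` suffice.
  have hlev : ∀ r ∈ Q, ∀ e ∈ H r, e ∈ descents m k Ev ∧
      (eventsInside g k Ev e).card ≤ 2 ^ (j + 1) := fun r hr e he => by
    have := Finset.mem_filter.1 ((h3 r hr).2 he)
    exact ⟨this.1, by rw [pow_succ']; exact this.2.2.le⟩
  refine ⟨ρ, Q, fun r => (H r).image x, h1, h2, fun r hr => ?_, fun D T hdone => ?_⟩
  · rw [Finset.card_image_of_injOn, (h3 r hr).1]
    refine hx.mono fun e he => ?_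
    have := (mem_descents.1 (hlev r hr e he).1).2.1
    exact Set.mem_Iic.2 (by omega)
  · obtain ⟨S, hS, hST, D₁, hD₁, hD⟩ := hdone
    refine h4 _ (fun p hp => (h.arc p hp).trans le_sup_left) fun r hr => ?_
    obtain ⟨v, hv, hvS⟩ := hS r hr
    obtain ⟨e, he, rfl⟩ := Finset.mem_image.1 hv
    have h5 := hlev r hr e he
    obtain ⟨a, ha, ha', hcov⟩ := hw.covers_exit hm h.draw h5.1 (hST hvS)
      ((levelStep_exit hm hw h5.1 hvS hD₁ h5.2).trans (hD.1 _ _ _))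
    exact ⟨e, he, a, ha, ha', hcov.trans le_sup_right⟩

lemma Complete.rev {D : DS n} (h : Complete M x m k D) :
    Complete M.rev (revPath x k) (revGain m k) k D.swap := by
  refine ⟨h.bounded.swap, h.last, fun a b hab hb hr => ?_⟩
  have hm : ∀ p < k, revGain (revGain m k) k p = m p := fun p hp => by
    unfold revGain
    rw [show k - 1 - (k - 1 - p) = p by omega]
  have hxx : ∀ p ≤ k, revPath (revPath x k) k p = x p := fun p hp => by
    unfold revPath
    rw [show k - (k - p) = p by omega]
  have h1 := h.first a b hab hb fun p hap hpb => by
    have := hr p hap hpb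
    rwa [hm p (by omega), hm (p - 1) (by omega)] at this
  rw [hxx a (by omega), hxx (a + 1) (by omega), hxx b hb]
  have h2 : arcSum (revGain (revGain m k) k) a b = arcSum m a b :=
    Finset.sum_congr rfl fun p hp => hm p (by have := Finset.mem_Ico.1 hp; omega)
  rw [h2]
  exact h1

/-- The forward argument applies to the reversed path. The repetitions on `D` act on `D.swap` as the
same repetitions in the reversed graph, and `Skip.reverse` turns the shortcuts around again. -/
lemma Profile.exists_family_backward (h : Profile B M x k g)
    (hm : ∀ p < k, M (x p) (x (p + 1)) = (m p : Gain)) (hx : Set.InjOn x (Set.Iic k))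
    (hw : Walk (revGain m k) (revProfile g k) k Ev) (j c : ℕ) :
    ∃ (ρ : ℕ) (Q : Finset ℕ) (A : ℕ → Finset (Fin n)), Q.card ≤ ρ ∧ ρ * 2 ^ j ≤ Ev.card ∧
      (∀ r ∈ Q, (A r).card = c) ∧ ∀ D T,
        LevelDone M x m k (j + 1) {S | ∀ r ∈ Q, ∃ v ∈ A r, v ∈ S} D T →
        ∃ l, Skip (Covers (M ⊔ (arcBoundedToMonotone B M T D).short) x g) k l ∧
          l + (level (revGain m k) (revProfile g k) k Ev (2 ^ j)).card ≤ k + (c + 1) * ρ := by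
  obtain ⟨ρ, Q, H, h1, h2, h3, h4⟩ := hw.exists_skip_level (2 ^ j) c
  have hlev : ∀ r ∈ Q, ∀ e ∈ H r, e ∈ descents (revGain m k) k Ev ∧
      (eventsInside (revProfile g k) k Ev e).card ≤ 2 ^ (j + 1) := fun r hr e he => by
    have := Finset.mem_filter.1 ((h3 r hr).2 he)
    exact ⟨this.1, by rw [pow_succ']; exact this.2.2.le⟩
  refine ⟨ρ, Q, fun r => (H r).image (revPath x k), h1, h2, fun r hr => ?_, fun D T hdone => ?_⟩
  · rw [Finset.card_image_of_injOn, (h3 r hr).1]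
    refine (revPath_injOn hx).mono fun e he => ?_
    have := (mem_descents.1 (hlev r hr e he).1).2.1
    exact Set.mem_Iic.2 (by omega)
  · obtain ⟨S, hS, hST, D₁, hD₁, hD⟩ := hdone
    set A := Covers (M ⊔ (arcBoundedToMonotone B M T D).short) x g with hA
    obtain ⟨l, hl, hle⟩ := h4 (fun a b => A (k - b) (k - a)) (fun p hp => by
        rw [show k - p = k - (p + 1) + 1 by omega]
        exact (h.arc _ (by omega)).trans le_sup_left) fun r hr => by
      obtain ⟨v, hv, hvS⟩ := hS r hr
      obtain ⟨e, he, rfl⟩ := Finset.mem_image.1 hv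
      have h5 := hlev r hr e he
      have h6 := levelStep_exit (revGain_eq hm) hw h5.1 hvS hD₁.rev h5.2
      rw [← iterate_swap (levelStep_swap M S)] at h6
      obtain ⟨a, ha, ha', hcov⟩ := hw.covers_exit_rev hm h.draw h5.1 (hST hvS)
        (h6.trans (hD.swap.1 _ _ _))
      exact ⟨e, he, a, ha, ha', hcov.trans le_sup_right⟩
    refine ⟨l, hl.reverse fun a b hab hb hcov => ?_, hle⟩
    exact hcov

/-- Choose the direction with more descents and then a level with at least the average share.
Choosing the direction costs a factor 2, as does passing from arcs to descending arcs. The size `c`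
depends on `j` because the sampling probability does. -/
lemma Profile.exists_family (h : Profile B M x k g)
    (hm : ∀ p < k, M (x p) (x (p + 1)) = (m p : Gain)) (hx : Set.InjOn x (Set.Iic k))
    (hw : Walk m g k Ev) {L : ℕ} (hL : Ev.card < 2 ^ L) (hk : 3 + 2 * Ev.card < k) (c : ℕ → ℕ) :
    ∃ j < L, ∃ (ρ : ℕ) (Q : Finset ℕ) (A : ℕ → Finset (Fin n)), Q.card ≤ ρ ∧
      ρ * 2 ^ j ≤ Ev.card ∧ (∀ r ∈ Q, (A r).card = c j) ∧ ∀ D T,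
        LevelDone M x m k (j + 1) {S | ∀ r ∈ Q, ∃ v ∈ A r, v ∈ S} D T →
        ∃ l s, Skip (Covers (M ⊔ (arcBoundedToMonotone B M T D).short) x g) k l ∧
          l + s ≤ k + (c j + 1) * ρ ∧ k ≤ 3 + 2 * Ev.card + 4 * (L * s) := by
  have hcard := hw.card_descents
  have hrev : (revArcs Ev k).card ≤ Ev.card := Finset.card_image_le
  rcases le_total (descents (revGain m k) k (revArcs Ev k)).card (descents m k Ev).card with h1 | h1
  · rcases hw.exists_large_level hL with h2 | ⟨j, hj, h2⟩
    · have := Finset.card_eq_zero.2 h2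
      omega
    · obtain ⟨ρ, Q, A, h3, h4, h5, h6⟩ := h.exists_family_forward hm hx hw j (c j)
      refine ⟨j, hj, ρ, Q, A, h3, h4, h5, fun D T hdone => ?_⟩
      obtain ⟨l, hl, hle⟩ := h6 D T hdone
      exact ⟨l, _, hl, hle, by omega⟩
  · rcases hw.rev.exists_large_level (hrev.trans_lt hL) with h2 | ⟨j, hj, h2⟩
    · have := Finset.card_eq_zero.2 h2
      omega
    · obtain ⟨ρ, Q, A, h3, h4, h5, h6⟩ := h.exists_family_backward hm hx hw.rev j (c j)
      refine ⟨j, hj, ρ, Q, A, h3, h4.trans hrev, h5, fun D T hdone => ?_⟩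
      obtain ⟨l, hl, hle⟩ := h6 D T hdone
      exact ⟨l, _, hl, hle, by omega⟩

end Skip

/-! ### Success of Long-Shortcuts -/

lemma mul_exp_neg_le {n : ℕ} (hn : 2 ≤ n) {a t : ℝ} (ha : a ≤ n)
    (ht : 4 * Real.log n ≤ t) : a * Real.exp (-t) ≤ 1 / 8 := by
  have hn' : (2 : ℝ) ≤ n := by exact_mod_cast hn
  have h1 : Real.exp (-t) ≤ ((n : ℝ) ^ 4)⁻¹ := by
    rw [← Real.exp_log (show (0 : ℝ) < ((n : ℝ) ^ 4)⁻¹ by positivity), Real.log_inv, Real.log_pow]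
    exact Real.exp_le_exp.2 (by push_cast; linarith)
  calc a * Real.exp (-t) ≤ n * ((n : ℝ) ^ 4)⁻¹ :=
        mul_le_mul ha h1 (Real.exp_pos _).le (by positivity)
    _ = ((n : ℝ) ^ 3)⁻¹ := by field_simp
    _ ≤ ((2 : ℝ) ^ 3)⁻¹ := by gcongr
    _ = 1 / 8 := by norm_num

lemma log_le_logb_two {n : ℕ} (hn : 1 ≤ n) : Real.log n ≤ Real.logb 2 n := by
  have hn' : (1 : ℝ) ≤ n := by exact_mod_cast hn
  rw [Real.logb, le_div_iff₀ (Real.log_pos one_lt_two)]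
  have := Real.log_nonneg hn'
  have := Real.log_two_lt_d9
  nlinarith

lemma one_le_logb_two {n : ℕ} (hn : 2 ≤ n) : 1 ≤ Real.logb 2 n := by
  have hn' : (2 : ℝ) ≤ n := by exact_mod_cast hn
  rw [Real.le_logb_iff_rpow_le one_lt_two (by linarith), Real.rpow_one]
  exact hn'

/-- Bounds for the number of levels of Long-Shortcuts. -/
lemma levels_bounds {n : ℕ} (hn : 2 ≤ n) {α : ℝ} (hα₀ : 0 ≤ α) :
    (n : ℝ) ^ (1 - α) ≤
      2 ^ ⌈Real.logb 2 ((n : ℝ) ^ (1 - α) * Real.logb 2 n ^ 2)⌉₊ ∧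
    (⌈Real.logb 2 ((n : ℝ) ^ (1 - α) * Real.logb 2 n ^ 2)⌉₊ : ℝ) ≤ 4 * Real.logb 2 n := by
  have hn' : (2 : ℝ) ≤ n := by exact_mod_cast hn
  have hΛ := one_le_logb_two hn
  have hpos : (0 : ℝ) < (n : ℝ) ^ (1 - α) := Real.rpow_pos_of_pos (by linarith) _
  set Λ := Real.logb 2 n with hΛdef
  set y := Real.logb 2 ((n : ℝ) ^ (1 - α) * Λ ^ 2) with hy
  constructor
  · calc (n : ℝ) ^ (1 - α) ≤ (n : ℝ) ^ (1 - α) * Λ ^ 2 :=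
          le_mul_of_one_le_right hpos.le (one_le_pow₀ hΛ)
      _ = (2 : ℝ) ^ y := by
          rw [hy, Real.rpow_logb two_pos (by norm_num) (by positivity)]
      _ ≤ (2 : ℝ) ^ (⌈y⌉₊ : ℝ) := Real.rpow_le_rpow_of_exponent_le one_le_two (Nat.le_ceil y)
      _ = 2 ^ ⌈y⌉₊ := Real.rpow_natCast _ _
  · have h1 : y = (1 - α) * Λ + 2 * Real.logb 2 Λ := by
      rw [hy, Real.logb_mul hpos.ne' (by positivity), Real.logb_rpow_eq_mul_logb_of_pos (by linarith),
        Real.logb_pow]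
      push_cast
      rfl
    have h2 : Real.logb 2 Λ ≤ Λ := by
      rw [Real.logb_le_iff_le_rpow one_lt_two (by linarith)]
      have h4 := one_add_mul_self_le_rpow_one_add (s := 1) (by norm_num) hΛ
      norm_num at h4
      linarith
    have h3 : y ≤ 3 * Λ := by
      rw [h1]
      nlinarith
    rcases le_total y 0 with h4 | h4
    · rw [Nat.ceil_eq_zero.2 h4]
      push_cast
      linarith
    · have := Nat.ceil_lt_add_one h4
      linarith

/-- With `H = q / 2` and `q ≥ 2` one has `q ≤ 3 * H`. Hence `12 ≤ cSample` makes the exponent at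
least `4 log n`, and each direction fails with probability at most `1/8`. -/
lemma computeFunnels_success {Θ : Params} {M : Table n} {x : ℕ → Fin n} {m : ℕ → ℝ}
    {k : ℕ} (hm : ∀ p < k, M (x p) (x (p + 1)) = (m p : Gain)) (hx : Set.InjOn x (Set.Iic k))
    (hn : 2 ≤ n) (hF : 0 < Θ.cFunnel) (hFn : Θ.cFunnel * (n : ℝ) ^ Θ.β < n)
    (hS : 12 ≤ Θ.cSample) :
    (computeFunnels Θ M).toOuterMeasure {D | ¬ Complete M x m k D} ≤ ENNReal.ofReal (1 / 4) := by
  have hn' : (2 : ℝ) ≤ n := by exact_mod_cast hn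
  have hs : 0 < Θ.cFunnel * (n : ℝ) ^ Θ.β := mul_pos hF (Real.rpow_pos_of_pos (by linarith) _)
  set s := Θ.cFunnel * (n : ℝ) ^ Θ.β with hsdef
  have hΛ := one_le_logb_two hn
  have hq2 : 2 ≤ ⌈(n : ℝ) / s⌉₊ := by
    have : 1 < ⌈(n : ℝ) / s⌉₊ := by
      rw [Nat.lt_ceil, Nat.cast_one, lt_div_iff₀ hs]
      linarith
    exact this
  have hq := Nat.le_ceil ((n : ℝ) / s)
  set q := ⌈(n : ℝ) / s⌉₊ with hqdef
  obtain ⟨H, hH⟩ : ∃ H, H = q / 2 := ⟨_, rfl⟩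
  refine (computeFunnels_not_complete_le hm hx (H := H) (by omega)
    (by rw [← hsdef, ← hqdef]; omega) rfl
    (by positivity)).trans (ENNReal.ofReal_le_ofReal ?_)
  have hH3 : (q : ℝ) ≤ 3 * H := by
    have : q ≤ 3 * H := by omega
    exact_mod_cast this
  have h1 : (k : ℝ) ≤ n := by exact_mod_cast (length_lt_of_injOn hx).le
  have h2 := mul_exp_neg_le hn h1 (t := Θ.cSample * Real.logb 2 n * s / n * H) (by
    have h3 : (1 : ℝ) ≤ s / n * (3 * H) := by
      have : (n : ℝ) / s ≤ 3 * H := hq.trans hH3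
      rw [div_le_iff₀ hs] at this
      rw [div_mul_eq_mul_div, le_div_iff₀ (by linarith)]
      linarith
    calc 4 * Real.log n ≤ 4 * Real.logb 2 n := by
          have := log_le_logb_two (n := n) (by omega)
          linarith
      _ ≤ (Θ.cSample / 3) * Real.logb 2 n * 1 := by nlinarith
      _ ≤ (Θ.cSample / 3) * Real.logb 2 n * (s / n * (3 * H)) := by gcongr
      _ = Θ.cSample * Real.logb 2 n * s / n * H := by ring)
  linarith

/-- With so few events some level has at least `k / (32 log₂ n)` descents. Sets of size of order
`2^j n^α / log₂ n` are hit reliably at the rate of that level, and the `c + 1` arcs lost per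
outermost descent stay below the gain because `ρ * 2^j ≤ |Ev|`. -/
lemma longShortcuts_success {Θ : Params} {B : ℝ} {M : Table n} {x : ℕ → Fin n} {k : ℕ}
    {m g : ℕ → ℝ} {Ev : Finset ℕ} (h : Profile B M x k g)
    (hm : ∀ p < k, M (x p) (x (p + 1)) = (m p : Gain)) (hx : Set.InjOn x (Set.Iic k))
    (hw : Walk m g k Ev) (hn : 2 ≤ n) (hF : 0 < Θ.cFunnel)
    (hFn : Θ.cFunnel * (n : ℝ) ^ Θ.β < n) (hS : 12 ≤ Θ.cSample) (hT : 1 ≤ Θ.cLevel)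
    (hα : 0 < Θ.α) (hα' : Real.logb 2 n ≤ (n : ℝ) ^ Θ.α) (hk : 24 ≤ k)
    (hEv : 1024 * (n : ℝ) ^ Θ.α * Ev.card ≤ k) :
    (longShortcuts Θ B M).toOuterMeasure {L | ¬ ∃ l, Skip (Covers (M ⊔ L) x g) k l ∧
      (l : ℝ) ≤ (1 - 1 / (64 * Real.logb 2 n)) * k} ≤ ENNReal.ofReal (1 / 2) := by
  have hn' : (2 : ℝ) ≤ n := by exact_mod_cast hn
  have hk' : (24 : ℝ) ≤ k := by exact_mod_cast hk
  have hΛ := one_le_logb_two hn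
  have hΛ' := log_le_logb_two (n := n) (by omega)
  have hkn : (k : ℝ) ≤ n := by exact_mod_cast (length_lt_of_injOn hx).le
  obtain ⟨hL₁, hL₂⟩ := levels_bounds hn hα.le
  set L := ⌈Real.logb 2 ((n : ℝ) ^ (1 - Θ.α) * Real.logb 2 n ^ 2)⌉₊ with hL
  set Λ := Real.logb 2 n with hΛdef
  set A := (n : ℝ) ^ Θ.α with hA
  have hA1 : 1 ≤ A := hΛ.trans hα'
  set N : ℝ := (Ev.card : ℝ) with hN
  have hN0 : 0 ≤ N := Nat.cast_nonneg _
  have hNk : 1024 * N ≤ k := by nlinarith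
  have hNΛ : 1024 * (N * Λ) ≤ k := by nlinarith
  have hEvL : Ev.card < 2 ^ L := by
    have h1 : N < (n : ℝ) ^ (1 - Θ.α) := by
      rw [Real.rpow_sub (by linarith), Real.rpow_one, lt_div_iff₀ (by linarith)]
      nlinarith
    have h2 : N < ((2 ^ L : ℕ) : ℝ) := by
      push_cast
      linarith
    rw [hN] at h2
    exact_mod_cast h2
  have hEvk : 3 + 2 * Ev.card < k := by
    have : 3 + 2 * N < k := by linarith
    rw [hN] at this
    exact_mod_cast this
  obtain ⟨j, hj, ρ, Q, F, hQ, hρ, hF', hskip⟩ := h.exists_family hm hx hw hEvL hEvk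
    -- At level `j + 1` the expected number of hits in a set of this size is at least `cLevel * 4 *
    -- Λ`, before truncation of the sampling probability.
    fun j => ⌈4 * 2 ^ (j + 1) * A / Λ⌉₊
  set c := ⌈4 * 2 ^ (j + 1) * A / Λ⌉₊ with hc
  have hc₁ : 4 * 2 ^ (j + 1) * A / Λ ≤ c := Nat.le_ceil _
  have hc₂ : (c : ℝ) ≤ 4 * 2 ^ (j + 1) * A / Λ + 1 := (Nat.ceil_lt_add_one (by positivity)).le
  have hρN : (ρ : ℝ) * 2 ^ j ≤ N := by rw [hN]; exact_mod_cast hρ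
  have hρN' : (ρ : ℝ) ≤ N := by
    have : (1 : ℝ) ≤ 2 ^ j := one_le_pow₀ one_le_two
    have h0 : (0 : ℝ) ≤ ρ := Nat.cast_nonneg _
    nlinarith
  have hfail : (sample n (levelProb n Θ (j + 1))).toOuterMeasure
      {S | ∀ r ∈ Q, ∃ v ∈ F r, v ∈ S}ᶜ ≤ ENNReal.ofReal (1 / 8) := by
    have h1 : {S : Finset (Fin n) | ∀ r ∈ Q, ∃ v ∈ F r, v ∈ S}ᶜ =
        {S | ∃ r ∈ Q, ∀ v ∈ F r, v ∉ S} := by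
      ext S
      simp
    rw [h1]
    refine (sample_misses_family_le (c := c) (by unfold levelProb; positivity) Q F fun r hr =>
      (hF' r hr).ge).trans (ENNReal.ofReal_le_ofReal (mul_exp_neg_le hn ?_ ?_))
    · have : (Q.card : ℝ) ≤ ρ := by exact_mod_cast hQ
      linarith
    · calc 4 * Real.log n ≤ 4 * Λ := by linarith
        _ ≤ Θ.cLevel * (4 * Λ) := le_mul_of_one_le_left (by linarith) hT
        _ = levelProb n Θ (j + 1) * (4 * 2 ^ (j + 1) * A / Λ) := by
            unfold levelProb
            rw [← hΛdef, ← hA]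
            field_simp
        _ ≤ levelProb n Θ (j + 1) * c := by
            refine mul_le_mul_of_nonneg_left hc₁ ?_
            unfold levelProb
            positivity
  have hbound := (longShortcuts_not_done_le (B := B) (M := M) (x := x) (m := m) (k := k)
    {S | ∀ r ∈ Q, ∃ v ∈ F r, v ∈ S} (Nat.le_add_left 1 j) (show j + 1 ≤ _ from hj)).trans
    (add_le_add (computeFunnels_success hm hx hn hF hFn hS) hfail)
  rw [← ENNReal.ofReal_add (by norm_num) (by norm_num)] at hbound
  refine (MeasureTheory.measure_mono ?_).trans
    (hbound.trans (ENNReal.ofReal_le_ofReal (by norm_num)))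
  rintro _ hL' ⟨D, T, hdone, rfl⟩
  obtain ⟨l, s, hl, hls, hks⟩ := hskip D T hdone
  refine hL' ⟨l, hl, ?_⟩
  have h1 : (l : ℝ) + s ≤ k + (c + 1) * ρ := by exact_mod_cast hls
  have h2 : (k : ℝ) ≤ 3 + 2 * N + 4 * (L * s) := by rw [hN]; exact_mod_cast hks
  have hs0 : (0 : ℝ) ≤ s := Nat.cast_nonneg _
  have h3 : (L : ℝ) * s ≤ 4 * Λ * s := mul_le_mul_of_nonneg_right hL₂ hs0
  have h4 : (k : ℝ) / (32 * Λ) ≤ s := by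
    rw [div_le_iff₀ (by positivity)]
    nlinarith
  have h5 : ((c : ℝ) + 1) * ρ ≤ 8 * A * N / Λ + 2 * N := by
    calc ((c : ℝ) + 1) * ρ ≤ (4 * 2 ^ (j + 1) * A / Λ + 2) * ρ := by
          refine mul_le_mul_of_nonneg_right (by linarith) (Nat.cast_nonneg _)
      _ = 8 * A * (ρ * 2 ^ j) / Λ + 2 * ρ := by ring
      _ ≤ 8 * A * N / Λ + 2 * N := by gcongr
  have h6 : 8 * A * N / Λ ≤ k / 128 / Λ := by
    gcongr
    linarith
  have h7 : 2 * N ≤ k / 512 / Λ := by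
    rw [le_div_iff₀ (by linarith)]
    linarith
  -- In units of `k / (512 Λ)`: at least 16 gained, at most 4 + 1 lost, and 8 claimed.
  have h8 : (k : ℝ) / (32 * Λ) = 16 * (k / 512 / Λ) := by ring
  have h9 : (k : ℝ) / 128 / Λ = 4 * (k / 512 / Λ) := by ring
  have h10 : (1 - 1 / (64 * Λ)) * k = k - 8 * (k / 512 / Λ) := by ring
  have h11 : 0 ≤ (k : ℝ) / 512 / Λ := by positivity
  rw [h10]
  linarith

/-! ### The rounds of Update-Shortcuts -/

-- In a good round Long-Shortcuts is called with probability `min 1 p` and then succeeds with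
-- probability at least `1/2`, independently of earlier rounds since its input is deterministic.
-- Success is stated for all tables above both the current one and `L`, because this is what the
-- final table is known to satisfy.
open Classical in
lemma rounds_fail_le {Θ : Params} {B p : ℝ} (hp : 0 ≤ p) (G : Set (Table n)) (r : ℕ)
    (good : ℕ → Prop) (M M₀ : Table n)
    (hgood : ∀ j < r, good j →
      (longShortcuts Θ B ((shortShortcuts B)^[j] M)).toOuterMeasure
        {L | ¬ ∀ M', (∀ a b, (shortShortcuts B)^[j] M a b ≤ M' a b) → (∀ a b, L a b ≤ M' a b) →
          M' ∈ G} ≤ ENNReal.ofReal (1 / 2)) :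
    (rounds Θ B p r M M₀).toOuterMeasure Gᶜ ≤
      ENNReal.ofReal (Real.exp (-(min 1 p / 2))) ^
        ∑ j ∈ Finset.range r, (if good j then 1 else 0) := by
  induction r generalizing good M M₀ with
  | zero => simpa using toOuterMeasure_le_one _ _
  | succ r ih =>
    have hrest : ∀ M₁, (rounds Θ B p r (shortShortcuts B M) M₁).toOuterMeasure Gᶜ ≤
        ENNReal.ofReal (Real.exp (-(min 1 p / 2))) ^
          ∑ j ∈ Finset.range r, (if good (j + 1) then 1 else 0) := fun M₁ =>
      ih (fun j => good (j + 1)) (shortShortcuts B M) M₁ fun j hj hg =>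
        hgood (j + 1) (by omega) hg
    rw [Finset.sum_range_succ']
    set t := ∑ j ∈ Finset.range r, (if good (j + 1) then 1 else 0)
    set E := ENNReal.ofReal (Real.exp (-(min 1 p / 2))) with hE
    rw [rounds]
    by_cases h0 : good 0
    · rw [if_pos h0, pow_succ', toOuterMeasure_bind_coin]
      simp only [if_true, Bool.false_eq_true, if_false, PMF.pure_bind]
      have h1 : (((longShortcuts Θ B M).map fun L => M₀ ⊔ L).bind fun M' =>
          rounds Θ B p r (shortShortcuts B M) M').toOuterMeasure Gᶜ ≤
          ENNReal.ofReal (1 / 2) * E ^ t := by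
        rw [PMF.bind_map]
        refine (toOuterMeasure_bind_le_mul _ _ _ _ (fun L hL => ?_) fun L => hrest _).trans
          (mul_le_mul' (hgood 0 (Nat.succ_pos r) h0) le_rfl)
        refine toOuterMeasure_eq_zero _ _ fun M' hM' hbad => hbad ?_
        have h2 := le_of_mem_support_rounds r hM'
        refine not_not.1 hL M' (fun a b => ?_) fun a b => le_trans le_sup_right (h2.2 a b)
        exact (le_iterate_shortShortcuts B M (r + 1) a b).trans (h2.1 a b)
      have hq0 : 0 ≤ min 1 p := le_min zero_le_one hp
      have hq1 : min 1 p ≤ 1 := min_le_left _ _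
      calc _ ≤ ENNReal.ofReal (min 1 p) * (ENNReal.ofReal (1 / 2) * E ^ t) +
            (1 - ENNReal.ofReal (min 1 p)) * E ^ t :=
            add_le_add (mul_le_mul' le_rfl h1) (mul_le_mul' le_rfl (hrest _))
        _ = ENNReal.ofReal (1 - min 1 p / 2) * E ^ t := by
            rw [← mul_assoc, ← add_mul, ← ENNReal.ofReal_mul hq0, ← ENNReal.ofReal_one,
              ← ENNReal.ofReal_sub _ hq0, ← ENNReal.ofReal_add (by positivity) (by linarith)]
            congr 2
            ring
        _ ≤ E * E ^ t := by
            refine mul_le_mul' (ENNReal.ofReal_le_ofReal ?_) le_rfl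
            linarith [Real.add_one_le_exp (-(min 1 p / 2))]
    · rw [if_neg h0, add_zero]
      exact toOuterMeasure_bind_le _ _ _ fun b => toOuterMeasure_bind_le _ _ _ fun M₁ => hrest M₁

/-- A simple path with a tight profile in the table of a round, at least as good as the profile
`g` of the path `x 0, …, x k`. -/
structure RoundPath (B : ℝ) (M : Table n) (u w : Fin n) (gain : ℝ) (x : ℕ → Fin n) (k : ℕ)
    (m g : ℕ → ℝ) : Prop where
  profile : Profile B M x k g
  gains : ∀ p < k, M (x p) (x (p + 1)) = (m p : Gain)
  tight : Tight m g k
  inj : Set.InjOn x (Set.Iic k)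
  start : x 0 = u
  finish : x k = w
  gain_le : gain ≤ g k

lemma exists_roundPath {B : ℝ} (hB : 0 < B) {M : Table n} {x : ℕ → Fin n} {k : ℕ} {g : ℕ → ℝ}
    (h : Profile B M x k g) (hx : Set.InjOn x (Set.Iic k)) {gain : ℝ} (hg : gain ≤ g k) :
    ∃ m G, RoundPath B M (x 0) (x k) gain x k m G := by
  obtain ⟨m, G, h1, h2, h3, h4⟩ := h.exists_tight hB
  exact ⟨m, G, h1, h3, h4, hx, rfl, rfl, hg.trans h2⟩

/-- The events play two roles: they limit the structure of the current walk and they shorten the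
next path. The new profile is made tight again for the new arcs. -/
lemma RoundPath.exists_next {B : ℝ} (hB : 0 < B) {M : Table n} {u w : Fin n} {gain : ℝ}
    {x : ℕ → Fin n} {k : ℕ} {m g : ℕ → ℝ} (h : RoundPath B M u w gain x k m g) :
    ∃ x' k' m' g', RoundPath B (shortShortcuts B M) u w gain x' k' m' g' ∧
      ∃ Ev : Finset ℕ, Walk m g k Ev ∧ 3 * k' + Ev.card ≤ 3 * k := by
  classical
  obtain ⟨l, hl, hle⟩ := h.profile.exists_skip_events
  obtain ⟨x', g', h1, h2, h3, h4, h5⟩ := h.profile.skip hl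
  obtain ⟨m', G', h6⟩ := exists_roundPath hB h1 (h5 h.inj) (gain := gain) (by
    rw [h2]; exact h.gain_le)
  rw [h3, h4, h.start, h.finish] at h6
  refine ⟨x', l, m', G', h6, _, Walk.of_profile h.profile h.gains h.tight ?_, hle⟩
  intro p hp₀ hp hev
  exact Finset.mem_filter.2 ⟨Finset.mem_range.2 (by omega), hp₀, hp, hev⟩

/-- Short-Shortcuts uses no randomness, so the paths of all rounds, and with them the good rounds,
are fixed in advance. -/
lemma exists_roundPaths {B : ℝ} (hB : 0 < B) {M : Table n} {u w : Fin n} {gain : ℝ}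
    {x : ℕ → Fin n} {k : ℕ} {m g : ℕ → ℝ} (h : RoundPath B M u w gain x k m g) :
    ∃ (x : ℕ → ℕ → Fin n) (l : ℕ → ℕ) (m g : ℕ → ℕ → ℝ) (Ev : ℕ → Finset ℕ), l 0 = k ∧
      ∀ j, RoundPath B ((shortShortcuts B)^[j] M) u w gain (x j) (l j) (m j) (g j) ∧
        Walk (m j) (g j) (l j) (Ev j) ∧ 3 * l (j + 1) + (Ev j).card ≤ 3 * l j := by
  let State := (ℕ → Fin n) × ℕ × (ℕ → ℝ) × (ℕ → ℝ)
  let P : ℕ → State → Prop := fun j s =>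
    RoundPath B ((shortShortcuts B)^[j] M) u w gain s.1 s.2.1 s.2.2.1 s.2.2.2
  have hstep : ∀ j, ∀ s : State, P j s → ∃ s' : State, P (j + 1) s' ∧
      ∃ Ev : Finset ℕ, Walk s.2.2.1 s.2.2.2 s.2.1 Ev ∧ 3 * s'.2.1 + Ev.card ≤ 3 * s.2.1 := by
    intro j s hs
    obtain ⟨x', k', m', g', h1, h2⟩ := hs.exists_next hB
    refine ⟨⟨x', k', m', g'⟩, ?_, h2⟩
    change RoundPath B ((shortShortcuts B)^[j + 1] M) u w gain x' k' m' g'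
    rw [Function.iterate_succ_apply']
    exact h1
  have : Nonempty State := ⟨(x, k, m, g)⟩
  choose! f hf hEv using hstep
  choose! Ev hEv using hEv
  let seq : ℕ → State := fun j => Nat.rec (x, k, m, g) (fun j s => f j s) j
  have hseq : ∀ j, P j (seq j) := by
    intro j
    induction j with
    | zero => exact h
    | succ j ih => exact hf j _ ih
  exact ⟨fun j => (seq j).1, fun j => (seq j).2.1, fun j => (seq j).2.2.1,
    fun j => (seq j).2.2.2, fun j => Ev j (seq j), rfl, fun j => ⟨hseq j, hEv j _ (hseq j)⟩⟩

/-- The tables with a monotone path of at most `b` arcs from `u` to `w` whose gain is at least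
`gain`. -/
def shortened (B : ℝ) (u w : Fin n) (gain : Gain) (b : ℝ) : Set (Table n) :=
  {M' | ∃ (v' : ℕ → Fin n) (k' : ℕ) (C' : ℕ → ℝ), IsMonotonePath B M' v' k' C' ∧ v' 0 = u ∧
    v' k' = w ∧ gain ≤ gainAt M' v' C' k' ∧ (k' : ℝ) ≤ b}

lemma Profile.mem_shortened {B : ℝ} {M : Table n} {x : ℕ → Fin n} {k : ℕ} {g : ℕ → ℝ}
    (h : Profile B M x k g) {u w : Fin n} (hu : x 0 = u) (hw : x k = w) {gain : Gain}
    (hg : gain ≤ (g k : Gain)) {b : ℝ} (hb : (k : ℝ) ≤ b) : M ∈ shortened B u w gain b := by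
  obtain ⟨C, hC, hgain⟩ := h.isMonotonePath
  exact ⟨x, k, C, hC, hu, hw, hgain ▸ hg, hb⟩

lemma ofReal_one_sub_le {α : Type} (p : PMF α) (s : Set α) {ε : ℝ} (hε : 0 ≤ ε)
    (h : p.toOuterMeasure sᶜ ≤ ENNReal.ofReal ε) :
    ENNReal.ofReal (1 - ε) ≤ p.toOuterMeasure s := by
  rw [ENNReal.ofReal_sub _ hε, ENNReal.ofReal_one, ← toOuterMeasure_add_compl p s]
  rw [tsub_le_iff_right]
  exact add_le_add le_rfl h

/-- For boundedly many vertices, the one arc that a single round is sure to save is already a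
sufficient fraction. -/
lemma shortened_of_few_vertices {Θ : Params} {B : ℝ} {M : Table n} {x : ℕ → Fin n} {k r : ℕ}
    {g : ℕ → ℝ} (h : Profile B M x k g) (hr : 0 < r) (hk : 2 ≤ k) {gain : Gain}
    (hg : gain ≤ (g k : Gain)) {b p : ℝ} (hb : (k : ℝ) - 1 ≤ b) :
    (rounds Θ B p r M M).toOuterMeasure (shortened B (x 0) (x k) gain b)ᶜ = 0 := by
  refine toOuterMeasure_eq_zero _ _ fun M' hM' hbad => hbad ?_
  obtain ⟨x', k', g', h1, h2, h3, h4, h5⟩ := exists_profile_iterate h r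
  refine (h1.mono_table (le_of_mem_support_rounds r hM').1).mem_shortened h3 h4 (h2 ▸ hg) ?_
  have : k' + 1 ≤ k := by omega
  have : (k' : ℝ) + 1 ≤ k := by exact_mod_cast this
  linarith

open Filter in
lemma exists_threshold {α β cFunnel d : ℝ} (hα : 0 < α) (hβ : β < 1) (hd : 0 < d) :
    ∃ n₀ : ℕ, 3 ≤ n₀ ∧ ∀ n : ℕ, n₀ ≤ n → Real.logb 2 n ≤ (n : ℝ) ^ α ∧ 48 ≤ (n : ℝ) ^ α ∧
      cFunnel * (n : ℝ) ^ β < n ∧ 4 * d * Real.log n ≤ (n : ℝ) ^ α := by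
  have hlog : ∀ c : ℝ, 0 < c → ∀ᶠ n : ℕ in atTop, Real.log n ≤ c * (n : ℝ) ^ α := by
    intro c hc
    filter_upwards [tendsto_natCast_atTop_atTop.eventually ((isLittleO_log_rpow_atTop hα).def hc)]
      with n hn
    rw [Real.norm_of_nonneg (Real.rpow_nonneg (Nat.cast_nonneg n) α)] at hn
    exact (le_abs_self _).trans hn
  have h2 : 0 < Real.log 2 := Real.log_pos one_lt_two
  have h3 : ∀ᶠ n : ℕ in atTop, 48 ≤ (n : ℝ) ^ α :=
    ((tendsto_rpow_atTop hα).comp tendsto_natCast_atTop_atTop).eventually_ge_atTop 48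
  have h4 : ∀ᶠ n : ℕ in atTop, cFunnel < (n : ℝ) ^ (1 - β) :=
    ((tendsto_rpow_atTop (by linarith)).comp tendsto_natCast_atTop_atTop).eventually_gt_atTop _
  obtain ⟨n₀, hn₀⟩ := eventually_atTop.1 ((hlog _ h2).and ((hlog (1 / (4 * d)) (by positivity)).and
    (h3.and h4)))
  refine ⟨max n₀ 3, le_max_right _ _, fun n hn => ?_⟩
  obtain ⟨h5, h6, h7, h8⟩ := hn₀ n ((le_max_left _ _).trans hn)
  have hn3 : (0 : ℝ) < n := by
    have : 0 < n := by omega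
    exact_mod_cast this
  refine ⟨?_, h7, ?_, ?_⟩
  · rw [Real.logb, div_le_iff₀ h2]
    linarith
  · calc cFunnel * (n : ℝ) ^ β < (n : ℝ) ^ (1 - β) * (n : ℝ) ^ β :=
        mul_lt_mul_of_pos_right h8 (Real.rpow_pos_of_pos hn3 β)
      _ = n := by rw [← Real.rpow_add hn3, sub_add_cancel, Real.rpow_one]
  · calc 4 * d * Real.log n ≤ 4 * d * (1 / (4 * d) * (n : ℝ) ^ α) := by gcongr
      _ = (n : ℝ) ^ α := by field_simp

open Classical in
/-- If the rounds of Short-Shortcuts do not shorten a path much, then at least half of them see few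
events. -/
lemma card_good_rounds {l N : ℕ → ℕ} {r : ℕ} (hl : ∀ j, 3 * l (j + 1) + N j ≤ 3 * l j)
    {A ε : ℝ} (hA : 0 < A) (hr : A ≤ r) (hε : ε ≤ 1 / 12288)
    (hlr : (1 - ε) * l 0 < l r) :
    (r : ℝ) / 2 ≤ ∑ j ∈ Finset.range r, (if 1024 * A * N j ≤ l j then 1 else 0 : ℕ) := by
  have hmono : ∀ j i, l (j + i) ≤ l j := fun j i => by
    induction i with
    | zero => exact le_rfl
    | succ i ih => have := hl (j + i); rw [← add_assoc]; omega
  have hsum : ∀ j, 3 * l j + ∑ i ∈ Finset.range j, N i ≤ 3 * l 0 := fun j => by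
    induction j with
    | zero => simp
    | succ j ih => rw [Finset.sum_range_succ]; have := hl j; omega
  have h1 : (l r : ℝ) ≤ l 0 := by
    have := hmono 0 r
    rw [zero_add] at this
    exact_mod_cast this
  have hl0 : (0 : ℝ) < l 0 := by
    by_contra! h0
    have h2 : (l 0 : ℝ) = 0 := le_antisymm h0 (Nat.cast_nonneg _)
    have h3 : (0 : ℝ) ≤ l r := Nat.cast_nonneg _
    rw [h2] at h1 hlr
    linarith
  -- A bad round has more than `l j / (1024 A)` events, where `l j` is at least half of `l 0`.
  have hterm : ∀ j ∈ Finset.range r, (l 0 : ℝ) / 2 -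
      (l 0 : ℝ) / 2 * (if 1024 * A * N j ≤ l j then 1 else 0 : ℕ) ≤ 1024 * A * N j := by
    intro j hj
    split_ifs with h2
    · have : 0 ≤ 1024 * A * N j := by positivity
      push_cast
      linarith
    · have h3 : (l r : ℝ) ≤ l j := by
        have := hmono j (r - j)
        rw [Nat.add_sub_cancel' (Finset.mem_range.1 hj).le] at this
        exact_mod_cast this
      push_cast
      nlinarith
  have htot := Finset.sum_le_sum hterm
  rw [Finset.sum_sub_distrib, Finset.sum_const, Finset.card_range, nsmul_eq_mul, ← Finset.mul_sum,
    ← Finset.mul_sum] at htot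
  have h3 : 3 * (l r : ℝ) + ∑ i ∈ Finset.range r, (N i : ℝ) ≤ 3 * l 0 := by
    exact_mod_cast hsum r
  -- All rounds together see at most `3 * ε * l 0` events, and `12288 = 4 * 3 * 1024`.
  have h4 : 1024 * A * ∑ i ∈ Finset.range r, (N i : ℝ) ≤ A * (l 0 / 4) := by
    have h5 : ∑ i ∈ Finset.range r, (N i : ℝ) ≤ 3 * (1 / 12288) * l 0 := by nlinarith
    nlinarith
  have h6 : A * ((l 0 : ℝ) / 4) ≤ r * (l 0 / 4) := by gcongr
  push_cast at htot ⊢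
  have h7 : (l 0 : ℝ) * (r / 2) ≤
      l 0 * ∑ j ∈ Finset.range r, (if 1024 * A * N j ≤ l j then (1 : ℝ) else 0) := by
    linarith
  exact le_of_mul_le_mul_left h7 hl0

/-- If Short-Shortcuts has not shortened the path enough by itself, then half of the rounds are
good, and every path of a round still has nearly `k` arcs. A success in any one of them suffices. -/
lemma rounds_success {Θ : Params} {B : ℝ} (hB : 0 < B) {M : Table n} {x : ℕ → Fin n} {k r : ℕ}
    {g : ℕ → ℝ} (h : Profile B M x k g) (hx : Set.InjOn x (Set.Iic k)) {d c : ℝ}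
    (hn : 3 ≤ n) (hα : 0 < Θ.α) (hF : 0 < Θ.cFunnel) (hd : 0 < d) (hL : 4 * d ≤ Θ.cLong)
    (hS : 12 ≤ Θ.cSample) (hT : 1 ≤ Θ.cLevel) (h₁ : Real.logb 2 n ≤ (n : ℝ) ^ Θ.α)
    (h₂ : 48 ≤ (n : ℝ) ^ Θ.α) (h₃ : Θ.cFunnel * (n : ℝ) ^ Θ.β < n)
    (h₄ : 4 * d * Real.log n ≤ (n : ℝ) ^ Θ.α) (hc₀ : 0 < c) (hc : c ≤ 1 / 12288)
    (hc' : c ≤ Real.log 2 / 64) (hr : (n : ℝ) ^ Θ.α ≤ r) (hk : (n : ℝ) ^ Θ.α < k) :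
    (rounds Θ B (Θ.cLong * Real.logb 2 n / r) r M M).toOuterMeasure
      (shortened B (x 0) (x k) (g k : Gain) ((1 - c / Real.log n) * k))ᶜ ≤
      ENNReal.ofReal ((n : ℝ) ^ (-d)) := by
  classical
  have hn' : (3 : ℝ) ≤ n := by exact_mod_cast hn
  have hlog : 1 ≤ Real.log n := by
    rw [Real.le_log_iff_exp_le (by linarith)]
    exact Real.exp_one_lt_three.le.trans hn'
  have hΛ := one_le_logb_two (n := n) (by omega)
  have hlogΛ := log_le_logb_two (n := n) (by omega)
  have hε : c / Real.log n ≤ 1 / 12288 := (div_le_self hc₀.le hlog).trans hc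
  have hr0 : (0 : ℝ) < r := by linarith
  obtain ⟨m₀, G₀, hG₀⟩ := exists_roundPath hB h hx le_rfl
  obtain ⟨X, l, m, G, Ev, hl0, hseq⟩ := exists_roundPaths hB hG₀
  have hlen := fun j => (hseq j).2.2
  have hGgain : ∀ j, (g k : Gain) ≤ (G j (l j) : Gain) := fun j =>
    WithBot.coe_le_coe.2 (hseq j).1.gain_le
  have hmono : ∀ j i, l (j + i) ≤ l j := fun j i => by
    induction i with
    | zero => exact le_rfl
    | succ i ih => have := hlen (j + i); rw [← add_assoc]; omega
  by_cases hdone : (l r : ℝ) ≤ (1 - c / Real.log n) * k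
  · refine (toOuterMeasure_eq_zero _ _ fun M' hM' hbad => ?_).le.trans bot_le
    exact hbad (((hseq r).1.profile.mono_table (le_of_mem_support_rounds r hM').1).mem_shortened
      (hseq r).1.start (hseq r).1.finish (hGgain r) hdone)
  have hlr : (1 - c / Real.log n) * l 0 < l r := by rw [hl0]; exact not_le.1 hdone
  have hgoodcount := card_good_rounds (N := fun j => (Ev j).card) hlen
    (show 0 < (n : ℝ) ^ Θ.α by linarith) hr hε hlr
  set p := Θ.cLong * Real.logb 2 n / r with hp
  have hp0 : 0 ≤ p := by
    have : 0 ≤ Θ.cLong := by linarith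
    positivity
  have hfail := rounds_fail_le (Θ := Θ) (B := B) hp0
    (shortened B (x 0) (x k) (g k : Gain) ((1 - c / Real.log n) * k)) r
    (fun j => 1024 * (n : ℝ) ^ Θ.α * (Ev j).card ≤ l j) M M (fun j hj hgood => by
      have hlj : (l r : ℝ) ≤ l j := by
        have := hmono j (r - j)
        rw [Nat.add_sub_cancel' hj.le] at this
        exact_mod_cast this
      have hlk : (l j : ℝ) ≤ k := by
        have := hmono 0 j
        rw [zero_add, hl0] at this
        exact_mod_cast this
      have hl24 : 24 ≤ l j := by
        have : (24 : ℝ) ≤ l j := by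
          rw [hl0] at hlr
          nlinarith
        exact_mod_cast this
      refine (MeasureTheory.measure_mono ?_).trans (longShortcuts_success (hseq j).1.profile
        (hseq j).1.gains (hseq j).1.inj (hseq j).2.1 (by omega) hF h₃ hS hT hα h₁ hl24 hgood)
      rintro L hbad ⟨s, hs, hsl⟩
      refine hbad fun M' hM' hLM' => ?_
      obtain ⟨x', g', h5, h6, h7, h8, -⟩ := ((hseq j).1.profile).skip (M' := M')
        (hs.mono fun a b _ _ hab => hab.trans (sup_le (hM' _ _) (hLM' _ _)))
      refine h5.mem_shortened (h7.trans (hseq j).1.start) (h8.trans (hseq j).1.finish)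
        (h6 ▸ hGgain j) (hsl.trans ?_)
      -- Here the logarithm changes from base 2 to base `e`, which explains the bound `c ≤ log 2 /
      -- 64`.
      have h9 : c / Real.log n ≤ 1 / (64 * Real.logb 2 n) := by
        rw [Real.logb, div_le_div_iff₀ (by linarith) (by
          have := Real.log_pos one_lt_two
          positivity)]
        have h10 : 0 < Real.log 2 := Real.log_pos one_lt_two
        have h11 : c * (64 * (Real.log n / Real.log 2)) = (64 * c / Real.log 2) * Real.log n := by
          ring
        rw [h11]
        refine mul_le_mul_of_nonneg_right ?_ (by linarith)
        rw [div_le_one h10]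
        linarith
      have h12 : 1 / (64 * Real.logb 2 n) ≤ 1 := by
        rw [div_le_one (by positivity)]
        linarith
      exact mul_le_mul (by linarith) hlk (Nat.cast_nonneg _) (by linarith))
  refine hfail.trans ?_
  rw [← ENNReal.ofReal_pow (Real.exp_pos _).le, ← Real.exp_nat_mul,
    Real.rpow_def_of_pos (show (0 : ℝ) < n by linarith) (-d)]
  refine ENNReal.ofReal_le_ofReal (Real.exp_le_exp.2 ?_)
  -- At least `r / 2` good rounds contribute `min 1 p / 2` each to the exponent. If the coin is
  -- truncated, `r ≥ n^α` is large enough; otherwise `4 * d ≤ cLong` is used.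
  have hmin : 4 * d * Real.log n ≤ min 1 p * r := by
    rw [min_mul_of_nonneg _ _ hr0.le]
    refine le_min (by linarith) ?_
    rw [hp, div_mul_cancel₀ _ hr0.ne']
    nlinarith
  have hq0 : 0 ≤ min 1 p := le_min zero_le_one hp0
  nlinarith [mul_le_mul_of_nonneg_left hgoodcount hq0]

end EnergyPaths

end

/-! ### Choice of the constants -/

open EnergyPaths
theorem mainTheorem4 (α β : ℝ) (hα₀ : 0 < α) (hα₁ : α < 1) (hβ₀ : 0 < β) (hβ₁ : β < 1)
    (cRounds cFunnel : ℝ) (hRounds : 1 ≤ cRounds) (hFunnel : 0 < cFunnel)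
    (d : ℝ) (hd : 0 < d) :
    ∃ K : ℝ, 0 < K ∧ ∀ cLong cSample cLevel : ℝ, K ≤ cLong → K ≤ cSample → K ≤ cLevel →
      ∃ c : ℝ, 0 < c ∧
        ∀ (n : ℕ) (B : ℝ), 0 < B →
        ∀ M : Table n, (∀ x, 0 ≤ M x x) →
        ∀ (v : ℕ → Fin n) (k : ℕ) (C : ℕ → ℝ),
          IsSimplePath v k → IsMonotonePath B M v k C →
          ((k : ℝ) ≤ (n : ℝ) ^ α →
            ∀ M' ∈ (updateShortcuts
                ⟨α, β, cRounds, cFunnel, cLong, cSample, cLevel⟩ B M).support,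
              gainAt M v C k ≤ M' (v 0) (v k)) ∧
          ((n : ℝ) ^ α < (k : ℝ) →
            ENNReal.ofReal (1 - (n : ℝ) ^ (-d)) ≤
              (updateShortcuts
                ⟨α, β, cRounds, cFunnel, cLong, cSample, cLevel⟩ B M).toOuterMeasure
                {M' | ∃ (v' : ℕ → Fin n) (k' : ℕ) (C' : ℕ → ℝ),
                  IsMonotonePath B M' v' k' C' ∧ v' 0 = v 0 ∧ v' k' = v k ∧
                  gainAt M v C k ≤ gainAt M' v' C' k' ∧
                  (k' : ℝ) ≤ (1 - c / Real.log n) * k}) := by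
  refine ⟨max 12 (4 * d), by positivity, fun cLong cSample cLevel hL hS hT => ?_⟩
  obtain ⟨n₀, hn₀, hthr⟩ := exists_threshold (cFunnel := cFunnel) hα₀ hβ₁ hd
  have hn₀' : (3 : ℝ) ≤ n₀ := by exact_mod_cast hn₀
  have hlog2 : 0 < Real.log 2 := Real.log_pos one_lt_two
  -- The last term serves `n < n₀`: there `c / log n * k ≤ 1`, so one saved arc is enough.
  refine ⟨min (1 / 12288) (min (Real.log 2 / 64) (Real.log 2 / n₀)), by positivity,
    fun n B hB M hM v k C hv hC => ⟨fun hk M' hM' => gain_le_of_short hRounds hB hM hC hk M' hM',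
      fun hk => ?_⟩⟩
  set c := min (1 / 12288) (min (Real.log 2 / 64) (Real.log 2 / n₀)) with hc
  obtain ⟨g, hg, hgain⟩ := Profile.of_isMonotonePath hB hC
  have hkn : k < n := length_lt_of_injOn hv
  have hn1 : (1 : ℝ) ≤ n := by
    have : 1 ≤ n := by omega
    exact_mod_cast this
  have hpow : 1 ≤ (n : ℝ) ^ α := Real.one_le_rpow hn1 hα₀.le
  have hk2 : 2 ≤ k := by
    have : (1 : ℝ) < k := by linarith
    have : 1 < k := by exact_mod_cast this
    exact this
  refine ofReal_one_sub_le _ _ (Real.rpow_nonneg (by linarith) _) ?_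
  change PMF.toOuterMeasure _
    (shortened B (v 0) (v k) (gainAt M v C k) ((1 - c / Real.log n) * k))ᶜ ≤ _
  have hr : (n : ℝ) ^ α ≤ (⌈cRounds * (n : ℝ) ^ α⌉₊ : ℝ) :=
    (le_mul_of_one_le_left (by linarith) hRounds).trans (Nat.le_ceil _)
  unfold updateShortcuts
  dsimp only
  set r := ⌈cRounds * (n : ℝ) ^ α⌉₊ with hrdef
  rcases Nat.lt_or_ge n n₀ with hlt | hge
  · have hr0 : 0 < r := by
      have : (0 : ℝ) < r := by linarith
      exact_mod_cast this
    refine (shortened_of_few_vertices hg hr0 hk2 hgain ?_).le.trans bot_le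
    have hlog : Real.log 2 ≤ Real.log n := by
      refine Real.log_le_log two_pos ?_
      have : 2 ≤ n := by omega
      exact_mod_cast this
    have hc₁ : c / Real.log n ≤ 1 / n₀ := by
      rw [div_le_div_iff₀ (by linarith) (by linarith)]
      have : c ≤ Real.log 2 / n₀ := (min_le_right _ _).trans (min_le_right _ _)
      rw [le_div_iff₀ (by linarith)] at this
      linarith
    have hkn₀ : (k : ℝ) ≤ n₀ := by
      have : k ≤ n₀ := by omega
      exact_mod_cast this
    have : c / Real.log n * k ≤ 1 := by
      calc c / Real.log n * k ≤ 1 / n₀ * n₀ := by gcongr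
        _ = 1 := by field_simp
    linarith
  · obtain ⟨h₁, h₂, h₃, h₄⟩ := hthr n hge
    refine (MeasureTheory.measure_mono (Set.compl_subset_compl.2 ?_)).trans (rounds_success
      (Θ := ⟨α, β, cRounds, cFunnel, cLong, cSample, cLevel⟩) (c := c) (d := d) (r := r) hB hg hv
      (by omega) hα₀ hFunnel hd ((le_max_right _ _).trans hL) ((le_max_left _ _).trans hS)
      (le_trans (by norm_num) ((le_max_left _ _).trans hT)) h₁ h₂ h₃ h₄ (by positivity)
      (min_le_left _ _) ((min_le_right _ _).trans (min_le_left _ _)) hr hk)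
    rintro M' ⟨v', k', C', h5, h6, h7, h8, h9⟩
    exact ⟨v', k', C', h5, h6, h7, hgain.trans h8, h9⟩
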